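/- **Setting.** Fix $G,m_0,m_1,m_2,\omega>0$. For $0<\varepsilon\le 1$ consider the planar planetary problem of a star of mass $m_0$ and two planets of masses $\varepsilon m_1,\varepsilon m_2$. Put $\beta_j=\frac{m_0m_j}{m_0+\varepsilon m_j}$, $\mu_j=G(m_0+\varepsilon m_j)$, let $\Lambda_j^0>0$ be defined by $\mu_j^2\beta_j^3/(\Lambda_j^0)^3=\omega$, and for $\Delta>0$ let $\delta=\sin\!\left(\frac{\Delta}{2}\right)\min_j\frac{(\Lambda_j^0)^2}{\beta_j^2\mu_j}$. In rescaled heliocentric variables $(R_j,r_j)$ the Hamiltonian is $\mathcal H_K+\varepsilon\mathcal H_P$ with $\mathcal H_K=\sum_j\left(\frac{|R_j|^2}{2\beta_j}-\frac{\mu_j\beta_j}{|r_j|}\right)$, $\mathcal H_P=\frac{R_1\cdot R_2}{m_0}-\frac{Gm_1m_2}{|r_1-r_2|}$. In Poincaré's variables $\lambda_j$, $\Lambda_j=\beta_j\sqrt{\mu_ja_j}$, $x_j=\sqrt{\Lambda_j}\sqrt{1-\sqrt{1-e_j^2}}\,e^{i\varpi_j}$, $-i\bar x_j$, and then in the resonant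 variables $\zeta_1=\lambda_1-\lambda_2$, $\zeta_2=\lambda_2$, $Z_1=\Lambda_1-\Lambda_1^0$, $Z_2=\Lambda_1-\Lambda_1^0+\Lambda_2-\Lambda_2^0$, it becomes $H=H_K+H_P$ with $$H_K(Z)=-\frac{\beta_1^3\mu_1^2}{2(\Lambda_1^0+Z_1)^2}-\frac{\beta_2^3\mu_2^2}{2(\Lambda_2^0-Z_1+Z_2)^2}$$ and $H_P$ equal to $\varepsilon\mathcal H_P$ expressed in the variables $(\zeta_j,Z_j,x_j,-i\bar x_j)$. Let $\Upsilon:(\zeta_j,Z_j,\xi_j,\eta_j)\mapsto(R_j,r_j)$ be the holomorphic extension of the change of variables, where $\xi_j,\eta_j$ are the independent complex variables that extend $x_j,-i\bar x_j$; $H_P$ is extended through $\Upsilon$. Let $$\mathcal K_{\Delta,\rho,\sigma}=\Big\{(\zeta_j,Z_j,\xi_j,\eta_j)_{j=1,2}\in\mathbb C^8:\ \exists\,\theta_1\in(\Delta,2\pi-\Delta),\ \theta_2\in\mathbb R,\ |\zeta_j-\theta_j|\le\sigma,\ |Z_j|\le\rho,\ |\xi_j|,|\eta_j|\le\sqrt{\rho\sigma}\Big\},$$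 $\mathcal K_p=\mathcal K_{\Delta,p\rho,p\sigma}$, and let $\|\cdot\|_p$ be the supremum norm on $\mathcal K_p$ (angles are represented by their lifts). Let $\overline H_P=\frac1{2\pi}\int_0^{2\pi}H_P\,d\zeta_2$ and $$\chi=\frac{\omega}{2\pi}\int_0^{2\pi/\omega}t\,\big[\overline H_P-H_P(\zeta_1,\zeta_2+\omega t,Z,\xi,\eta)\big]\,dt .$$ For $s\in\{1,-1\}$ use the symplectic form $\sum_j d\zeta_j\wedge dZ_j+s\,d\xi_j\wedge d\eta_j$ and the bracket $\{f,g\}=\sum_j\partial_{\zeta_j}f\,\partial_{Z_j}g-\partial_{Z_j}f\,\partial_{\zeta_j}g+s\,(\partial_{\xi_j}f\,\partial_{\eta_j}g-\partial_{\eta_j}f\,\partial_{\xi_j}g)$. **Theorem 2.** There are constants $\rho_0,\sigma_0,M>0$ and $C>1$, depending only on $G,m_0,m_1,m_2,\omega$, such that for all $\varepsilon\in(0,1]$ and $\Delta>0$ the map $\Upsilon$ is holomorphic with differential bounded by $C$ on $\mathcal K_{\Delta,\rho_0,\sigma_0}$, and such that the following holds for both signs $s=\pm1$, all $\varepsilon\in(0,1]$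 and all $\Delta,\rho,\sigma>0$ with $$\rho<\frac{\rho_0}{2},\qquad \rho<\sigma<\min\left(\frac{\sigma_0}{2},\frac{\delta}{32C}\right),\qquad \frac{\varepsilon}{\delta\rho\sigma}<\frac{\omega}{32\pi M}.$$ The functions $H_P$ and $\chi$ are holomorphic on (a neighbourhood of) $\mathcal K_2$, $\omega\,\partial_{\zeta_2}\chi=\overline H_P-H_P$ on $\mathcal K_2$, and $\|\overline H_P\|_2\le 2M\frac{\varepsilon}{\delta}$. The time-one map $\mathcal C$ of the Hamiltonian flow $\Phi_t$ generated by $\chi$, $\frac{d}{dt}(K\circ\Phi_t)=\{\chi,K\}\circ\Phi_t$, is defined on $\mathcal K_{3/2}$ (with orbits in $\mathcal K_{7/4}$ for $0\le t\le1$), holomorphic, canonical, compatible with the $2\pi$-periodicity in $\zeta_2$, maps real points to real points, and $\mathcal C:\mathcal K_{3/2}\to\mathcal K_2$ is one-to-one with $$\mathcal K_{5/4}\subseteq\mathcal C(\mathcal K_{3/2})\subseteq\mathcal K_{7/4}.$$ On $\mathcal K_{3/2}$ one has $H\circ\mathcal C=H_K+\overline H_P+H_*$ with $H_*$ holomorphic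 and $$\|H_*\|_{3/2}\le\eta M\frac{\varepsilon}{\delta},\qquad \eta=40\,\frac{M\pi}{\omega}\left(\frac{\rho}{\sigma}+\frac{\varepsilon}{\rho\sigma\delta}\right).$$ -/

import Mathlib

open Complex Set

noncomputable section

/-- Data of the planar planetary three-body problem with two planets: gravitational constant `G`,
mass `m₀` of the star, rescaled masses `m j` of the planets (the actual masses are `ε * m j`),
and the common mean motion `ω` of the 1:1 resonance under consideration. -/
structure PlanetarySystem where
  G : ℝ
  m₀ : ℝ
  m : Fin 2 → ℝ
  ω : ℝ
  G_pos : 0 < G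
  m₀_pos : 0 < m₀
  m_pos : ∀ j, 0 < m j
  ω_pos : 0 < ω

/-- The complexified phase space `ℂ⁸` with the sup norm. A point `z` has coordinates
`z 0 j = ζ_j`, `z 1 j = Z_j`, `z 2 j = ξ_j` (for `x_j`) and `z 3 j = η_j` (for `-i x̄_j`);
the planets `1, 2` are indexed by `0, 1 : Fin 2`. Angles are represented by their lifts. -/
abbrev Phase := Fin 4 → Fin 2 → ℂ

/-- The basis vector of `Phase` in the direction of the coordinate `z k j`. -/
def Phase.basisVec (k : Fin 4) (j : Fin 2) : Phase := Pi.single k (Pi.single j 1)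

/-- The complex partial derivative of `f` with respect to the coordinate `z k j`. -/
def Phase.partialDeriv (k : Fin 4) (j : Fin 2) (f : Phase → ℂ) (z : Phase) : ℂ :=
  fderiv ℂ f z (Phase.basisVec k j)

/-- Real points of the phase space: `ζ_j` and `Z_j` are real and `η_j = -i * conj ξ_j`. -/
def Phase.IsReal (z : Phase) : Prop :=
  ∀ j, (z 0 j).im = 0 ∧ (z 1 j).im = 0 ∧ z 3 j = -I * starRingEnd ℂ (z 2 j)

/-- The complex neighbourhood of the real resonant cylinder
`{ζ₁ ∈ (Δ, 2π - Δ), ζ₂ ∈ ℝ, Z = 0, ξ = η = 0}` with widths `σ` in the angles, `ρ` in the actions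
and `√(ρσ)` in the variables `ξ`, `η`. -/
def Phase.domain (Δ ρ σ : ℝ) : Set Phase :=
  {z | ∃ θ : Fin 2 → ℝ, θ 0 ∈ Ioo Δ (2 * Real.pi - Δ) ∧
    ∀ j, ‖z 0 j - (θ j : ℂ)‖ ≤ σ ∧ ‖z 1 j‖ ≤ ρ ∧
      ‖z 2 j‖ ≤ Real.sqrt (ρ * σ) ∧ ‖z 3 j‖ ≤ Real.sqrt (ρ * σ)}

/-- The bilinear form `∑ j, dζ_j ∧ dZ_j + s * dξ_j ∧ dη_j`. -/
def Phase.sympl (s : ℝ) (v w : Phase) : ℂ :=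
  ∑ j, ((v 0 j * w 1 j - v 1 j * w 0 j) + s * (v 2 j * w 3 j - v 3 j * w 2 j))

/-- The Hamiltonian vector field whose flow `Φ_t` satisfies `d/dt (K ∘ Φ_t) = {χ, K} ∘ Φ_t` where
`{χ, f} = ∑ j, (∂χ/∂ζ_j ∂f/∂Z_j - ∂χ/∂Z_j ∂f/∂ζ_j) + s (∂χ/∂ξ_j ∂f/∂η_j - ∂χ/∂η_j ∂f/∂ξ_j)`. -/
def Phase.hamField (s : ℝ) (χ : Phase → ℂ) (z : Phase) : Phase :=
  ![fun j => -Phase.partialDeriv 1 j χ z,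
    fun j => Phase.partialDeriv 0 j χ z,
    fun j => -(s * Phase.partialDeriv 3 j χ z),
    fun j => s * Phase.partialDeriv 2 j χ z]

/-- The principal square root. -/
def csqrt (w : ℂ) : ℂ := w ^ (1 / 2 : ℂ)

/-- The eccentric longitude `F = E + ϖ` as a function of the mean longitude `l` and of
`k = e * exp (i ϖ)`, `kbar = e * exp (-i ϖ)`: the solution close to `l` of Kepler's equation
`l = F - e * sin (F - ϖ)`, written with `2 i e sin (F - ϖ) = exp (i F) kbar - exp (-i F) k`.
For small `k`, `kbar` (and bounded imaginary part of `l`) the solution is unique. -/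
def eccLongitude (l k kbar : ℂ) : ℂ :=
  Classical.epsilon fun F : ℂ =>
    ‖F - l‖ ≤ 1 ∧ l = F - (exp (I * F) * kbar - exp (-(I * F)) * k) / (2 * I)

namespace PlanetarySystem

variable (S : PlanetarySystem)

/-- The reduced mass `β_j`. -/
def beta (ε : ℝ) (j : Fin 2) : ℝ := S.m₀ * S.m j / (S.m₀ + ε * S.m j)

/-- The coefficient `μ_j`. -/
def mu (ε : ℝ) (j : Fin 2) : ℝ := S.G * (S.m₀ + ε * S.m j)

/-- The resonant action `Λ_j⁰`, i.e. the solution of `μ_j² β_j³ / (Λ_j⁰)³ = ω`. -/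
def lam0 (ε : ℝ) (j : Fin 2) : ℝ := (S.mu ε j ^ 2 * S.beta ε j ^ 3 / S.ω) ^ (1 / 3 : ℝ)

/-- The radius `(Λ_j⁰)² / (β_j² μ_j)` of the resonant circular orbit of planet `j`. -/
def radius (ε : ℝ) (j : Fin 2) : ℝ := S.lam0 ε j ^ 2 / (S.beta ε j ^ 2 * S.mu ε j)

/-- The distance parameter `δ`. -/
def delta (ε Δ : ℝ) : ℝ := Real.sin (Δ / 2) * min (S.radius ε 0) (S.radius ε 1)

/-! ### Poincaré's variables

For one planet with Poincaré variables `l = λ`, `L = Λ`, `x`, `y = -i x̄`, where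
`Λ = β √(μ a)` and `x = √Λ √(1 - √(1 - e²)) exp (i ϖ)`, one has, with `x̄ = i y` and
`s = x x̄ / Λ = 1 - √(1 - e²)`,
`e exp (i ϖ) = x √(2 - s) / √Λ`, and with the eccentric longitude `F = E + ϖ` the position
`r_X + i r_Y = a exp (i ϖ) (cos E - e + i √(1 - e²) sin E)` equals
`a ((1 - s / 2) exp (i F) + x² / (2 Λ) exp (-i F) - e exp (i ϖ))`. The momentum is `β` times
the Keplerian velocity, i.e. `β` times the mean motion `μ² β³ / Λ³` times the `λ`-derivative of
the position, where `dF / dλ = 1 / (1 - e cos E)`. In these formulas the complex conjugates of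
`r_X + i r_Y` and of `x` are treated as independent variables; this is the holomorphic extension. -/

/-- `x̄ x / Λ = i y x / Λ`, which is `1 - √(1 - e²)` at real points. -/
def sVar (L x y : ℂ) : ℂ := x * (I * y) / L

/-- `e * exp (i ϖ)`. -/
def kVar (L x y : ℂ) : ℂ := x * csqrt (2 - sVar L x y) / csqrt L

/-- `e * exp (-i ϖ)`. -/
def kbarVar (L x y : ℂ) : ℂ := I * y * csqrt (2 - sVar L x y) / csqrt L

/-- The eccentric longitude in Poincaré variables. -/
def fVar (l L x y : ℂ) : ℂ := eccLongitude l (kVar L x y) (kbarVar L x y)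

/-- Semi-major axis. -/
def semiMajor (ε : ℝ) (j : Fin 2) (L : ℂ) : ℂ := L ^ 2 / (S.beta ε j ^ 2 * S.mu ε j)

/-- `r_X + i r_Y`. -/
def posPlus (ε : ℝ) (j : Fin 2) (l L x y : ℂ) : ℂ :=
  S.semiMajor ε j L * ((1 - sVar L x y / 2) * exp (I * fVar l L x y)
    + x ^ 2 / (2 * L) * exp (-(I * fVar l L x y)) - kVar L x y)

/-- `r_X - i r_Y`. -/
def posMinus (ε : ℝ) (j : Fin 2) (l L x y : ℂ) : ℂ :=
  S.semiMajor ε j L * ((1 - sVar L x y / 2) * exp (-(I * fVar l L x y))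
    + (I * y) ^ 2 / (2 * L) * exp (I * fVar l L x y) - kbarVar L x y)

/-- `1 - e cos E`. -/
def dVar (l L x y : ℂ) : ℂ :=
  1 - (exp (I * fVar l L x y) * kbarVar L x y + exp (-(I * fVar l L x y)) * kVar L x y) / 2

/-- `R_X + i R_Y` (note that `β * (μ² β³ / Λ³) * a = μ β² / Λ`). -/
def momPlus (ε : ℝ) (j : Fin 2) (l L x y : ℂ) : ℂ :=
  S.mu ε j * S.beta ε j ^ 2 / L * (I * ((1 - sVar L x y / 2) * exp (I * fVar l L x y)
    - x ^ 2 / (2 * L) * exp (-(I * fVar l L x y)))) / dVar l L x y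

/-- `R_X - i R_Y`. -/
def momMinus (ε : ℝ) (j : Fin 2) (l L x y : ℂ) : ℂ :=
  S.mu ε j * S.beta ε j ^ 2 / L * (-I * ((1 - sVar L x y / 2) * exp (-(I * fVar l L x y))
    - (I * y) ^ 2 / (2 * L) * exp (I * fVar l L x y))) / dVar l L x y

/-- Mean longitudes in resonant variables: `λ₁ = ζ₁ + ζ₂`, `λ₂ = ζ₂`. -/
def meanLong (z : Phase) : Fin 2 → ℂ := ![z 0 0 + z 0 1, z 0 1]

/-- Actions in resonant variables: `Λ₁ = Λ₁⁰ + Z₁`, `Λ₂ = Λ₂⁰ - Z₁ + Z₂`. -/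
def action (ε : ℝ) (z : Phase) : Fin 2 → ℂ :=
  ![S.lam0 ε 0 + z 1 0, S.lam0 ε 1 - z 1 0 + z 1 1]

/-- Cartesian heliocentric positions `r_j` in resonant Poincaré variables. -/
def position (ε : ℝ) (z : Phase) (j : Fin 2) : Fin 2 → ℂ :=
  let p := S.posPlus ε j (meanLong z j) (S.action ε z j) (z 2 j) (z 3 j)
  let q := S.posMinus ε j (meanLong z j) (S.action ε z j) (z 2 j) (z 3 j)
  ![(p + q) / 2, (p - q) / (2 * I)]

/-- Cartesian (rescaled) momenta `R_j` in resonant Poincaré variables. -/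
def momentum (ε : ℝ) (z : Phase) (j : Fin 2) : Fin 2 → ℂ :=
  let p := S.momPlus ε j (meanLong z j) (S.action ε z j) (z 2 j) (z 3 j)
  let q := S.momMinus ε j (meanLong z j) (S.action ε z j) (z 2 j) (z 3 j)
  ![(p + q) / 2, (p - q) / (2 * I)]

/-- The change of variables `(ζ, Z, ξ, η) ↦ (R, r)`. -/
def upsilon (ε : ℝ) (z : Phase) : (Fin 2 → Fin 2 → ℂ) × (Fin 2 → Fin 2 → ℂ) :=
  (S.momentum ε z, S.position ε z)

/-- The Keplerian Hamiltonian. -/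
def HK (ε : ℝ) (z : Phase) : ℂ :=
  ∑ j, -((S.mu ε j ^ 2 * S.beta ε j ^ 3 : ℝ) : ℂ) / (2 * S.action ε z j ^ 2)

/-- The perturbation `ε * (R₁ · R₂ / m₀ - G m₁ m₂ / ‖r₁ - r₂‖)` in resonant Poincaré variables,
extended holomorphically. -/
def HP (ε : ℝ) (z : Phase) : ℂ :=
  ε * ((∑ i, S.momentum ε z 0 i * S.momentum ε z 1 i) / S.m₀
    - S.G * S.m 0 * S.m 1 / csqrt (∑ i, (S.position ε z 0 i - S.position ε z 1 i) ^ 2))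

/-- The planetary Hamiltonian. -/
def H (ε : ℝ) (z : Phase) : ℂ := S.HK ε z + S.HP ε z

/-- The average of the perturbation over the fast angle `ζ₂`. -/
def HPbar (ε : ℝ) (z : Phase) : ℂ :=
  ((1 / (2 * Real.pi) : ℝ) : ℂ) *
    ∫ t in (0 : ℝ)..(2 * Real.pi),
      S.HP ε (Function.update z 0 (Function.update (z 0) 1 (t : ℂ)))

/-- The generating function
`χ = ω / (2π) ∫₀^{2π/ω} t (HPbar - HP (ζ₂ + ω t)) dt`. -/
def chi (ε : ℝ) (z : Phase) : ℂ :=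
  ((S.ω / (2 * Real.pi) : ℝ) : ℂ) *
    ∫ t in (0 : ℝ)..(2 * Real.pi / S.ω),
      (t : ℂ) * (S.HPbar ε z - S.HP ε (z + ((S.ω * t : ℝ) : ℂ) • Phase.basisVec 0 1))

end PlanetarySystem

end

/-!
One step of averaging over the fast angle `ζ₂`, with explicit domains.

Where the eccentricities are small and `Λ_j` is close to `Λ_j⁰`, Kepler's equation has a unique
solution that depends holomorphically on the Poincaré variables; so `Υ` is holomorphic there, and
Cauchy's estimate turns a bound for `Υ` into a bound for its differential. On the resonant cylinder
the two planets are on circles, separated by an angle greater than `Δ`, hence at distance at least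
`2 δ` (`four_mul_delta_sq_le`). By the bound on the differential of `Υ`, displacements smaller than
a fixed multiple of `δ / C` keep the extension of the squared distance at real part at least `δ ^ 2`
(`delta_sq_le_re`). Therefore `H_P` is holomorphic and bounded by a multiple of `ε / δ` on the
domains of width `4` (`exists_perturbation_bounds`), and so are its average and the generating
function `χ`, which solves the homological equation (`IsFastStrip.partialDeriv_averagingGenerator`).

The rescaling by `σ` in the angles, `ρ` in the actions and `√(ρσ)` in `ξ, η` is conformally
symplectic and turns the domains into neighbourhoods of width `p` of a real cylinder in the sup
norm. There `χ / (ρσ)` has size `κ ∼ ε / (δρσ)`, which the hypotheses make small, and Cauchy's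
estimates give a vector field of speed at most `κ`. All geometric statements are about the flow of
such a field: existence from Picard–Lindelöf, holomorphy from the variational equation
(`exists_flow`) and Osgood's lemma, canonicity from the symmetry of second derivatives,
compatibility with the period and with the real structure from uniqueness of integral curves
(`flow_comp_affine`), injectivity and covering by running the flow backwards
(`injOn_and_exists_preimage_of_flow`).

Along a trajectory the Keplerian energy changes at the rate `{χ, H_K}`, which equals `ω ∂χ/∂ζ₂ =
H̄_P - H_P` up to the detuning of the frequencies from `ω`, of relative size `ρ`; and `H_P`, `H̄_P`
vary by a multiple of `κ ε / δ`. Integrating from `0` to `1` bounds the remainder `H_*`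
(`norm_energy_sub_le`).
-/

open Complex Set

noncomputable section

/-! ### Holomorphic functions of several variables -/

open Metric MeasureTheory in
/-- The Cauchy integral formula on a polydisc. -/
theorem torusIntegral_prod_sub_inv_smul {F : Type*} [NormedAddCommGroup F] [NormedSpace ℂ F]
    [CompleteSpace F] {r : ℝ} (hr : 0 < r) {n : ℕ} :
    ∀ (f : (Fin n → ℂ) → F) (c w : Fin n → ℂ), (∀ z ∈ closedBall c r, DifferentiableAt ℂ f z) →
      w ∈ ball c r →
      torusIntegral (fun ζ => (∏ j, (ζ j - w j)⁻¹) • f ζ) c (fun _ => r)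
        = (2 * Real.pi * I : ℂ) ^ n • f w := by
  induction n with
  | zero =>
    intro f c w _ _
    rw [torusIntegral_dim0, Subsingleton.elim w c]
    simp
  | succ n ih =>
    intro f c w hf hw
    have hw' : ∀ j, ‖w j - c j‖ < r := by
      rw [mem_ball, dist_pi_lt_iff hr] at hw
      simpa [dist_eq_norm] using hw
    have hmem : ∀ θ, torusMap c (fun _ => r) θ ∈ closedBall c r := by
      intro θ
      rw [mem_closedBall, dist_pi_le_iff hr.le]
      intro j
      simp [torusMap, dist_eq_norm, Complex.norm_exp_ofReal_mul_I, abs_of_pos hr]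
    have hne : ∀ θ j, torusMap c (fun _ => r) θ j - w j ≠ 0 := by
      intro θ j h
      have h1 := hw' j
      rw [← sub_eq_zero.1 h] at h1
      simp [torusMap, Complex.norm_exp_ofReal_mul_I, abs_of_pos hr] at h1
    have hint : TorusIntegrable (fun ζ => (∏ j, (ζ j - w j)⁻¹) • f ζ) c (fun _ => r) := by
      refine ContinuousOn.integrableOn_compact isCompact_Icc ?_
      have hcont : Continuous (torusMap c (fun _ => r)) := by
        unfold torusMap; fun_prop
      refine Continuous.continuousOn ?_
      refine Continuous.smul ?_ ?_
      · refine continuous_finsetProd _ fun j _ => ?_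
        exact ((continuous_apply j).comp hcont |>.sub continuous_const).inv₀ fun θ => hne θ j
      · refine continuous_iff_continuousAt.2 fun θ => ?_
        exact (hf _ (hmem θ)).continuousAt.comp hcont.continuousAt
    rw [torusIntegral_succ hint]
    have key : ∀ x ∈ closedBall (c 0) r,
        torusIntegral (fun y : Fin n → ℂ => (∏ j, ((Fin.cons x y : Fin (n + 1) → ℂ) j - w j)⁻¹) •
          f (Fin.cons x y)) (c ∘ Fin.succ) ((fun _ => r) ∘ Fin.succ)
        = (x - w 0)⁻¹ • ((2 * Real.pi * I : ℂ) ^ n • f (Fin.cons x (w ∘ Fin.succ))) := by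
      intro x hx
      simp_rw [Fin.prod_univ_succ, Fin.cons_zero, Fin.cons_succ, mul_smul]
      rw [torusIntegral_smul]
      congr 1
      refine ih (fun y => f (Fin.cons x y)) (c ∘ Fin.succ) (w ∘ Fin.succ) ?_ ?_
      · intro z hz
        have hd : DifferentiableAt ℂ (fun y : Fin n → ℂ => (Fin.cons x y : Fin (n + 1) → ℂ)) z := by
          refine differentiableAt_pi.2 fun j => ?_
          refine Fin.cases ?_ (fun j => ?_) j <;> simp <;> fun_prop
        refine (hf _ ?_).comp z hd
        rw [mem_closedBall, dist_pi_le_iff hr.le] at hz ⊢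
        refine fun j => Fin.cases ?_ (fun j => ?_) j
        · simpa using hx
        · simpa using hz j
      · rw [mem_ball, dist_pi_lt_iff hr] at hw ⊢
        exact fun j => hw j.succ
    have hsph : ∀ x ∈ sphere (c 0) r, x ∈ closedBall (c 0) r := fun x hx =>
      sphere_subset_closedBall hx
    rw [circleIntegral.integral_congr hr.le fun x hx => key x (hsph x hx)]
    have hd : DifferentiableOn ℂ
        (fun x => (2 * Real.pi * I : ℂ) ^ n • f (Fin.cons x (w ∘ Fin.succ))) (closedBall (c 0) r) := by
      intro x hx
      have hd : DifferentiableAt ℂ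
          (fun x : ℂ => (Fin.cons x (w ∘ Fin.succ) : Fin (n + 1) → ℂ)) x := by
        refine differentiableAt_pi.2 fun j => ?_
        refine Fin.cases ?_ (fun j => ?_) j <;> simp
      refine (((hf _ ?_).comp x hd).const_smul _).differentiableWithinAt
      rw [mem_closedBall, dist_pi_le_iff hr.le]
      refine fun j => Fin.cases ?_ (fun j => ?_) j
      · simpa using hx
      · simpa [dist_eq_norm] using (hw' j.succ).le
    rw [hd.circleIntegral_sub_inv_smul (by simpa [dist_eq_norm] using hw' 0), smul_smul,
      ← pow_succ']
    congr 2
    ext j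
    refine Fin.cases ?_ (fun j => ?_) j <;> simp

open Metric MeasureTheory in
/-- A complex differentiable function on `ℂⁿ` is analytic: in the Cauchy formula on a polydisc the
kernel is an analytic function of the evaluation point with values in the Banach algebra of
continuous functions on the torus, and the integral is a continuous linear functional of it. -/
theorem analyticAt_of_eventually_differentiableAt_fin {F : Type*} [NormedAddCommGroup F]
    [NormedSpace ℂ F] [CompleteSpace F] {n : ℕ} {f : (Fin n → ℂ) → F} {c : Fin n → ℂ}
    (hf : ∀ᶠ z in nhds c, DifferentiableAt ℂ f z) : AnalyticAt ℂ f c := by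
  obtain ⟨r, hr, hfr⟩ := nhds_basis_closedBall.eventually_iff.1 hf
  let K : Set (Fin n → ℝ) := Icc (0 : Fin n → ℝ) fun _ => 2 * Real.pi
  have : CompactSpace K := isCompact_iff_compactSpace.1 isCompact_Icc
  have hcont : Continuous (torusMap c (fun _ => r)) := by unfold torusMap; fun_prop
  have hmem : ∀ θ, torusMap c (fun _ => r) θ ∈ closedBall c r := by
    intro θ
    rw [mem_closedBall, dist_pi_le_iff hr.le]
    intro j
    simp [torusMap, dist_eq_norm, Complex.norm_exp_ofReal_mul_I, abs_of_pos hr]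
  let h : (Fin n → ℝ) → F := fun θ =>
    (∏ i : Fin n, (r : ℂ) * exp (θ i * I) * I : ℂ) • f (torusMap c (fun _ => r) θ)
  have hh : Continuous h := by
    refine Continuous.smul (by fun_prop) (continuous_iff_continuousAt.2 fun θ => ?_)
    exact (hfr (hmem θ)).continuousAt.comp hcont.continuousAt
  let μ : Measure K := Measure.comap Subtype.val volume
  have : IsFiniteMeasure μ := by
    refine ⟨?_⟩
    rw [comap_subtype_coe_apply measurableSet_Icc, image_univ, Subtype.range_coe]
    exact (isCompact_Icc : IsCompact K).measure_lt_top
  have hint : ∀ k : C(K, ℂ), Integrable (fun θ : K => k θ • h θ) μ := by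
    intro k
    exact (by fun_prop : Continuous fun θ : K => k θ • h θ).integrable_of_hasCompactSupport
      (HasCompactSupport.of_compactSpace _)
  let T : C(K, ℂ) →L[ℂ] F := LinearMap.mkContinuous
    { toFun := fun k => ∫ θ : K, k θ • h θ ∂μ
      map_add' := fun k l => by
        simp only [ContinuousMap.add_apply, add_smul]
        exact integral_add (hint k) (hint l)
      map_smul' := fun a k => by
        simp only [ContinuousMap.smul_apply, smul_assoc, RingHom.id_apply]
        exact integral_smul a _ } (∫ θ : K, ‖h θ‖ ∂μ) (fun k => by
        simp only [LinearMap.coe_mk, AddHom.coe_mk]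
        rw [← integral_mul_const]
        refine norm_integral_le_of_norm_le ?_ (Filter.Eventually.of_forall fun θ => ?_)
        · refine Integrable.mul_const ?_ _
          exact (by fun_prop : Continuous fun θ : K => ‖h θ‖).integrable_of_hasCompactSupport
            (HasCompactSupport.of_compactSpace _)
        · rw [norm_smul, mul_comm]
          gcongr
          exact k.norm_coe_le_norm θ)
  let g : Fin n → (Fin n → ℂ) → C(K, ℂ) := fun j w =>
    ⟨fun θ => torusMap c (fun _ => r) θ j, by fun_prop⟩ - algebraMap ℂ C(K, ℂ) (w j)
  have hgu : ∀ w ∈ ball c r, ∀ j, IsUnit (g j w) := by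
    intro w hw j
    rw [ContinuousMap.isUnit_iff_forall_ne_zero]
    intro θ h0
    have h1 : ‖w j - c j‖ < r := by
      rw [mem_ball, dist_pi_lt_iff hr] at hw
      simpa [dist_eq_norm] using hw j
    have h2 : torusMap c (fun _ => r) θ j = w j := by
      simpa [g, sub_eq_zero] using h0
    rw [← h2] at h1
    simp [torusMap, Complex.norm_exp_ofReal_mul_I, abs_of_pos hr] at h1
  have hk : AnalyticAt ℂ (fun w => ∏ j, Ring.inverse (g j w)) c := by
    refine Finset.analyticAt_fun_prod _ fun j _ => ?_
    have hg : AnalyticAt ℂ (g j) c := by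
      have h1 : AnalyticAt ℂ (fun w : Fin n → ℂ => algebraMap ℂ C(K, ℂ) (w j)) c :=
        ((algebraMapCLM ℂ C(K, ℂ)).comp
          (ContinuousLinearMap.proj j : (Fin n → ℂ) →L[ℂ] ℂ)).analyticAt c
      exact analyticAt_const.sub h1
    obtain ⟨u, hu⟩ := hgu c (mem_ball_self hr) j
    have := analyticAt_inverse (𝕜 := ℂ) u
    rw [hu] at this
    exact this.comp hg
  have hT : AnalyticAt ℂ (fun w => ((2 * Real.pi * I : ℂ) ^ n)⁻¹ •
      T (∏ j, Ring.inverse (g j w))) c :=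
    (((T.analyticAt _).comp hk).const_smul)
  refine hT.congr ?_
  filter_upwards [ball_mem_nhds c hr] with w hw
  rw [inv_smul_eq_iff₀ (pow_ne_zero _ (by simp [Real.pi_ne_zero])),
    ← torusIntegral_prod_sub_inv_smul hr f c w (fun z hz => hfr hz) hw]
  change ∫ θ : K, _ ∂μ = _
  rw [torusIntegral, ← integral_subtype_comap (measurableSet_Icc)]
  refine integral_congr_ae (Filter.Eventually.of_forall fun θ => ?_)
  have hinv : ∀ j, (Ring.inverse (g j w)) θ = (torusMap c (fun _ => r) θ j - w j)⁻¹ := by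
    intro j
    have h1 := Ring.mul_inverse_cancel _ (hgu w hw j)
    have h2 := congrArg (fun k : C(K, ℂ) => k θ) h1
    have h3 : (torusMap c (fun _ => r) θ j - w j) * (Ring.inverse (g j w)) θ = 1 := by
      simpa [g] using h2
    exact eq_inv_of_mul_eq_one_right h3
  simp only [ContinuousMap.prod_apply, hinv, h]
  rw [smul_comm]

/-- **Osgood's lemma**: on a finite-dimensional complex space, complex differentiability on a
neighbourhood implies analyticity. -/
theorem analyticAt_of_eventually_differentiableAt {E F : Type*} [NormedAddCommGroup E]
    [NormedSpace ℂ E] [FiniteDimensional ℂ E] [NormedAddCommGroup F] [NormedSpace ℂ F]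
    [CompleteSpace F] {f : E → F} {c : E} (hf : ∀ᶠ z in nhds c, DifferentiableAt ℂ f z) :
    AnalyticAt ℂ f c := by
  let e : E ≃L[ℂ] (Fin (Module.finrank ℂ E) → ℂ) :=
    ContinuousLinearEquiv.ofFinrankEq (by simp)
  have h1 : AnalyticAt ℂ (f ∘ e.symm) (e c) := by
    refine analyticAt_of_eventually_differentiableAt_fin ?_
    have h2 : Filter.Tendsto e.symm (nhds (e c)) (nhds c) := by
      simpa using e.symm.continuous.tendsto (e c)
    filter_upwards [h2.eventually hf] with z hz
    exact hz.comp z e.symm.differentiableAt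
  have h3 := h1.comp (e.toContinuousLinearMap.analyticAt c)
  simpa [Function.comp_def] using h3

theorem DifferentiableOn.analyticOnNhd_of_finiteDimensional {E F : Type*} [NormedAddCommGroup E]
    [NormedSpace ℂ E] [FiniteDimensional ℂ E] [NormedAddCommGroup F] [NormedSpace ℂ F]
    [CompleteSpace F] {f : E → F} {U : Set E} (hf : DifferentiableOn ℂ f U) (hU : IsOpen U) :
    AnalyticOnNhd ℂ f U := fun z hz =>
  analyticAt_of_eventually_differentiableAt <| by
    filter_upwards [hU.mem_nhds hz] with w hw using hf.differentiableAt (hU.mem_nhds hw)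

open Metric in
/-- A Cauchy estimate for the derivative of a bounded holomorphic map, from the Schwarz lemma. -/
theorem norm_fderiv_le_of_forall_mem_ball {E F : Type*} [NormedAddCommGroup E] [NormedSpace ℂ E]
    [NormedAddCommGroup F] [NormedSpace ℂ F] {f : E → F} {z : E} {r B : ℝ} (hr : 0 < r)
    (hf : ∀ w ∈ ball z r, DifferentiableAt ℂ f w) (hB : ∀ w ∈ ball z r, ‖f w‖ ≤ B) :
    ‖fderiv ℂ f z‖ ≤ 2 * B / r := by
  refine norm_fderiv_le_div_of_mapsTo_ball (fun w hw => (hf w hw).differentiableWithinAt) ?_ hr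
  intro w hw
  rw [mem_closedBall, dist_eq_norm]
  calc ‖f w - f z‖ ≤ ‖f w‖ + ‖f z‖ := norm_sub_le _ _
    _ ≤ 2 * B := by linarith [hB w hw, hB z (mem_ball_self hr)]

open Metric in
/-- Differentiation under the integral sign along a family of real translates. -/
theorem hasFDerivAt_integral_comp_translate {E : Type*} [NormedAddCommGroup E] [NormedSpace ℂ E]
    [FiniteDimensional ℂ E] {g : E → ℂ} {U : Set E} (hU : IsOpen U) (hg : AnalyticOnNhd ℂ g U)
    (A : E →L[ℂ] E) (v : E) {c : ℝ → ℂ} (hc : Continuous c) {a b : ℝ} (hab : a ≤ b) {z₀ : E}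
    (hz₀ : ∀ t ∈ Icc a b, A z₀ + (t : ℂ) • v ∈ U) :
    HasFDerivAt (fun z => ∫ t in a..b, c t * g (A z + (t : ℂ) • v))
      (∫ t in a..b, c t • (fderiv ℂ g (A z₀ + (t : ℂ) • v)).comp A) z₀ := by
  have : ProperSpace E := FiniteDimensional.proper ℂ E
  have hcurve : ∀ z, Continuous fun t : ℝ => A z + (t : ℂ) • v := fun z => by fun_prop
  have hK : IsCompact ((fun t : ℝ => A z₀ + (t : ℂ) • v) '' Icc a b) :=
    isCompact_Icc.image (hcurve z₀)
  obtain ⟨δ, hδ, hδU⟩ := hK.exists_cthickening_subset_open hU (by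
    rintro _ ⟨t, ht, rfl⟩; exact hz₀ t ht)
  have hKδ : IsCompact (cthickening δ ((fun t : ℝ => A z₀ + (t : ℂ) • v) '' Icc a b)) :=
    hK.cthickening
  have hfd : AnalyticOnNhd ℂ (fderiv ℂ g) U := hg.fderiv
  obtain ⟨B, hB⟩ := hKδ.exists_bound_of_continuousOn (hfd.continuousOn.mono hδU)
  obtain ⟨D, hD⟩ := (isCompact_Icc (a := a) (b := b)).exists_bound_of_continuousOn hc.continuousOn
  let s : Set E := A ⁻¹' ball (A z₀) δ
  have hs : s ∈ nhds z₀ := A.continuous.continuousAt.preimage_mem_nhds (ball_mem_nhds _ hδ)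
  have hmem : ∀ z ∈ s, ∀ t ∈ Icc a b, A z + (t : ℂ) • v ∈
      cthickening δ ((fun t : ℝ => A z₀ + (t : ℂ) • v) '' Icc a b) := by
    intro z hz t ht
    refine mem_cthickening_of_dist_le _ (A z₀ + (t : ℂ) • v) _ _ (mem_image_of_mem _ ht) ?_
    simpa using (mem_ball.1 hz).le
  have hI : uIoc a b ⊆ Icc a b := by rw [uIoc_of_le hab]; exact Ioc_subset_Icc_self
  have hcontF : ∀ z ∈ s, ContinuousOn (fun t : ℝ => c t * g (A z + (t : ℂ) • v)) (Icc a b) := by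
    intro z hz
    refine hc.continuousOn.mul (hg.continuousOn.comp (hcurve z).continuousOn fun t ht => ?_)
    exact hδU (hmem z hz t ht)
  have hz₀s : z₀ ∈ s := by simp [s, hδ]
  refine intervalIntegral.hasFDerivAt_integral_of_dominated_of_fderiv_le
    (F' := fun z t => c t • (fderiv ℂ g (A z + (t : ℂ) • v)).comp A)
    (bound := fun _ => D * (B * ‖A‖)) hs ?_ ?_ ?_ ?_ (by simp) ?_
  · filter_upwards [hs] with z hz
    exact ((hcontF z hz).mono hI).aestronglyMeasurable measurableSet_uIoc
  · refine ContinuousOn.intervalIntegrable ?_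
    rw [uIcc_of_le hab]; exact hcontF z₀ hz₀s
  · refine ContinuousOn.aestronglyMeasurable ?_ measurableSet_uIoc
    refine hc.continuousOn.smul ?_
    have h1 : ContinuousOn (fun t : ℝ => fderiv ℂ g (A z₀ + (t : ℂ) • v)) (uIoc a b) :=
      hfd.continuousOn.comp (hcurve z₀).continuousOn fun t ht => hz₀ t (hI ht)
    exact h1.clm_comp continuousOn_const
  · refine Filter.Eventually.of_forall fun t ht z hz => ?_
    rw [norm_smul]
    have h1 := hD t (hI ht)
    have h2 := hB _ (hmem z hz t (hI ht))
    have h3 := (fderiv ℂ g (A z + (t : ℂ) • v)).opNorm_comp_le A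
    have h4 : 0 ≤ D := (norm_nonneg _).trans h1
    refine mul_le_mul h1 (h3.trans ?_) (norm_nonneg _) h4
    gcongr
  · refine Filter.Eventually.of_forall fun t ht z hz => ?_
    have h1 : HasFDerivAt (fun z => A z + (t : ℂ) • v) A z := A.hasFDerivAt.add_const _
    have h2 := (hg _ (hδU (hmem z hz t (hI ht)))).differentiableAt.hasFDerivAt
    exact (h2.comp z h1).const_mul (c t)

/-! ### Holomorphic flows -/

section Flow

open Metric

theorem HasDerivWithinAt.Ici_of_mem_Ico {E : Type*} [NormedAddCommGroup E] [NormedSpace ℝ E]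
    {γ : ℝ → E} {v : E} {t : ℝ} (h : HasDerivWithinAt γ v (Icc 0 1) t) (ht : t ∈ Ico (0 : ℝ) 1) :
    HasDerivWithinAt γ v (Ici t) t :=
  h.mono_of_mem_nhdsWithin (Icc_mem_nhdsGE_of_mem ht)

theorem norm_sub_le_of_hasDerivWithinAt_unitInterval {E : Type*} [NormedAddCommGroup E]
    [NormedSpace ℝ E] {γ γ' : ℝ → E} {κ : ℝ}
    (hγ : ∀ t ∈ Icc (0 : ℝ) 1, HasDerivWithinAt γ (γ' t) (Icc 0 1) t)
    (hκ : ∀ t ∈ Icc (0 : ℝ) 1, ‖γ' t‖ ≤ κ) {s t : ℝ} (hs : s ∈ Icc (0 : ℝ) 1)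
    (ht : t ∈ Icc (0 : ℝ) 1) : ‖γ t - γ s‖ ≤ κ := by
  have h := (convex_Icc (0 : ℝ) 1).norm_image_sub_le_of_norm_hasDerivWithin_le hγ hκ hs ht
  have h0 : 0 ≤ κ := (norm_nonneg _).trans (hκ s hs)
  have h1 : ‖t - s‖ ≤ 1 := by
    rw [Real.norm_eq_abs, abs_le]; constructor <;> linarith [hs.1, hs.2, ht.1, ht.2]
  nlinarith

theorem ball_subset_thickening_add {E : Type*} [PseudoMetricSpace E] {R : Set E} {p q s : ℝ} {z : E}
    (hz : z ∈ thickening p R) (h : p + q ≤ s) : ball z q ⊆ thickening s R := by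
  intro w hw
  obtain ⟨x, hx, hd⟩ := mem_thickening_iff.1 hz
  refine mem_thickening_iff.2 ⟨x, hx, ?_⟩
  have := dist_triangle w z x
  rw [mem_ball] at hw
  linarith

/-- The Picard–Lindelöf solution stays in the closed ball in which the field is controlled. -/
theorem IsPicardLindelof.exists_hasDerivWithinAt_mem_closedBall {E : Type*} [NormedAddCommGroup E]
    [NormedSpace ℝ E] [CompleteSpace E] {f : ℝ → E → E} {tmin tmax : ℝ} {t₀ : Icc tmin tmax}
    {x₀ : E} {a L K : NNReal} (hf : IsPicardLindelof f t₀ x₀ a 0 L K) :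
    ∃ α : ℝ → E, α t₀ = x₀ ∧ ∀ t ∈ Icc tmin tmax, α t ∈ closedBall x₀ a ∧
      HasDerivWithinAt α (f t (α t)) (Icc tmin tmax) t := by
  have hx : x₀ ∈ closedBall x₀ (0 : NNReal) := by simp
  obtain ⟨α, hα⟩ := ODE.FunSpace.exists_isFixedPt_next hf hx
  refine ⟨α.compProj, by rw [ODE.FunSpace.compProj_val, ← hα, ODE.FunSpace.next_apply₀],
    fun t ht => ⟨α.compProj_mem_closedBall hf.mul_max_le, ?_⟩⟩
  apply ODE.hasDerivWithinAt_picard_Icc t₀.2 hf.continuousOn_uncurry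
    α.continuous_compProj.continuousOn (fun _ ht' => α.compProj_mem_closedBall hf.mul_max_le)
    x₀ ht |>.congr_of_mem _ ht
  intro t' ht'
  nth_rw 1 [← hα]
  rw [ODE.FunSpace.compProj_of_mem ht', ODE.FunSpace.next_apply]

variable {E : Type*} [NormedAddCommGroup E] [NormedSpace ℂ E] {R : Set E} {X : E → E} {κ : ℝ}

theorem norm_fderiv_le_of_mem_thickening {F : Type*} [NormedAddCommGroup F] [NormedSpace ℂ F]
    {f : E → F} {p q B : ℝ} (hf : AnalyticOnNhd ℂ f (thickening p R))
    (hB : ∀ z ∈ thickening p R, ‖f z‖ ≤ B) (hpq : q < p) {z : E} (hz : z ∈ thickening q R) :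
    ‖fderiv ℂ f z‖ ≤ 2 * B / (p - q) :=
  norm_fderiv_le_of_forall_mem_ball (sub_pos.2 hpq)
    (fun w hw => (hf w (ball_subset_thickening_add hz (by linarith) hw)).differentiableAt)
    (fun w hw => hB w (ball_subset_thickening_add hz (by linarith) hw))

theorem norm_fderiv_vectorField_le (hX : AnalyticOnNhd ℂ X (thickening 3 R))
    (hκ : ∀ z ∈ thickening 3 R, ‖X z‖ ≤ κ) {z : E} (hz : z ∈ thickening (5 / 2) R) :
    ‖fderiv ℂ X z‖ ≤ 4 * κ :=
  (norm_fderiv_le_of_mem_thickening hX hκ (by norm_num) hz).trans_eq (by ring)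

theorem norm_fderiv_fderiv_vectorField_le [CompleteSpace E]
    (hX : AnalyticOnNhd ℂ X (thickening 3 R))
    (hκ : ∀ z ∈ thickening 3 R, ‖X z‖ ≤ κ) {z : E} (hz : z ∈ thickening 2 R) :
    ‖fderiv ℂ (fderiv ℂ X) z‖ ≤ 16 * κ :=
  (norm_fderiv_le_of_mem_thickening
    (hX.fderiv.mono (thickening_mono (by norm_num) R))
    (fun _ => norm_fderiv_vectorField_le hX hκ) (by norm_num) hz).trans_eq (by ring)

theorem closedBall_subset_thickening {E : Type*} [PseudoMetricSpace E] {R : Set E} {z : E}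
    (hz : z ∈ thickening (7 / 4) R) : closedBall z (1 / 4) ⊆ thickening 2 R := by
  intro w hw
  obtain ⟨x, hx, hd⟩ := mem_thickening_iff.1 hz
  refine mem_thickening_iff.2 ⟨x, hx, ?_⟩
  have := dist_triangle w z x
  rw [mem_closedBall] at hw
  linarith

theorem lipschitzOnWith_vectorField (hX : AnalyticOnNhd ℂ X (thickening 3 R))
    (hκ : ∀ z ∈ thickening 3 R, ‖X z‖ ≤ κ) (hκ1 : κ ≤ 1 / 100) {z : E}
    (hz : z ∈ thickening (7 / 4) R) : LipschitzOnWith 1 X (closedBall z (1 / 4)) := by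
  have hsub := closedBall_subset_thickening hz
  refine (convex_closedBall z (1 / 4)).lipschitzOnWith_of_nnnorm_fderiv_le (𝕜 := ℂ)
    (fun w hw => (hX w (thickening_mono (by norm_num) R (hsub hw))).differentiableAt) fun w hw => ?_
  rw [← NNReal.coe_le_coe, coe_nnnorm, NNReal.coe_one]
  have := norm_fderiv_vectorField_le hX hκ (thickening_mono (by norm_num) R (hsub hw))
  linarith

/-- Integral curves over the unit time interval are determined by their starting point. -/
theorem eqOn_of_hasDerivWithinAt_vectorField (hX : AnalyticOnNhd ℂ X (thickening 3 R))
    (hκ : ∀ z ∈ thickening 3 R, ‖X z‖ ≤ κ) (hκ1 : κ ≤ 1 / 100) {γ₁ γ₂ : ℝ → E}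
    (h0 : γ₁ 0 = γ₂ 0) (hz : γ₁ 0 ∈ thickening (7 / 4) R)
    (h₁ : ∀ t ∈ Icc (0 : ℝ) 1, HasDerivWithinAt γ₁ (X (γ₁ t)) (Icc 0 1) t)
    (h₂ : ∀ t ∈ Icc (0 : ℝ) 1, HasDerivWithinAt γ₂ (X (γ₂ t)) (Icc 0 1) t)
    (hm₁ : ∀ t ∈ Icc (0 : ℝ) 1, γ₁ t ∈ thickening 3 R)
    (hm₂ : ∀ t ∈ Icc (0 : ℝ) 1, γ₂ t ∈ thickening 3 R) : EqOn γ₁ γ₂ (Icc 0 1) := by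
  have hz0 : (0 : ℝ) ∈ Icc (0 : ℝ) 1 := by simp
  have hb : ∀ γ : ℝ → E, γ 0 = γ₁ 0 →
      (∀ t ∈ Icc (0 : ℝ) 1, HasDerivWithinAt γ (X (γ t)) (Icc 0 1) t) →
      (∀ t ∈ Icc (0 : ℝ) 1, γ t ∈ thickening 3 R) →
      ∀ t ∈ Ico (0 : ℝ) 1, γ t ∈ closedBall (γ₁ 0) (1 / 4) := by
    intro γ hγ0 hγ hm t ht
    have := norm_sub_le_of_hasDerivWithinAt_unitInterval hγ (fun t ht => hκ _ (hm t ht)) hz0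
      (Ico_subset_Icc_self ht)
    rw [mem_closedBall, dist_eq_norm, ← hγ0]
    linarith
  exact ODE_solution_unique_of_mem_Icc_right (v := fun _ => X)
    (s := fun _ => closedBall (γ₁ 0) (1 / 4)) (K := 1)
    (fun t _ => lipschitzOnWith_vectorField hX hκ hκ1 hz)
    (fun t ht => (h₁ t ht).continuousWithinAt)
    (fun t ht => (h₁ t (Ico_subset_Icc_self ht)).Ici_of_mem_Ico ht) (hb γ₁ rfl h₁ hm₁)
    (fun t ht => (h₂ t ht).continuousWithinAt)
    (fun t ht => (h₂ t (Ico_subset_Icc_self ht)).Ici_of_mem_Ico ht) (hb γ₂ h0.symm h₂ hm₂) h0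

variable [CompleteSpace E]

theorem exists_integralCurve (hX : AnalyticOnNhd ℂ X (thickening 3 R))
    (hκ : ∀ z ∈ thickening 3 R, ‖X z‖ ≤ κ) (hκ1 : κ ≤ 1 / 100) {z : E}
    (hz : z ∈ thickening (7 / 4) R) :
    ∃ γ : ℝ → E, γ 0 = z ∧ ∀ t ∈ Icc (0 : ℝ) 1,
      ‖γ t - z‖ ≤ κ ∧ HasDerivWithinAt γ (X (γ t)) (Icc 0 1) t := by
  have hκ0 : 0 ≤ κ := (norm_nonneg _).trans (hκ z (thickening_mono (by norm_num) R hz))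
  have hsub : closedBall z κ ⊆ closedBall z (1 / 4) :=
    closedBall_subset_closedBall (by linarith)
  have hsub3 : closedBall z (1 / 4) ⊆ thickening 3 R :=
    (closedBall_subset_thickening hz).trans (thickening_mono (by norm_num) R)
  have hPL : IsPicardLindelof (fun _ : ℝ => X) (tmin := 0) (tmax := 1) ⟨0, by simp⟩ z
      ⟨κ, hκ0⟩ 0 ⟨κ, hκ0⟩ 1 :=
    { lipschitzOnWith := fun t _ => (lipschitzOnWith_vectorField hX hκ hκ1 hz).mono hsub
      continuousOn := fun x _ => continuousOn_const
      norm_le := fun t _ x hx => hκ x (hsub3 (hsub hx))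
      mul_max_le := by simp }
  obtain ⟨γ, h0, hγ⟩ := hPL.exists_hasDerivWithinAt_mem_closedBall
  refine ⟨γ, h0, fun t ht => ⟨?_, (hγ t ht).2⟩⟩
  exact mem_closedBall_iff_norm.1 (hγ t ht).1

/-- The fundamental solution of a linear equation `A' = B(t) A` with small coefficients. -/
theorem exists_linear_integralCurve {B : ℝ → E →L[ℂ] E} (hB : ContinuousOn B (Icc 0 1))
    (hB1 : ∀ t ∈ Icc (0 : ℝ) 1, ‖B t‖ ≤ 1 / 25) :
    ∃ A : ℝ → E →L[ℂ] E, A 0 = ContinuousLinearMap.id ℂ E ∧ ∀ t ∈ Icc (0 : ℝ) 1,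
      ‖A t‖ ≤ 2 ∧ HasDerivWithinAt A ((B t).comp (A t)) (Icc 0 1) t := by
  have hid : ‖ContinuousLinearMap.id ℂ E‖ ≤ 1 := ContinuousLinearMap.norm_id_le
  have hle : ∀ A ∈ closedBall (ContinuousLinearMap.id ℂ E) (1 : NNReal), ‖A‖ ≤ 2 := by
    intro A hA
    rw [mem_closedBall, dist_eq_norm] at hA
    have := norm_le_insert' A (ContinuousLinearMap.id ℂ E)
    push_cast at hA
    linarith
  have hPL : IsPicardLindelof (fun t (A : E →L[ℂ] E) => (B t).comp A) (tmin := 0) (tmax := 1)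
      ⟨0, by simp⟩ (ContinuousLinearMap.id ℂ E) 1 0 1 1 :=
    { lipschitzOnWith := fun t ht => by
        refine LipschitzWith.lipschitzOnWith (LipschitzWith.of_dist_le_mul fun A A' => ?_)
        rw [dist_eq_norm, dist_eq_norm, ← ContinuousLinearMap.comp_sub]
        refine ((B t).opNorm_comp_le _).trans ?_
        have := hB1 t ht
        gcongr
        push_cast; linarith
      continuousOn := fun A _ => hB.clm_comp continuousOn_const
      norm_le := fun t ht A hA => by
        refine ((B t).opNorm_comp_le _).trans ?_
        have h1 := hB1 t ht
        have h2 := hle A hA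
        have h3 := mul_le_mul h1 h2 (norm_nonneg _) (by norm_num)
        push_cast; linarith
      mul_max_le := by simp }
  obtain ⟨A, h0, hA⟩ := hPL.exists_hasDerivWithinAt_mem_closedBall
  exact ⟨A, h0, fun t ht => ⟨hle _ (hA t ht).1, (hA t ht).2⟩⟩

theorem norm_sub_sub_fderiv_vectorField_le (hX : AnalyticOnNhd ℂ X (thickening 3 R))
    (hκ : ∀ z ∈ thickening 3 R, ‖X z‖ ≤ κ) (hκ1 : κ ≤ 1 / 100) {z x y : E}
    (hz : z ∈ thickening (7 / 4) R) (hx : x ∈ closedBall z (1 / 4))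
    (hy : y ∈ closedBall z (1 / 4)) :
    ‖X y - X x - fderiv ℂ X x (y - x)‖ ≤ ‖y - x‖ ^ 2 := by
  have hsub := closedBall_subset_thickening hz
  have hsub3 : closedBall z (1 / 4) ⊆ thickening 3 R := hsub.trans (thickening_mono (by norm_num) R)
  have hlip : ∀ w ∈ closedBall z (1 / 4), ‖fderiv ℂ X w - fderiv ℂ X x‖ ≤ ‖w - x‖ := by
    intro w hw
    have h := (convex_closedBall z (1 / 4)).norm_image_sub_le_of_norm_fderiv_le (𝕜 := ℂ)
      (fun w hw => (hX.fderiv w (hsub3 hw)).differentiableAt) (C := 1) (fun w hw => by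
        have := norm_fderiv_fderiv_vectorField_le hX hκ (hsub hw)
        linarith) hx hw
    simpa using h
  have hseg : segment ℝ x y ⊆ closedBall z (1 / 4) :=
    (convex_closedBall z (1 / 4)).segment_subset hx hy
  have h := (convex_segment x y).norm_image_sub_le_of_norm_fderiv_le' (𝕜 := ℂ) (f := X)
    (φ := fderiv ℂ X x) (C := ‖y - x‖)
    (fun w hw => (hX w (hsub3 (hseg hw))).differentiableAt) (fun w hw =>
      (hlip w (hseg hw)).trans (by
        obtain ⟨a, b, ha, hb, hab, rfl⟩ := hw
        have h1 : a • x + b • y - x = b • (y - x) := by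
          rw [eq_sub_of_add_eq hab, sub_smul, smul_sub, one_smul]; abel
        rw [h1, norm_smul, Real.norm_of_nonneg hb]
        nlinarith [norm_nonneg (y - x)])) (left_mem_segment ℝ x y) (right_mem_segment ℝ x y)
  rwa [pow_two]

/-- The flow of a small holomorphic vector field on a tube, with its derivative with respect to the
starting point, which solves the variational equation. -/
theorem exists_flow (hX : AnalyticOnNhd ℂ X (thickening 3 R))
    (hκ : ∀ z ∈ thickening 3 R, ‖X z‖ ≤ κ) (hκ1 : κ ≤ 1 / 100) :
    ∃ (Φ : ℝ → E → E) (A : ℝ → E → E →L[ℂ] E), ∀ z ∈ thickening (7 / 4) R,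
      Φ 0 z = z ∧ A 0 z = ContinuousLinearMap.id ℂ E ∧ ∀ t ∈ Icc (0 : ℝ) 1,
        ‖Φ t z - z‖ ≤ κ ∧ HasDerivWithinAt (fun t => Φ t z) (X (Φ t z)) (Icc 0 1) t ∧
        HasDerivWithinAt (fun t => A t z) ((fderiv ℂ X (Φ t z)).comp (A t z)) (Icc 0 1) t ∧
        HasFDerivAt (Φ t) (A t z) z := by
  have hγ : ∀ z : E, ∃ γ : ℝ → E, z ∈ thickening (7 / 4) R → γ 0 = z ∧ ∀ t ∈ Icc (0 : ℝ) 1,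
      ‖γ t - z‖ ≤ κ ∧ HasDerivWithinAt γ (X (γ t)) (Icc 0 1) t := by
    intro z
    by_cases hz : z ∈ thickening (7 / 4) R
    · obtain ⟨γ, h⟩ := exists_integralCurve hX hκ hκ1 hz
      exact ⟨γ, fun _ => h⟩
    · exact ⟨0, fun h => (hz h).elim⟩
  choose γ hγ using hγ
  have hγb : ∀ z ∈ thickening (7 / 4) R, ∀ t ∈ Icc (0 : ℝ) 1, γ z t ∈ closedBall z (1 / 100) := by
    intro z hz t ht
    rw [mem_closedBall, dist_eq_norm]
    exact ((hγ z hz).2 t ht).1.trans hκ1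
  have hb4 : ∀ z : E, closedBall z (1 / 100) ⊆ closedBall z (1 / 4) := fun z =>
    closedBall_subset_closedBall (by norm_num)
  have hA : ∀ z : E, ∃ A : ℝ → E →L[ℂ] E, z ∈ thickening (7 / 4) R →
      A 0 = ContinuousLinearMap.id ℂ E ∧ ∀ t ∈ Icc (0 : ℝ) 1,
      ‖A t‖ ≤ 2 ∧ HasDerivWithinAt A ((fderiv ℂ X (γ z t)).comp (A t)) (Icc 0 1) t := by
    intro z
    by_cases hz : z ∈ thickening (7 / 4) R
    · have hsub : ∀ t ∈ Icc (0 : ℝ) 1, γ z t ∈ thickening 2 R := fun t ht =>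
        closedBall_subset_thickening hz (hb4 z (hγb z hz t ht))
      obtain ⟨A, h⟩ := exists_linear_integralCurve (B := fun t => fderiv ℂ X (γ z t))
        (by
          refine hX.fderiv.continuousOn.comp
            (fun t ht => ((hγ z hz).2 t ht).2.continuousWithinAt) fun t ht => ?_
          exact thickening_mono (by norm_num) R (hsub t ht))
        (fun t ht => by
          have := norm_fderiv_vectorField_le hX hκ (thickening_mono (by norm_num) R (hsub t ht))
          linarith)
      exact ⟨A, fun _ => h⟩
    · exact ⟨0, fun h => (hz h).elim⟩
  choose A hA using hA
  refine ⟨fun t z => γ z t, fun t z => A z t, fun z hz => ⟨(hγ z hz).1, (hA z hz).1,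
    fun t ht => ⟨((hγ z hz).2 t ht).1, ((hγ z hz).2 t ht).2, ((hA z hz).2 t ht).2, ?_⟩⟩⟩
  -- `γ z t + A z t h` solves the equation up to an error quadratic in `h`
  have key : ∀ᶠ w in nhds z, ‖γ w t - γ z t - A z t (w - z)‖ ≤ 8 * ‖w - z‖ ^ 2 := by
    filter_upwards [isOpen_thickening.mem_nhds hz, closedBall_mem_nhds z
      (by norm_num : (0 : ℝ) < 1 / 16)] with w hw hwz
    rw [mem_closedBall, dist_eq_norm] at hwz
    have hAh : ∀ t ∈ Icc (0 : ℝ) 1, ‖A z t (w - z)‖ ≤ 2 * ‖w - z‖ := fun t ht =>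
      ((A z t).le_opNorm _).trans (by gcongr; exact ((hA z hz).2 t ht).1)
    have hy : ∀ t ∈ Icc (0 : ℝ) 1, γ z t + A z t (w - z) ∈ closedBall z (1 / 4) := by
      intro t ht
      have h1 := hγb z hz t ht
      rw [mem_closedBall, dist_eq_norm] at h1 ⊢
      have h2 := norm_add_le (γ z t - z) (A z t (w - z))
      have h3 := hAh t ht
      rw [sub_add_eq_add_sub] at h2
      linarith
    have hw4 : ∀ t ∈ Icc (0 : ℝ) 1, γ w t ∈ closedBall z (1 / 4) := by
      intro t ht
      have h1 := hγb w hw t ht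
      rw [mem_closedBall, dist_eq_norm] at h1 ⊢
      have h2 := norm_sub_le_norm_sub_add_norm_sub (γ w t) w z
      linarith
    have hyd : ∀ t ∈ Icc (0 : ℝ) 1, HasDerivWithinAt (fun t => γ z t + A z t (w - z))
        (X (γ z t) + fderiv ℂ X (γ z t) (A z t (w - z))) (Icc 0 1) t := by
      intro t ht
      refine ((hγ z hz).2 t ht).2.add ?_
      exact (((ContinuousLinearMap.apply ℂ E (w - z)).restrictScalars ℝ).hasFDerivAt
        |>.comp_hasDerivWithinAt t ((hA z hz).2 t ht).2)
    have hg := dist_le_of_approx_trajectories_ODE_of_mem (v := fun _ => X) (K := 1) (δ := 0)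
      (s := fun _ => closedBall z (1 / 4)) (a := 0) (b := 1) (f := γ w)
      (f' := fun t => X (γ w t)) (g := fun t => γ z t + A z t (w - z))
      (g' := fun t => X (γ z t) + fderiv ℂ X (γ z t) (A z t (w - z))) (εf := 0)
      (εg := 4 * ‖w - z‖ ^ 2)
      (fun t _ => lipschitzOnWith_vectorField hX hκ hκ1 hz)
      (fun t ht => ((hγ w hw).2 t ht).2.continuousWithinAt)
      (fun t ht => ((hγ w hw).2 t (Ico_subset_Icc_self ht)).2.Ici_of_mem_Ico ht)
      (fun t _ => by simp)
      (fun t ht => hw4 t (Ico_subset_Icc_self ht))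
      (fun t ht => (hyd t ht).continuousWithinAt)
      (fun t ht => (hyd t (Ico_subset_Icc_self ht)).Ici_of_mem_Ico ht)
      (fun t ht => by
        have ht' := Ico_subset_Icc_self ht
        have h1 := norm_sub_sub_fderiv_vectorField_le hX hκ hκ1 hz
          (hb4 z (hγb z hz t ht')) (hy t ht')
        rw [add_sub_cancel_left] at h1
        rw [dist_comm, dist_eq_norm, ← sub_sub]
        refine h1.trans ?_
        have := hAh t ht'
        nlinarith [norm_nonneg (A z t (w - z))])
      (fun t ht => hy t (Ico_subset_Icc_self ht))
      (by rw [(hγ w hw).1, (hγ z hz).1, (hA z hz).1]; simp) t ht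
    rw [dist_eq_norm, sub_zero, zero_add, gronwallBound_of_K_ne_0 (by simp)] at hg
    rw [sub_sub]
    refine hg.trans ?_
    have he : Real.exp t ≤ 3 := by
      have h1 := Real.exp_le_exp.2 ht.2
      have h2 := Real.exp_one_lt_d9
      linarith
    simp only [NNReal.coe_one, zero_mul, zero_add, one_mul, div_one]
    nlinarith [sq_nonneg ‖w - z‖]
  rw [hasFDerivAt_iff_isLittleO]
  refine Asymptotics.IsBigO.trans_isLittleO (g := fun w => ‖w - z‖ ^ 2)
    (Asymptotics.IsBigO.of_bound 8 ?_) ?_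
  · filter_upwards [key] with w hw
    simpa using hw
  · exact Asymptotics.isLittleO_pow_sub_sub z (by norm_num)

/-- The time-one map of a flow on a tube is injective, and its image contains a smaller tube. -/
theorem injOn_and_exists_preimage_of_flow (hX : AnalyticOnNhd ℂ X (thickening 3 R))
    (hκ : ∀ z ∈ thickening 3 R, ‖X z‖ ≤ κ) (hκ1 : κ ≤ 1 / 100) {Φ : ℝ → E → E}
    (hΦ : ∀ z ∈ thickening (7 / 4) R, Φ 0 z = z ∧ ∀ t ∈ Icc (0 : ℝ) 1,
      ‖Φ t z - z‖ ≤ κ ∧ HasDerivWithinAt (fun t => Φ t z) (X (Φ t z)) (Icc 0 1) t) :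
    InjOn (Φ 1) (thickening (5 / 3) R) ∧
      ∀ y ∈ thickening (3 / 2) R, ∃ z, ‖z - y‖ ≤ κ ∧ Φ 1 z = y := by
  have hrev : ∀ (Y : E → E) (γ : ℝ → E),
      (∀ t ∈ Icc (0 : ℝ) 1, HasDerivWithinAt γ (Y (γ t)) (Icc 0 1) t) →
      ∀ t ∈ Icc (0 : ℝ) 1, HasDerivWithinAt (fun t => γ (1 - t)) (-Y (γ (1 - t))) (Icc 0 1) t := by
    intro Y γ h t ht
    have hm : MapsTo (fun t : ℝ => 1 - t) (Icc 0 1) (Icc 0 1) := fun t ht =>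
      ⟨by linarith [ht.2], by linarith [ht.1]⟩
    have h1 : HasDerivWithinAt (fun t : ℝ => 1 - t) (-1) (Icc 0 1) t :=
      ((hasDerivAt_id t).const_sub 1).hasDerivWithinAt
    have h2 := HasDerivWithinAt.scomp t (h (1 - t) (hm ht)) h1 hm
    simpa [Function.comp_def] using h2
  have hm1 : ∀ t ∈ Icc (0 : ℝ) 1, 1 - t ∈ Icc (0 : ℝ) 1 := fun t ht =>
    ⟨by linarith [ht.2], by linarith [ht.1]⟩
  have hnX : AnalyticOnNhd ℂ (fun z => -X z) (thickening 3 R) := hX.neg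
  have hnκ : ∀ z ∈ thickening 3 R, ‖-X z‖ ≤ κ := fun z hz => by rw [norm_neg]; exact hκ z hz
  have hmem : ∀ {p q : ℝ} {z w : E}, z ∈ thickening p R → ‖w - z‖ ≤ κ → p + 1 / 50 ≤ q →
      w ∈ thickening q R := by
    intro p q z w hz hw hpq
    refine ball_subset_thickening_add hz hpq ?_
    rw [mem_ball, dist_eq_norm]; linarith
  have h1m : (1 : ℝ) ∈ Icc (0 : ℝ) 1 := by simp
  have h0m : (0 : ℝ) ∈ Icc (0 : ℝ) 1 := by simp
  constructor
  · intro z hz w hw hzw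
    have hz' := thickening_mono (by norm_num : (5 / 3 : ℝ) ≤ 7 / 4) R hz
    have hw' := thickening_mono (by norm_num : (5 / 3 : ℝ) ≤ 7 / 4) R hw
    have := eqOn_of_hasDerivWithinAt_vectorField hnX hnκ hκ1
      (γ₁ := fun t => Φ (1 - t) z) (γ₂ := fun t => Φ (1 - t) w) (by simpa using hzw)
      (by simpa using hmem hz ((hΦ z hz').2 1 h1m).1 (by norm_num))
      (hrev X (fun t => Φ t z) fun t ht => ((hΦ z hz').2 t ht).2)
      (hrev X (fun t => Φ t w) fun t ht => ((hΦ w hw').2 t ht).2)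
      (fun t ht => hmem hz ((hΦ z hz').2 _ (hm1 t ht)).1 (by norm_num))
      (fun t ht => hmem hw ((hΦ w hw').2 _ (hm1 t ht)).1 (by norm_num)) h1m
    simpa [(hΦ z hz').1, (hΦ w hw').1] using this
  · intro y hy
    have hy' := thickening_mono (by norm_num : (3 / 2 : ℝ) ≤ 7 / 4) R hy
    obtain ⟨γ, h0, hγ⟩ := exists_integralCurve hnX hnκ hκ1 hy'
    have hz : γ 1 ∈ thickening (7 / 4) R := hmem hy (hγ 1 h1m).1 (by norm_num)
    refine ⟨γ 1, (hγ 1 h1m).1, ?_⟩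
    have h2 := hrev (fun z => -X z) γ fun t ht => (hγ t ht).2
    simp only [neg_neg] at h2
    have := eqOn_of_hasDerivWithinAt_vectorField hX hκ hκ1
      (γ₁ := fun t => Φ t (γ 1)) (γ₂ := fun t => γ (1 - t)) (by simp [(hΦ _ hz).1])
      (by simpa [(hΦ _ hz).1] using hz) (fun t ht => ((hΦ _ hz).2 t ht).2) h2
      (fun t ht => hmem hz ((hΦ _ hz).2 t ht).1 (by norm_num))
      (fun t ht => hmem hy (hγ _ (hm1 t ht)).1 (by norm_num)) h1m
    simpa [h0] using this

end Flow

/-! ### Kepler's equation -/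

theorem csqrt_mul_self (w : ℂ) : csqrt w * csqrt w = w := by
  rcases eq_or_ne w 0 with rfl | hw
  · simp [csqrt]
  · rw [csqrt, ← cpow_add _ _ hw]; norm_num

theorem norm_csqrt_sq (w : ℂ) : ‖csqrt w‖ ^ 2 = ‖w‖ := by
  rw [pow_two, ← norm_mul, csqrt_mul_self]

theorem csqrt_ne_zero {w : ℂ} (hw : w ≠ 0) : csqrt w ≠ 0 := fun h =>
  hw (by rw [← csqrt_mul_self w, h, zero_mul])

theorem AnalyticAt.csqrt {E : Type*} [NormedAddCommGroup E] [NormedSpace ℂ E] {f : E → ℂ} {z : E}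
    (hf : AnalyticAt ℂ f z) (h : f z ∈ slitPlane) : AnalyticAt ℂ (fun w => csqrt (f w)) z :=
  hf.cpow analyticAt_const h

theorem csqrt_conj {w : ℂ} (hw : w ∈ slitPlane) :
    csqrt (starRingEnd ℂ w) = starRingEnd ℂ (csqrt w) := by
  have h := cpow_conj w (1 / 2) (mem_slitPlane_iff_arg.1 hw).1
  rw [map_div₀, map_one, map_ofNat] at h
  rw [csqrt, csqrt, h, conj_conj]

theorem norm_exp_I_mul_le {F : ℂ} (hF : |F.im| ≤ 2) :
    ‖exp (I * F)‖ ≤ 8 ∧ ‖exp (-(I * F))‖ ≤ 8 := by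
  have h2 : Real.exp 2 ≤ 8 := by
    have h := Real.exp_one_lt_d9
    have h3 : Real.exp 2 = Real.exp 1 * Real.exp 1 := by rw [← Real.exp_add]; norm_num
    have := Real.exp_pos 1
    rw [h3]; nlinarith
  obtain ⟨ha, hb⟩ := abs_le.1 hF
  constructor
  · rw [norm_exp]
    refine (Real.exp_le_exp.2 ?_).trans h2
    simp; linarith
  · rw [norm_exp]
    refine (Real.exp_le_exp.2 ?_).trans h2
    simp; linarith

/-- The map whose fixed points are the solutions of Kepler's equation. -/
def keplerMap (l k kbar F : ℂ) : ℂ := l + (exp (I * F) * kbar - exp (-(I * F)) * k) / (2 * I)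

theorem hasDerivAt_keplerMap (l k kbar F : ℂ) :
    HasDerivAt (keplerMap l k kbar) ((exp (I * F) * kbar + exp (-(I * F)) * k) / 2) F := by
  have h1 : HasDerivAt (fun F : ℂ => I * F) I F := by simpa using (hasDerivAt_id F).const_mul I
  have h := (((h1.cexp.mul_const kbar).sub (h1.neg.cexp.mul_const k)).div_const (2 * I)).const_add l
  refine h.congr_deriv ?_
  simp only [Pi.neg_apply]
  field_simp
  ring

section

variable {l k kbar : ℂ}

theorem abs_im_le_of_norm_sub_le {F : ℂ} (hl : |l.im| ≤ 1) (hF : ‖F - l‖ ≤ 1) : |F.im| ≤ 2 := by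
  have h1 := (abs_im_le_norm (F - l)).trans hF
  rw [sub_im] at h1
  obtain ⟨a, b⟩ := abs_le.1 h1
  obtain ⟨c, d⟩ := abs_le.1 hl
  exact abs_le.2 ⟨by linarith, by linarith⟩

theorem norm_exp_mul_le {F : ℂ} (hl : |l.im| ≤ 1) (hk : ‖k‖ ≤ 1 / 32) (hkb : ‖kbar‖ ≤ 1 / 32)
    (hF : ‖F - l‖ ≤ 1) : ‖exp (I * F) * kbar‖ ≤ 1 / 4 ∧ ‖exp (-(I * F)) * k‖ ≤ 1 / 4 := by
  obtain ⟨h1, h2⟩ := norm_exp_I_mul_le (abs_im_le_of_norm_sub_le hl hF)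
  rw [norm_mul, norm_mul]
  constructor
  · nlinarith [mul_le_mul h1 hkb (norm_nonneg _) (by norm_num)]
  · nlinarith [mul_le_mul h2 hk (norm_nonneg _) (by norm_num)]

theorem norm_keplerMap_sub_le {F : ℂ} (hl : |l.im| ≤ 1) (hk : ‖k‖ ≤ 1 / 32) (hkb : ‖kbar‖ ≤ 1 / 32)
    (hF : ‖F - l‖ ≤ 1) : ‖keplerMap l k kbar F - l‖ ≤ 1 / 4 := by
  obtain ⟨h1, h2⟩ := norm_exp_mul_le hl hk hkb hF
  rw [keplerMap, add_sub_cancel_left, norm_div, norm_mul, norm_I]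
  have := norm_sub_le (exp (I * F) * kbar) (exp (-(I * F)) * k)
  norm_num
  linarith

theorem lipschitzOnWith_keplerMap (hl : |l.im| ≤ 1) (hk : ‖k‖ ≤ 1 / 32) (hkb : ‖kbar‖ ≤ 1 / 32) :
    LipschitzOnWith (1 / 4) (keplerMap l k kbar) (Metric.closedBall l 1) := by
  refine (convex_closedBall l 1).lipschitzOnWith_of_nnnorm_hasDerivWithin_le
    (fun F _ => (hasDerivAt_keplerMap l k kbar F).hasDerivWithinAt) fun F hF => ?_
  rw [mem_closedBall_iff_norm] at hF
  obtain ⟨h1, h2⟩ := norm_exp_mul_le hl hk hkb hF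
  rw [← NNReal.coe_le_coe, coe_nnnorm, norm_div]
  have := norm_add_le (exp (I * F) * kbar) (exp (-(I * F)) * k)
  norm_num
  linarith

/-- Existence for Kepler's equation: `keplerMap` contracts the closed unit disc around `l`. -/
theorem eccLongitude_spec (hl : |l.im| ≤ 1) (hk : ‖k‖ ≤ 1 / 32) (hkb : ‖kbar‖ ≤ 1 / 32) :
    ‖eccLongitude l k kbar - l‖ ≤ 1 / 4 ∧
      keplerMap l k kbar (eccLongitude l k kbar) = eccLongitude l k kbar := by
  have hmaps : MapsTo (keplerMap l k kbar) (Metric.closedBall l 1) (Metric.closedBall l 1) := by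
    intro F hF
    rw [mem_closedBall_iff_norm] at hF ⊢
    exact (norm_keplerMap_sub_le hl hk hkb hF).trans (by norm_num)
  have hc : ContractingWith (1 / 4) (hmaps.restrict (keplerMap l k kbar) _ _) :=
    ⟨by rw [← NNReal.coe_lt_coe]; norm_num,
      (lipschitzOnWith_keplerMap hl hk hkb).mapsToRestrict hmaps⟩
  obtain ⟨F, hF, hfix, -⟩ := hc.exists_fixedPoint' Metric.isClosed_closedBall.isComplete hmaps
    (Metric.mem_closedBall_self zero_le_one) (edist_ne_top _ _)
  rw [mem_closedBall_iff_norm] at hF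
  have hex : ∃ F : ℂ, ‖F - l‖ ≤ 1 ∧
      l = F - (exp (I * F) * kbar - exp (-(I * F)) * k) / (2 * I) :=
    ⟨F, hF, eq_sub_of_add_eq hfix⟩
  obtain ⟨h1, h2⟩ := Classical.epsilon_spec hex
  change ‖eccLongitude l k kbar - l‖ ≤ 1 at h1
  have h3 : keplerMap l k kbar (eccLongitude l k kbar) = eccLongitude l k kbar :=
    add_eq_of_eq_sub h2
  refine ⟨?_, h3⟩
  rw [← h3]
  exact norm_keplerMap_sub_le hl hk hkb h1

/-- Uniqueness for Kepler's equation. The periodicity and the symmetry under conjugation of the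
eccentric longitude follow from it. -/
theorem eccLongitude_eq (hl : |l.im| ≤ 1) (hk : ‖k‖ ≤ 1 / 32) (hkb : ‖kbar‖ ≤ 1 / 32) {F : ℂ}
    (hF : ‖F - l‖ ≤ 1) (h : keplerMap l k kbar F = F) : eccLongitude l k kbar = F := by
  obtain ⟨h1, h2⟩ := eccLongitude_spec hl hk hkb
  have h3 := (lipschitzOnWith_keplerMap hl hk hkb).dist_le_mul (eccLongitude l k kbar)
    (mem_closedBall_iff_norm.2 (h1.trans (by norm_num))) F (mem_closedBall_iff_norm.2 hF)
  rw [h, h2] at h3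
  have h4 : dist (eccLongitude l k kbar) F ≤ 0 := by
    norm_num at h3
    linarith [dist_nonneg (x := eccLongitude l k kbar) (y := F)]
  exact dist_le_zero.1 h4

theorem eccLongitude_add_two_pi (hl : |l.im| ≤ 1) (hk : ‖k‖ ≤ 1 / 32) (hkb : ‖kbar‖ ≤ 1 / 32) :
    eccLongitude (l + 2 * Real.pi) k kbar = eccLongitude l k kbar + 2 * Real.pi := by
  obtain ⟨h1, h2⟩ := eccLongitude_spec hl hk hkb
  refine eccLongitude_eq (by simpa using hl) hk hkb ?_ ?_
  · rw [add_sub_add_right_eq_sub]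
    exact h1.trans (by norm_num)
  · conv_rhs => rw [← h2]
    have e1 : I * (eccLongitude l k kbar + 2 * Real.pi)
        = I * eccLongitude l k kbar + 2 * Real.pi * I := by ring
    simp only [keplerMap, exp_neg, e1, exp_periodic _]
    ring

theorem eccLongitude_conj (hl : |l.im| ≤ 1) (hk : ‖k‖ ≤ 1 / 32) (hkb : ‖kbar‖ ≤ 1 / 32) :
    eccLongitude (starRingEnd ℂ l) (starRingEnd ℂ kbar) (starRingEnd ℂ k)
      = starRingEnd ℂ (eccLongitude l k kbar) := by
  obtain ⟨h1, h2⟩ := eccLongitude_spec hl hk hkb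
  refine eccLongitude_eq (by simpa using hl) (by simpa using hkb) (by simpa using hk) ?_ ?_
  · rw [← map_sub, norm_conj]
    exact h1.trans (by norm_num)
  · conv_rhs => rw [← h2]
    simp only [keplerMap, map_add, map_div₀, map_sub, map_mul, ← exp_conj, map_neg, conj_I,
      map_ofNat]
    rw [neg_mul, neg_neg, mul_neg, div_neg, ← neg_div, neg_sub]

theorem eccLongitude_zero (hl : |l.im| ≤ 1) : eccLongitude l 0 0 = l :=
  eccLongitude_eq hl (by simp) (by simp) (by simp) (by simp [keplerMap])

end

theorem ContinuousLinearMap.isInvertible_of_apply_one_ne_zero {L : ℂ →L[ℂ] ℂ} (h : L 1 ≠ 0) :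
    L.IsInvertible := by
  refine ⟨ContinuousLinearEquiv.unitsEquivAut ℂ (Units.mk0 _ h), ?_⟩
  ext
  simp

/-- The solution of Kepler's equation depends holomorphically on the data, by the implicit
function theorem: the derivative `1 - e cos E` of the equation does not vanish. -/
theorem differentiableAt_eccLongitude {p : ℂ × ℂ × ℂ} (hl : |p.1.im| < 1) (hk : ‖p.2.1‖ < 1 / 32)
    (hkb : ‖p.2.2‖ < 1 / 32) :
    DifferentiableAt ℂ (fun p : ℂ × ℂ × ℂ => eccLongitude p.1 p.2.1 p.2.2) p := by
  obtain ⟨h1, h2⟩ := eccLongitude_spec hl.le hk.le hkb.le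
  set F₀ := eccLongitude p.1 p.2.1 p.2.2 with hF₀
  let f : (ℂ × ℂ × ℂ) × ℂ → ℂ := fun u => u.2 - keplerMap u.1.1 u.1.2.1 u.1.2.2 u.2
  have hfc : ContDiff ℂ 1 f := by
    simp only [f, keplerMap]
    fun_prop
  have hstrict := hfc.contDiffAt.hasStrictFDerivAt (x := (p, F₀)) one_ne_zero
  have hderiv : HasDerivAt (fun F => f (p, F))
      (1 - (exp (I * F₀) * p.2.2 + exp (-(I * F₀)) * p.2.1) / 2) F₀ :=
    (hasDerivAt_id F₀).sub (hasDerivAt_keplerMap p.1 p.2.1 p.2.2 F₀)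
  have hderiv' : HasDerivAt (fun F => f (p, F)) (fderiv ℂ f (p, F₀) (0, 1)) F₀ := by
    have h3 : HasDerivAt (fun F : ℂ => (p, F)) ((0 : ℂ × ℂ × ℂ), (1 : ℂ)) F₀ :=
      (hasDerivAt_const F₀ p).prodMk (hasDerivAt_id F₀)
    exact hstrict.hasFDerivAt.comp_hasDerivAt F₀ h3
  have hne : (fderiv ℂ f (p, F₀) ∘L .inr ℂ (ℂ × ℂ × ℂ) ℂ) 1 ≠ 0 := by
    have h4 : (fderiv ℂ f (p, F₀) ∘L .inr ℂ (ℂ × ℂ × ℂ) ℂ) 1 = fderiv ℂ f (p, F₀) (0, 1) := rfl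
    rw [h4, hderiv'.unique hderiv]
    obtain ⟨h5, h6⟩ := norm_exp_mul_le hl.le hk.le hkb.le (h1.trans (by norm_num))
    intro h7
    have h8 : (exp (I * F₀) * p.2.2 + exp (-(I * F₀)) * p.2.1) = 2 := by
      linear_combination (-2) * h7
    have h9 := norm_add_le (exp (I * F₀) * p.2.2) (exp (-(I * F₀)) * p.2.1)
    rw [h8] at h9
    rw [norm_ofNat] at h9
    linarith
  have hinv := ContinuousLinearMap.isInvertible_of_apply_one_ne_zero hne
  have hψ := hstrict.hasStrictFDerivAt_implicitFunctionOfProdDomain hinv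
  have hψt := hstrict.tendsto_implicitFunctionOfProdDomain hinv
  have hψe := hstrict.eventually_apply_implicitFunctionOfProdDomain hinv
  simp only at hψ hψt hψe
  refine hψ.hasFDerivAt.differentiableAt.congr_of_eventuallyEq ?_
  have hf0 : f (p, F₀) = 0 := by simp [f, h2]
  have e1 : ∀ᶠ q : ℂ × ℂ × ℂ in nhds p, |q.1.im| < 1 :=
    (by fun_prop : Continuous fun q : ℂ × ℂ × ℂ => |q.1.im|).continuousAt.eventually_lt_const hl
  have e2 : ∀ᶠ q : ℂ × ℂ × ℂ in nhds p, ‖q.2.1‖ < 1 / 32 :=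
    (by fun_prop : Continuous fun q : ℂ × ℂ × ℂ => ‖q.2.1‖).continuousAt.eventually_lt_const hk
  have e3 : ∀ᶠ q : ℂ × ℂ × ℂ in nhds p, ‖q.2.2‖ < 1 / 32 :=
    (by fun_prop : Continuous fun q : ℂ × ℂ × ℂ => ‖q.2.2‖).continuousAt.eventually_lt_const hkb
  have e4 : ∀ᶠ q : ℂ × ℂ × ℂ in nhds p,
      ‖hstrict.implicitFunctionOfProdDomain hinv q - q.1‖ < 1 := by
    have ht : Filter.Tendsto (fun q : ℂ × ℂ × ℂ =>
        ‖hstrict.implicitFunctionOfProdDomain hinv q - q.1‖) (nhds p) (nhds ‖F₀ - p.1‖) :=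
      (hψt.sub continuous_fst.continuousAt).norm
    exact ht.eventually_lt_const (by linarith)
  filter_upwards [e1, e2, e3, e4, hψe] with q q1 q2 q3 q4 q5
  refine eccLongitude_eq q1.le q2.le q3.le q4.le ?_
  rw [hf0] at q5
  exact (sub_eq_zero.1 q5).symm

theorem analyticAt_eccLongitude {p : ℂ × ℂ × ℂ} (hl : |p.1.im| < 1) (hk : ‖p.2.1‖ < 1 / 32)
    (hkb : ‖p.2.2‖ < 1 / 32) :
    AnalyticAt ℂ (fun p : ℂ × ℂ × ℂ => eccLongitude p.1 p.2.1 p.2.2) p := by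
  refine analyticAt_of_eventually_differentiableAt ?_
  have e1 : ∀ᶠ q : ℂ × ℂ × ℂ in nhds p, |q.1.im| < 1 :=
    (by fun_prop : Continuous fun q : ℂ × ℂ × ℂ => |q.1.im|).continuousAt.eventually_lt_const hl
  have e2 : ∀ᶠ q : ℂ × ℂ × ℂ in nhds p, ‖q.2.1‖ < 1 / 32 :=
    (by fun_prop : Continuous fun q : ℂ × ℂ × ℂ => ‖q.2.1‖).continuousAt.eventually_lt_const hk
  have e3 : ∀ᶠ q : ℂ × ℂ × ℂ in nhds p, ‖q.2.2‖ < 1 / 32 :=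
    (by fun_prop : Continuous fun q : ℂ × ℂ × ℂ => ‖q.2.2‖).continuousAt.eventually_lt_const hkb
  filter_upwards [e1, e2, e3] with q q1 q2 q3
  exact differentiableAt_eccLongitude q1 q2 q3

/-! ### One planet in complexified Poincaré variables -/

namespace PlanetarySystem

variable (S : PlanetarySystem)

/-- Quantitative form of "nearly circular orbit": the action `L` has real part at least `m`, the
mean longitude `l` lies in a fixed complex strip, and the eccentricity variables are small with
respect to `√m`. -/
structure IsNearCircular (m : ℝ) (l L x y : ℂ) : Prop where
  pos : 0 < m
  im_lt : |l.im| < 1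
  le_re : m ≤ L.re
  norm_x : ‖x‖ ^ 2 < m / 4096
  norm_y : ‖y‖ ^ 2 < m / 4096

namespace IsNearCircular

variable {m : ℝ} {l L x y : ℂ}

theorem le_norm (h : IsNearCircular m l L x y) : m ≤ ‖L‖ := h.le_re.trans (re_le_norm L)

theorem mem_slitPlane (h : IsNearCircular m l L x y) : L ∈ slitPlane :=
  mem_slitPlane_iff.2 (Or.inl (h.pos.trans_le h.le_re))

theorem ne_zero (h : IsNearCircular m l L x y) : L ≠ 0 := slitPlane_ne_zero h.mem_slitPlane

theorem norm_sVar_lt (h : IsNearCircular m l L x y) : ‖sVar L x y‖ < 1 := by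
  rw [sVar, norm_div, norm_mul, norm_mul, norm_I, one_mul, div_lt_one (h.pos.trans_le h.le_norm)]
  have := h.le_norm
  have := h.pos
  nlinarith [h.norm_x, h.norm_y, sq_nonneg (‖x‖ - ‖y‖)]

theorem two_sub_mem_slitPlane (h : IsNearCircular m l L x y) : 2 - sVar L x y ∈ slitPlane := by
  refine mem_slitPlane_iff.2 (Or.inl ?_)
  have := re_le_norm (sVar L x y)
  have := h.norm_sVar_lt
  simp; linarith

theorem norm_mul_csqrt_div_csqrt_lt (h : IsNearCircular m l L x y) {u : ℂ}
    (hu : ‖u‖ ^ 2 < m / 4096) : ‖u * csqrt (2 - sVar L x y) / csqrt L‖ < 1 / 32 := by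
  have h1 : ‖u * csqrt (2 - sVar L x y) / csqrt L‖ ^ 2 < (1 / 32) ^ 2 := by
    rw [norm_div, norm_mul, div_pow, mul_pow, norm_csqrt_sq, norm_csqrt_sq,
      div_lt_iff₀ (h.pos.trans_le h.le_norm)]
    have h2 := norm_sub_le (2 : ℂ) (sVar L x y)
    rw [norm_ofNat] at h2
    have h3 := h.norm_sVar_lt
    have h4 := h.le_norm
    nlinarith [h.pos, norm_nonneg (2 - sVar L x y), sq_nonneg ‖u‖]
  exact lt_of_pow_lt_pow_left₀ 2 (by norm_num) h1

theorem norm_kVar_lt (h : IsNearCircular m l L x y) : ‖kVar L x y‖ < 1 / 32 :=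
  h.norm_mul_csqrt_div_csqrt_lt h.norm_x

theorem norm_kbarVar_lt (h : IsNearCircular m l L x y) : ‖kbarVar L x y‖ < 1 / 32 :=
  h.norm_mul_csqrt_div_csqrt_lt (by simpa using h.norm_y)

theorem norm_fVar_sub_le (h : IsNearCircular m l L x y) : ‖fVar l L x y - l‖ ≤ 1 :=
  (eccLongitude_spec h.im_lt.le h.norm_kVar_lt.le h.norm_kbarVar_lt.le).1.trans (by norm_num)

theorem norm_exp_le (h : IsNearCircular m l L x y) :
    ‖exp (I * fVar l L x y)‖ ≤ 8 ∧ ‖exp (-(I * fVar l L x y))‖ ≤ 8 :=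
  norm_exp_I_mul_le (abs_im_le_of_norm_sub_le h.im_lt.le h.norm_fVar_sub_le)

theorem le_norm_dVar (h : IsNearCircular m l L x y) : 3 / 4 ≤ ‖dVar l L x y‖ := by
  obtain ⟨h1, h2⟩ := norm_exp_mul_le h.im_lt.le h.norm_kVar_lt.le h.norm_kbarVar_lt.le
    h.norm_fVar_sub_le
  rw [dVar]
  set a := exp (I * fVar l L x y) * kbarVar L x y
  set b := exp (-(I * fVar l L x y)) * kVar L x y
  have h3 := norm_sub_norm_le (1 : ℂ) ((a + b) / 2)
  rw [norm_one, norm_div, norm_ofNat] at h3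
  have := norm_add_le a b
  linarith

theorem dVar_ne_zero (h : IsNearCircular m l L x y) : dVar l L x y ≠ 0 := by
  intro h0
  have := h.le_norm_dVar
  rw [h0, norm_zero] at this
  linarith

theorem norm_sq_div_le (h : IsNearCircular m l L x y) {u : ℂ} (hu : ‖u‖ ^ 2 < m / 4096) :
    ‖u ^ 2 / (2 * L)‖ ≤ 1 / 8 := by
  rw [norm_div, norm_pow, norm_mul, norm_ofNat, div_le_iff₀ (by linarith [h.le_norm, h.pos])]
  linarith [h.le_norm, h.pos]

theorem norm_bracket_le (h : IsNearCircular m l L x y) {a b : ℂ} {u : ℂ} (ha : ‖a‖ ≤ 8)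
    (hb : ‖b‖ ≤ 8) (hu : ‖u‖ ^ 2 < m / 4096) :
    ‖(1 - sVar L x y / 2) * a‖ + ‖u ^ 2 / (2 * L) * b‖ ≤ 17 := by
  have h1 := norm_sub_le (1 : ℂ) (sVar L x y / 2)
  rw [norm_one, norm_div, norm_ofNat] at h1
  have h2 := h.norm_sVar_lt
  have h3 := h.norm_sq_div_le hu
  rw [norm_mul, norm_mul]
  have h4 := mul_le_mul (h1.trans (by linarith : _ ≤ (2 : ℝ))) ha (norm_nonneg _) (by norm_num)
  have h5 := mul_le_mul h3 hb (norm_nonneg _) (by norm_num)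
  linarith

theorem norm_posPlus_le (h : IsNearCircular m l L x y) (ε : ℝ) (j : Fin 2) :
    ‖S.posPlus ε j l L x y‖ ≤ ‖S.semiMajor ε j L‖ * 18 := by
  rw [posPlus, norm_mul]
  gcongr
  have h1 := h.norm_bracket_le h.norm_exp_le.1 h.norm_exp_le.2 h.norm_x
  have h2 := h.norm_kVar_lt
  refine (norm_sub_le _ _).trans ?_
  refine (add_le_add_left (norm_add_le _ _) _).trans ?_
  linarith

theorem norm_posMinus_le (h : IsNearCircular m l L x y) (ε : ℝ) (j : Fin 2) :
    ‖S.posMinus ε j l L x y‖ ≤ ‖S.semiMajor ε j L‖ * 18 := by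
  rw [posMinus, norm_mul]
  gcongr
  have h1 := h.norm_bracket_le (u := I * y) h.norm_exp_le.2 h.norm_exp_le.1
    (by simpa using h.norm_y)
  have h2 := h.norm_kbarVar_lt
  refine (norm_sub_le _ _).trans ?_
  refine (add_le_add_left (norm_add_le _ _) _).trans ?_
  linarith

theorem norm_momPlus_le (h : IsNearCircular m l L x y) (ε : ℝ) (j : Fin 2) :
    ‖S.momPlus ε j l L x y‖ ≤ ‖(S.mu ε j * S.beta ε j ^ 2 / L : ℂ)‖ * 24 := by
  rw [momPlus, norm_div, norm_mul, div_le_iff₀ (by linarith [h.le_norm_dVar])]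
  have h1 := h.norm_bracket_le h.norm_exp_le.1 h.norm_exp_le.2 h.norm_x
  rw [mul_assoc]
  gcongr
  rw [norm_mul, norm_I, one_mul]
  refine (norm_sub_le _ _).trans (h1.trans ?_)
  linarith [h.le_norm_dVar]

theorem norm_momMinus_le (h : IsNearCircular m l L x y) (ε : ℝ) (j : Fin 2) :
    ‖S.momMinus ε j l L x y‖ ≤ ‖(S.mu ε j * S.beta ε j ^ 2 / L : ℂ)‖ * 24 := by
  rw [momMinus, norm_div, norm_mul, div_le_iff₀ (by linarith [h.le_norm_dVar])]
  have h1 := h.norm_bracket_le (u := I * y) h.norm_exp_le.2 h.norm_exp_le.1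
    (by simpa using h.norm_y)
  rw [mul_assoc]
  gcongr
  rw [norm_mul, norm_neg, norm_I, one_mul]
  refine (norm_sub_le _ _).trans (h1.trans ?_)
  linarith [h.le_norm_dVar]

end IsNearCircular

section Analytic

variable {E : Type*} [NormedAddCommGroup E] [NormedSpace ℂ E] {l L x y : E → ℂ} {z : E} {m : ℝ}

theorem analyticAt_sVar (hL : AnalyticAt ℂ L z) (hx : AnalyticAt ℂ x z) (hy : AnalyticAt ℂ y z)
    (h0 : L z ≠ 0) : AnalyticAt ℂ (fun z => sVar (L z) (x z) (y z)) z :=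
  (hx.mul (analyticAt_const.mul hy)).div hL h0

theorem analyticAt_kVar (hL : AnalyticAt ℂ L z) (hx : AnalyticAt ℂ x z) (hy : AnalyticAt ℂ y z)
    (h : IsNearCircular m (l z) (L z) (x z) (y z)) :
    AnalyticAt ℂ (fun z => kVar (L z) (x z) (y z)) z :=
  (hx.mul ((analyticAt_const.sub (analyticAt_sVar hL hx hy h.ne_zero)).csqrt
    h.two_sub_mem_slitPlane)).div (hL.csqrt h.mem_slitPlane) (csqrt_ne_zero h.ne_zero)

theorem analyticAt_kbarVar (hL : AnalyticAt ℂ L z) (hx : AnalyticAt ℂ x z) (hy : AnalyticAt ℂ y z)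
    (h : IsNearCircular m (l z) (L z) (x z) (y z)) :
    AnalyticAt ℂ (fun z => kbarVar (L z) (x z) (y z)) z :=
  ((analyticAt_const.mul hy).mul ((analyticAt_const.sub (analyticAt_sVar hL hx hy h.ne_zero)).csqrt
    h.two_sub_mem_slitPlane)).div (hL.csqrt h.mem_slitPlane) (csqrt_ne_zero h.ne_zero)

theorem analyticAt_fVar (hl : AnalyticAt ℂ l z) (hL : AnalyticAt ℂ L z) (hx : AnalyticAt ℂ x z)
    (hy : AnalyticAt ℂ y z) (h : IsNearCircular m (l z) (L z) (x z) (y z)) :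
    AnalyticAt ℂ (fun z => fVar (l z) (L z) (x z) (y z)) z :=
  AnalyticAt.comp (g := fun p : ℂ × ℂ × ℂ => eccLongitude p.1 p.2.1 p.2.2)
    (f := fun z => (l z, kVar (L z) (x z) (y z), kbarVar (L z) (x z) (y z)))
    (analyticAt_eccLongitude h.im_lt h.norm_kVar_lt h.norm_kbarVar_lt)
    (hl.prod ((analyticAt_kVar hL hx hy h).prod (analyticAt_kbarVar hL hx hy h)))

variable (hl : AnalyticAt ℂ l z) (hL : AnalyticAt ℂ L z) (hx : AnalyticAt ℂ x z)
    (hy : AnalyticAt ℂ y z) (h : IsNearCircular m (l z) (L z) (x z) (y z))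
include hl hL hx hy h

theorem analyticAt_posPlus (ε : ℝ) (j : Fin 2) :
    AnalyticAt ℂ (fun z => S.posPlus ε j (l z) (L z) (x z) (y z)) z := by
  have h1 := analyticAt_fVar hl hL hx hy h
  have h2 := analyticAt_sVar hL hx hy h.ne_zero
  have h3 := analyticAt_kVar hL hx hy h
  have h0 : 2 * L z ≠ 0 := by simpa using h.ne_zero
  simp only [posPlus, semiMajor, div_eq_mul_inv]
  fun_prop (disch := assumption)

theorem analyticAt_posMinus (ε : ℝ) (j : Fin 2) :
    AnalyticAt ℂ (fun z => S.posMinus ε j (l z) (L z) (x z) (y z)) z := by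
  have h1 := analyticAt_fVar hl hL hx hy h
  have h2 := analyticAt_sVar hL hx hy h.ne_zero
  have h3 := analyticAt_kbarVar hL hx hy h
  have h0 : 2 * L z ≠ 0 := by simpa using h.ne_zero
  simp only [posMinus, semiMajor, div_eq_mul_inv]
  fun_prop (disch := assumption)

theorem analyticAt_dVar : AnalyticAt ℂ (fun z => dVar (l z) (L z) (x z) (y z)) z := by
  have h1 := analyticAt_fVar hl hL hx hy h
  have h2 := analyticAt_kVar hL hx hy h
  have h3 := analyticAt_kbarVar hL hx hy h
  simp only [dVar, div_eq_mul_inv]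
  fun_prop

theorem analyticAt_momPlus (ε : ℝ) (j : Fin 2) :
    AnalyticAt ℂ (fun z => S.momPlus ε j (l z) (L z) (x z) (y z)) z := by
  have h1 := analyticAt_fVar hl hL hx hy h
  have h2 := analyticAt_sVar hL hx hy h.ne_zero
  have h0 : 2 * L z ≠ 0 := by simpa using h.ne_zero
  have h3 := analyticAt_dVar hl hL hx hy h
  have h4 := h.dVar_ne_zero
  have h5 := h.ne_zero
  simp only [momPlus, div_eq_mul_inv]
  fun_prop (disch := assumption)

theorem analyticAt_momMinus (ε : ℝ) (j : Fin 2) :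
    AnalyticAt ℂ (fun z => S.momMinus ε j (l z) (L z) (x z) (y z)) z := by
  have h1 := analyticAt_fVar hl hL hx hy h
  have h2 := analyticAt_sVar hL hx hy h.ne_zero
  have h0 : 2 * L z ≠ 0 := by simpa using h.ne_zero
  have h3 := analyticAt_dVar hl hL hx hy h
  have h4 := h.dVar_ne_zero
  have h5 := h.ne_zero
  simp only [momMinus, div_eq_mul_inv]
  fun_prop (disch := assumption)

end Analytic

section Symmetry

variable {m : ℝ} {l L x y : ℂ}

theorem fVar_add_two_pi (h : IsNearCircular m l L x y) :
    fVar (l + 2 * Real.pi) L x y = fVar l L x y + 2 * Real.pi :=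
  eccLongitude_add_two_pi h.im_lt.le h.norm_kVar_lt.le h.norm_kbarVar_lt.le

theorem exp_I_mul_fVar_add_two_pi (h : IsNearCircular m l L x y) :
    exp (I * fVar (l + 2 * Real.pi) L x y) = exp (I * fVar l L x y) := by
  rw [fVar_add_two_pi h, ← exp_periodic (I * fVar l L x y)]
  congr 1; ring

theorem posPlus_add_two_pi (h : IsNearCircular m l L x y) (ε : ℝ) (j : Fin 2) :
    S.posPlus ε j (l + 2 * Real.pi) L x y = S.posPlus ε j l L x y := by
  simp only [posPlus, exp_neg, exp_I_mul_fVar_add_two_pi h]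

theorem posMinus_add_two_pi (h : IsNearCircular m l L x y) (ε : ℝ) (j : Fin 2) :
    S.posMinus ε j (l + 2 * Real.pi) L x y = S.posMinus ε j l L x y := by
  simp only [posMinus, exp_neg, exp_I_mul_fVar_add_two_pi h]

theorem momPlus_add_two_pi (h : IsNearCircular m l L x y) (ε : ℝ) (j : Fin 2) :
    S.momPlus ε j (l + 2 * Real.pi) L x y = S.momPlus ε j l L x y := by
  simp only [momPlus, dVar, exp_neg, exp_I_mul_fVar_add_two_pi h]

theorem momMinus_add_two_pi (h : IsNearCircular m l L x y) (ε : ℝ) (j : Fin 2) :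
    S.momMinus ε j (l + 2 * Real.pi) L x y = S.momMinus ε j l L x y := by
  simp only [momMinus, dVar, exp_neg, exp_I_mul_fVar_add_two_pi h]

open scoped ComplexConjugate

theorem sVar_conj : sVar (conj L) (-I * conj y) (-I * conj x) = conj (sVar L x y) := by
  simp only [sVar, map_div₀, map_mul, conj_I]
  congr 1
  ring_nf
  simp

theorem kVar_conj (h : IsNearCircular m l L x y) :
    kVar (conj L) (-I * conj y) (-I * conj x) = conj (kbarVar L x y) := by
  have h1 : (2 : ℂ) - conj (sVar L x y) = conj (2 - sVar L x y) := by
    rw [map_sub, map_ofNat]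
  simp only [kVar, kbarVar, sVar_conj, h1, csqrt_conj h.two_sub_mem_slitPlane,
    csqrt_conj h.mem_slitPlane, map_div₀, map_mul, conj_I]

theorem kbarVar_conj (h : IsNearCircular m l L x y) :
    kbarVar (conj L) (-I * conj y) (-I * conj x) = conj (kVar L x y) := by
  have h1 : (2 : ℂ) - conj (sVar L x y) = conj (2 - sVar L x y) := by
    rw [map_sub, map_ofNat]
  have h2 : I * (-I * conj x) = conj x := by rw [← mul_assoc]; simp
  simp only [kVar, kbarVar, sVar_conj, h1, csqrt_conj h.two_sub_mem_slitPlane,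
    csqrt_conj h.mem_slitPlane, map_div₀, map_mul, h2]

theorem fVar_conj (h : IsNearCircular m l L x y) :
    fVar (conj l) (conj L) (-I * conj y) (-I * conj x) = conj (fVar l L x y) := by
  rw [fVar, kVar_conj h, kbarVar_conj h]
  exact eccLongitude_conj h.im_lt.le h.norm_kVar_lt.le h.norm_kbarVar_lt.le

theorem exp_fVar_conj (h : IsNearCircular m l L x y) :
    exp (I * fVar (conj l) (conj L) (-I * conj y) (-I * conj x))
      = conj (exp (-(I * fVar l L x y))) ∧
    exp (-(I * fVar (conj l) (conj L) (-I * conj y) (-I * conj x)))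
      = conj (exp (I * fVar l L x y)) := by
  rw [fVar_conj h, ← exp_conj, ← exp_conj]
  simp

theorem posPlus_conj (h : IsNearCircular m l L x y) (ε : ℝ) (j : Fin 2) :
    S.posPlus ε j (conj l) (conj L) (-I * conj y) (-I * conj x) = conj (S.posMinus ε j l L x y) := by
  simp only [posPlus, posMinus, semiMajor, (exp_fVar_conj h).1, (exp_fVar_conj h).2, kVar_conj h,
    sVar_conj, map_mul, map_div₀, map_add, map_sub, map_pow, map_one, map_ofNat, conj_ofReal, conj_I]

theorem posMinus_conj (h : IsNearCircular m l L x y) (ε : ℝ) (j : Fin 2) :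
    S.posMinus ε j (conj l) (conj L) (-I * conj y) (-I * conj x) = conj (S.posPlus ε j l L x y) := by
  have h2 : I * (-I * conj x) = conj x := by rw [← mul_assoc]; simp
  simp only [posPlus, posMinus, semiMajor, (exp_fVar_conj h).1, (exp_fVar_conj h).2, kbarVar_conj h,
    sVar_conj, map_mul, map_div₀, map_add, map_sub, map_pow, map_one, map_ofNat, conj_ofReal, h2]

theorem dVar_conj (h : IsNearCircular m l L x y) :
    dVar (conj l) (conj L) (-I * conj y) (-I * conj x) = conj (dVar l L x y) := by
  simp only [dVar, (exp_fVar_conj h).1, (exp_fVar_conj h).2, kbarVar_conj h, kVar_conj h,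
    map_mul, map_div₀, map_add, map_sub, map_one, map_ofNat]
  rw [add_comm]

theorem momPlus_conj (h : IsNearCircular m l L x y) (ε : ℝ) (j : Fin 2) :
    S.momPlus ε j (conj l) (conj L) (-I * conj y) (-I * conj x) = conj (S.momMinus ε j l L x y) := by
  simp only [momPlus, momMinus, (exp_fVar_conj h).1, (exp_fVar_conj h).2, dVar_conj h,
    sVar_conj, map_mul, map_div₀, map_sub, map_neg, map_pow, map_one, map_ofNat, conj_ofReal, conj_I,
    neg_neg]

theorem momMinus_conj (h : IsNearCircular m l L x y) (ε : ℝ) (j : Fin 2) :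
    S.momMinus ε j (conj l) (conj L) (-I * conj y) (-I * conj x) = conj (S.momPlus ε j l L x y) := by
  have h2 : I * (-I * conj x) = conj x := by rw [← mul_assoc]; simp
  simp only [momPlus, momMinus, (exp_fVar_conj h).1, (exp_fVar_conj h).2, dVar_conj h,
    sVar_conj, map_mul, map_div₀, map_sub, map_pow, map_one, map_ofNat, conj_ofReal, conj_I, h2]

end Symmetry

theorem posPlus_circular (ε : ℝ) (j : Fin 2) (l : ℝ) (L : ℂ) :
    S.posPlus ε j l L 0 0 = S.semiMajor ε j L * exp (I * l) := by
  simp [posPlus, sVar, kVar, kbarVar, fVar, eccLongitude_zero]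

theorem posMinus_circular (ε : ℝ) (j : Fin 2) (l : ℝ) (L : ℂ) :
    S.posMinus ε j l L 0 0 = S.semiMajor ε j L * exp (-(I * l)) := by
  simp [posMinus, sVar, kVar, kbarVar, fVar, eccLongitude_zero]

end PlanetarySystem

/-! ### The planetary perturbation near the resonant cylinder -/

namespace Phase

theorem domain_mono {Δ ρ σ ρ' σ' : ℝ} (hρ0 : 0 ≤ ρ) (hσ0 : 0 ≤ σ) (hρ : ρ ≤ ρ') (hσ : σ ≤ σ') :
    domain Δ ρ σ ⊆ domain Δ ρ' σ' := by
  rintro z ⟨θ, hθ, h⟩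
  have hs : Real.sqrt (ρ * σ) ≤ Real.sqrt (ρ' * σ') :=
    Real.sqrt_le_sqrt (mul_le_mul hρ hσ hσ0 (hρ0.trans hρ))
  exact ⟨θ, hθ, fun j => ⟨(h j).1.trans hσ, (h j).2.1.trans hρ, (h j).2.2.1.trans hs,
    (h j).2.2.2.trans hs⟩⟩

/-- The resonant circular configuration with angles `ζ_j = θ_j`. -/
def circular (θ : Fin 2 → ℝ) : Phase := ![fun j => (θ j : ℂ), 0, 0, 0]

/-- The anti-holomorphic involution whose fixed points are the real points. -/
def conjPoint (z : Phase) : Phase :=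
  ![fun j => starRingEnd ℂ (z 0 j), fun j => starRingEnd ℂ (z 1 j),
    fun j => -I * starRingEnd ℂ (z 3 j), fun j => -I * starRingEnd ℂ (z 2 j)]

theorem norm_le_iff {z : Phase} {r : ℝ} (hr : 0 ≤ r) :
    ‖z‖ ≤ r ↔ ∀ j, ‖z 0 j‖ ≤ r ∧ ‖z 1 j‖ ≤ r ∧ ‖z 2 j‖ ≤ r ∧ ‖z 3 j‖ ≤ r := by
  rw [pi_norm_le_iff_of_nonneg hr]
  simp only [pi_norm_le_iff_of_nonneg hr, Fin.forall_fin_succ (n := 3), Fin.forall_fin_succ (n := 2),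
    Fin.forall_fin_succ (n := 1), Fin.forall_fin_succ (n := 0)]
  simp
  tauto

theorem norm_apply_le (z : Phase) (k : Fin 4) (j : Fin 2) : ‖z k j‖ ≤ ‖z‖ :=
  (norm_le_pi_norm (z k) j).trans (norm_le_pi_norm z k)

end Phase

namespace PlanetarySystem

variable (S : PlanetarySystem)

theorem denom_pos {ε : ℝ} (hε : 0 ≤ ε) (j : Fin 2) : 0 < S.m₀ + ε * S.m j :=
  add_pos_of_pos_of_nonneg S.m₀_pos (mul_nonneg hε (S.m_pos j).le)

theorem beta_pos {ε : ℝ} (hε : 0 ≤ ε) (j : Fin 2) : 0 < S.beta ε j :=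
  div_pos (mul_pos S.m₀_pos (S.m_pos j)) (S.denom_pos hε j)

theorem mu_pos {ε : ℝ} (hε : 0 ≤ ε) (j : Fin 2) : 0 < S.mu ε j :=
  mul_pos S.G_pos (S.denom_pos hε j)

theorem lam0_pos {ε : ℝ} (hε : 0 ≤ ε) (j : Fin 2) : 0 < S.lam0 ε j :=
  Real.rpow_pos_of_pos (div_pos (mul_pos (pow_pos (S.mu_pos hε j) 2) (pow_pos (S.beta_pos hε j) 3))
    S.ω_pos) _

theorem lam0_pow_three {ε : ℝ} (hε : 0 ≤ ε) (j : Fin 2) :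
    S.mu ε j ^ 2 * S.beta ε j ^ 3 = S.ω * S.lam0 ε j ^ 3 := by
  have h : 0 ≤ S.mu ε j ^ 2 * S.beta ε j ^ 3 / S.ω :=
    (div_pos (mul_pos (pow_pos (S.mu_pos hε j) 2) (pow_pos (S.beta_pos hε j) 3)) S.ω_pos).le
  have h3 : S.lam0 ε j ^ 3 = S.mu ε j ^ 2 * S.beta ε j ^ 3 / S.ω := by
    rw [lam0, ← Real.rpow_natCast (_ ^ (1 / 3 : ℝ)), ← Real.rpow_mul h]
    norm_num
  rw [h3, mul_div_cancel₀ _ S.ω_pos.ne']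

theorem radius_pos {ε : ℝ} (hε : 0 ≤ ε) (j : Fin 2) : 0 < S.radius ε j :=
  div_pos (pow_pos (S.lam0_pos hε j) 2) (mul_pos (pow_pos (S.beta_pos hε j) 2) (S.mu_pos hε j))

theorem continuousOn_beta (j : Fin 2) : ContinuousOn (fun ε => S.beta ε j) (Icc 0 1) :=
  continuousOn_const.div (by fun_prop) fun _ hε => (S.denom_pos hε.1 j).ne'

theorem continuousOn_mu (j : Fin 2) : ContinuousOn (fun ε => S.mu ε j) (Icc 0 1) := by
  unfold mu; fun_prop

theorem continuousOn_lam0 (j : Fin 2) : ContinuousOn (fun ε => S.lam0 ε j) (Icc 0 1) :=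
  ((((S.continuousOn_mu j).pow 2).mul ((S.continuousOn_beta j).pow 3)).div_const _).rpow_const
    fun _ _ => Or.inr (by norm_num)

/-- By compactness of `[0, 1]` the parameters of the two orbits are bounded uniformly in the mass
ratio. -/
theorem exists_parameter_bounds : ∃ a B : ℝ, 0 < a ∧ 0 < B ∧ ∀ ε ∈ Icc (0 : ℝ) 1, ∀ j,
    a ≤ S.lam0 ε j ∧ S.lam0 ε j ≤ B ∧ S.mu ε j * S.beta ε j ^ 2 ≤ B ∧
      (S.beta ε j ^ 2 * S.mu ε j)⁻¹ ≤ B ∧ S.radius ε j ≤ B := by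
  have hne : (Icc (0 : ℝ) 1).Nonempty := ⟨0, by simp⟩
  have hmin : ∀ j, ∃ a, 0 < a ∧ ∀ ε ∈ Icc (0 : ℝ) 1, a ≤ S.lam0 ε j := by
    intro j
    obtain ⟨ε₀, h0, hm⟩ := isCompact_Icc.exists_isMinOn hne (S.continuousOn_lam0 j)
    exact ⟨_, S.lam0_pos h0.1 j, fun ε hε => hm hε⟩
  have hinv : ∀ j, ContinuousOn (fun ε => (S.beta ε j ^ 2 * S.mu ε j)⁻¹) (Icc 0 1) := fun j =>
    (((S.continuousOn_beta j).pow 2).mul (S.continuousOn_mu j)).inv₀ fun ε hε =>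
      (mul_pos (pow_pos (S.beta_pos hε.1 j) 2) (S.mu_pos hε.1 j)).ne'
  have hmax : ∀ j, ∃ B, ∀ ε ∈ Icc (0 : ℝ) 1, S.lam0 ε j ≤ B ∧ S.mu ε j * S.beta ε j ^ 2 ≤ B ∧
      (S.beta ε j ^ 2 * S.mu ε j)⁻¹ ≤ B ∧ S.radius ε j ≤ B := by
    intro j
    obtain ⟨B₁, h₁⟩ := isCompact_Icc.exists_bound_of_continuousOn (S.continuousOn_lam0 j)
    obtain ⟨B₂, h₂⟩ := isCompact_Icc.exists_bound_of_continuousOn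
      ((S.continuousOn_mu j).mul ((S.continuousOn_beta j).pow 2))
    obtain ⟨B₃, h₃⟩ := isCompact_Icc.exists_bound_of_continuousOn (hinv j)
    obtain ⟨B₄, h₄⟩ := isCompact_Icc.exists_bound_of_continuousOn
      (((S.continuousOn_lam0 j).pow 2).mul (hinv j))
    refine ⟨max (max B₁ B₂) (max B₃ B₄), fun ε hε => ⟨?_, ?_, ?_, ?_⟩⟩
    · exact ((le_abs_self _).trans (h₁ ε hε)).trans (by simp)
    · exact ((le_abs_self _).trans (h₂ ε hε)).trans (by simp)
    · exact ((le_abs_self _).trans (h₃ ε hε)).trans (by simp)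
    · refine ((le_abs_self _).trans ?_).trans ((h₄ ε hε).trans (by simp))
      rw [Real.norm_eq_abs, radius, div_eq_mul_inv]; rfl
  obtain ⟨a₀, ha₀, h₀⟩ := hmin 0
  obtain ⟨a₁, ha₁, h₁⟩ := hmin 1
  obtain ⟨B₀, k₀⟩ := hmax 0
  obtain ⟨B₁, k₁⟩ := hmax 1
  have z0 : (0 : ℝ) ∈ Icc (0 : ℝ) 1 := by simp
  have hB₀ : 0 < B₀ := (S.lam0_pos le_rfl 0).trans_le (k₀ 0 z0).1
  refine ⟨min a₀ a₁, max B₀ B₁, lt_min ha₀ ha₁, lt_max_of_lt_left hB₀, fun ε hε j => ?_⟩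
  fin_cases j
  · obtain ⟨p, q, r, s⟩ := k₀ ε hε
    exact ⟨(min_le_left _ _).trans (h₀ ε hε), p.trans (le_max_left _ _), q.trans (le_max_left _ _),
      r.trans (le_max_left _ _), s.trans (le_max_left _ _)⟩
  · obtain ⟨p, q, r, s⟩ := k₁ ε hε
    exact ⟨(min_le_right _ _).trans (h₁ ε hε), p.trans (le_max_right _ _),
      q.trans (le_max_right _ _), r.trans (le_max_right _ _), s.trans (le_max_right _ _)⟩

variable {S} {a B ε Δ : ℝ} {z : Phase}

theorem norm_action_sub_le {ρ : ℝ} (h : ∀ j, ‖z 1 j‖ ≤ ρ) (j : Fin 2) :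
    ‖S.action ε z j - S.lam0 ε j‖ ≤ 2 * ρ := by
  have h0 := h 0
  have h1 := h 1
  fin_cases j
  · simp only [action, Fin.zero_eta, Matrix.cons_val_zero, add_sub_cancel_left]
    linarith [norm_nonneg (z 1 0)]
  · have e : S.action ε z 1 - S.lam0 ε 1 = z 1 1 - z 1 0 := by
      simp only [action, Matrix.cons_val_one, Matrix.cons_val_fin_one]
      ring
    simp only [Fin.mk_one, e]
    linarith [norm_sub_le (z 1 1) (z 1 0)]

theorem isNearCircular_of_mem_domain (ha : 0 < a) (hlam : ∀ j, a ≤ S.lam0 ε j)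
    (hz : z ∈ Phase.domain Δ (a / 4096) (1 / 4)) (j : Fin 2) :
    IsNearCircular (a / 2) (meanLong z j) (S.action ε z j) (z 2 j) (z 3 j) := by
  obtain ⟨θ, -, h⟩ := hz
  have hact := norm_action_sub_le (S := S) (ε := ε) (fun j => (h j).2.1) j
  have him : ∀ j, |(z 0 j).im| ≤ 1 / 4 := by
    intro j
    have := (abs_im_le_norm _).trans (h j).1
    simpa using this
  have hsq : ∀ u : ℂ, ‖u‖ ≤ Real.sqrt (a / 4096 * (1 / 4)) → ‖u‖ ^ 2 < a / 2 / 4096 := by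
    intro u hu
    have h1 := pow_le_pow_left₀ (norm_nonneg u) hu 2
    rw [Real.sq_sqrt (by positivity)] at h1
    linarith
  refine ⟨by linarith, ?_, ?_, hsq _ (h j).2.2.1, hsq _ (h j).2.2.2⟩
  · have h0 := abs_le.1 (him 0)
    have h1 := abs_le.1 (him 1)
    rw [abs_lt]
    fin_cases j
    · simp [meanLong]; constructor <;> linarith
    · simp [meanLong]; constructor <;> linarith
  · have h1 := (abs_le.1 ((abs_re_le_norm _).trans hact)).1
    simp only [sub_re, ofReal_re] at h1
    have := hlam j
    linarith

theorem analyticAt_coord (k : Fin 4) (j : Fin 2) : AnalyticAt ℂ (fun z : Phase => z k j) z :=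
  ((ContinuousLinearMap.proj j : (Fin 2 → ℂ) →L[ℂ] ℂ).comp
    (ContinuousLinearMap.proj k : Phase →L[ℂ] (Fin 2 → ℂ))).analyticAt z

theorem analyticAt_meanLong (j : Fin 2) : AnalyticAt ℂ (fun z => meanLong z j) z := by
  fin_cases j
  · exact (analyticAt_coord 0 0).add (analyticAt_coord 0 1)
  · exact analyticAt_coord 0 1

theorem analyticAt_action (j : Fin 2) : AnalyticAt ℂ (fun z => S.action ε z j) z := by
  fin_cases j
  · exact analyticAt_const.add (analyticAt_coord 1 0)
  · exact (analyticAt_const.sub (analyticAt_coord 1 0)).add (analyticAt_coord 1 1)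

section NearCircular

variable {m : ℝ}
  (h : ∀ j, IsNearCircular m (meanLong z j) (S.action ε z j) (z 2 j) (z 3 j))
include h

theorem analyticAt_position (j i : Fin 2) : AnalyticAt ℂ (fun z => S.position ε z j i) z := by
  have hp := S.analyticAt_posPlus (analyticAt_meanLong j) (analyticAt_action j)
    (analyticAt_coord 2 j) (analyticAt_coord 3 j) (h j) ε j
  have hq := S.analyticAt_posMinus (analyticAt_meanLong j) (analyticAt_action j)
    (analyticAt_coord 2 j) (analyticAt_coord 3 j) (h j) ε j
  fin_cases i
  · exact (hp.add hq).div_const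
  · exact (hp.sub hq).div_const

theorem analyticAt_momentum (j i : Fin 2) : AnalyticAt ℂ (fun z => S.momentum ε z j i) z := by
  have hp := S.analyticAt_momPlus (analyticAt_meanLong j) (analyticAt_action j)
    (analyticAt_coord 2 j) (analyticAt_coord 3 j) (h j) ε j
  have hq := S.analyticAt_momMinus (analyticAt_meanLong j) (analyticAt_action j)
    (analyticAt_coord 2 j) (analyticAt_coord 3 j) (h j) ε j
  fin_cases i
  · exact (hp.add hq).div_const
  · exact (hp.sub hq).div_const

theorem analyticAt_upsilon : AnalyticAt ℂ (S.upsilon ε) z := by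
  refine AnalyticAt.prod ?_ ?_
  · exact AnalyticAt.pi fun j => AnalyticAt.pi fun i => analyticAt_momentum h j i
  · exact AnalyticAt.pi fun j => AnalyticAt.pi fun i => analyticAt_position h j i

omit h in
theorem norm_cartesian_le {p q : ℂ} {r : ℝ} (hp : ‖p‖ ≤ r) (hq : ‖q‖ ≤ r) (i : Fin 2) :
    ‖(![(p + q) / 2, (p - q) / (2 * I)] : Fin 2 → ℂ) i‖ ≤ r := by
  have h1 := norm_add_le p q
  have h2 := norm_sub_le p q
  fin_cases i
  · simp; linarith
  · simp; linarith

theorem norm_position_le (hε : 0 ≤ ε) (hinv : ∀ j, (S.beta ε j ^ 2 * S.mu ε j)⁻¹ ≤ B)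
    (hL : ∀ j, ‖S.action ε z j‖ ≤ 2 * B) (j i : Fin 2) : ‖S.position ε z j i‖ ≤ 72 * B ^ 3 := by
  have hs : ‖S.semiMajor ε j (S.action ε z j)‖ ≤ 4 * B ^ 3 := by
    have h1 : ‖(S.beta ε j ^ 2 * S.mu ε j : ℂ)⁻¹‖ ≤ B := by
      have h2 : (S.beta ε j ^ 2 * S.mu ε j : ℂ)⁻¹ = (((S.beta ε j ^ 2 * S.mu ε j)⁻¹ : ℝ) : ℂ) := by
        push_cast; rfl
      rw [h2, norm_real, Real.norm_of_nonneg]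
      · exact hinv j
      · exact inv_nonneg.2 (mul_pos (pow_pos (S.beta_pos hε j) 2) (S.mu_pos hε j)).le
    rw [semiMajor, div_eq_mul_inv, norm_mul, norm_pow]
    refine (mul_le_mul (pow_le_pow_left₀ (norm_nonneg _) (hL j) 2) h1 (norm_nonneg _)
      (by positivity)).trans_eq (by ring)
  refine norm_cartesian_le ?_ ?_ i
  · exact ((h j).norm_posPlus_le S ε j).trans (by linarith)
  · exact ((h j).norm_posMinus_le S ε j).trans (by linarith)

theorem norm_momentum_le (hε : 0 ≤ ε) (hmu : ∀ j, S.mu ε j * S.beta ε j ^ 2 ≤ B) (j i : Fin 2) :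
    ‖S.momentum ε z j i‖ ≤ 24 * B / m := by
  have hs : ‖(S.mu ε j * S.beta ε j ^ 2 / S.action ε z j : ℂ)‖ ≤ B / m := by
    have h1 : (S.mu ε j * S.beta ε j ^ 2 : ℂ) = ((S.mu ε j * S.beta ε j ^ 2 : ℝ) : ℂ) := by
      push_cast; rfl
    have h0 : 0 ≤ S.mu ε j * S.beta ε j ^ 2 :=
      (mul_pos (S.mu_pos hε j) (pow_pos (S.beta_pos hε j) 2)).le
    rw [h1, norm_div, norm_real, Real.norm_of_nonneg h0]
    exact div_le_div₀ (h0.trans (hmu j)) (hmu j) (h j).pos (h j).le_norm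
  have e : 24 * B / m = B / m * 24 := by ring
  rw [e]
  refine norm_cartesian_le ?_ ?_ i
  · exact ((h j).norm_momPlus_le S ε j).trans (by linarith)
  · exact ((h j).norm_momMinus_le S ε j).trans (by linarith)

theorem position_momentum_add_two_pi (j : Fin 2) :
    S.position ε (z + ((2 * Real.pi : ℝ) : ℂ) • Phase.basisVec 0 1) j = S.position ε z j ∧
    S.momentum ε (z + ((2 * Real.pi : ℝ) : ℂ) • Phase.basisVec 0 1) j = S.momentum ε z j := by
  have e1 : meanLong (z + ((2 * Real.pi : ℝ) : ℂ) • Phase.basisVec 0 1) j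
      = meanLong z j + 2 * Real.pi := by
    fin_cases j
    · simp [meanLong, Phase.basisVec]; ring
    · simp [meanLong, Phase.basisVec]
  have e2 : S.action ε (z + ((2 * Real.pi : ℝ) : ℂ) • Phase.basisVec 0 1) = S.action ε z := by
    simp [action, Phase.basisVec]
  have e3 : ∀ k : Fin 4, k ≠ 0 →
      (z + ((2 * Real.pi : ℝ) : ℂ) • Phase.basisVec 0 1) k j = z k j := by
    intro k hk
    simp [Phase.basisVec, hk]
  constructor
  · simp only [position, e1, e2, e3 2 (by decide), e3 3 (by decide), posPlus_add_two_pi S (h j),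
      posMinus_add_two_pi S (h j)]
  · simp only [momentum, e1, e2, e3 2 (by decide), e3 3 (by decide), momPlus_add_two_pi S (h j),
      momMinus_add_two_pi S (h j)]

theorem HP_add_two_pi :
    S.HP ε (z + ((2 * Real.pi : ℝ) : ℂ) • Phase.basisVec 0 1) = S.HP ε z := by
  simp only [HP, (position_momentum_add_two_pi h _).1, (position_momentum_add_two_pi h _).2]

omit h in
open scoped ComplexConjugate in
theorem cartesian_conj (p q : ℂ) (i : Fin 2) :
    (![(conj q + conj p) / 2, (conj q - conj p) / (2 * I)] : Fin 2 → ℂ) i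
      = conj ((![(p + q) / 2, (p - q) / (2 * I)] : Fin 2 → ℂ) i) := by
  fin_cases i
  · simp only [Fin.zero_eta, Matrix.cons_val_zero, map_div₀, map_add, map_ofNat]
    rw [add_comm]
  · simp only [Fin.mk_one, Matrix.cons_val_one, Matrix.cons_val_fin_one, map_div₀, map_sub, map_mul,
      map_ofNat, conj_I]
    rw [mul_neg, div_neg, ← neg_div, neg_sub]

open scoped ComplexConjugate in
theorem position_momentum_conj (j i : Fin 2) :
    S.position ε z.conjPoint j i = conj (S.position ε z j i) ∧
    S.momentum ε z.conjPoint j i = conj (S.momentum ε z j i) := by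
  have e1 : meanLong z.conjPoint j = conj (meanLong z j) := by
    fin_cases j <;> simp [meanLong, Phase.conjPoint]
  have e2 : S.action ε z.conjPoint j = conj (S.action ε z j) := by
    fin_cases j <;> simp [action, Phase.conjPoint]
  have e3 : z.conjPoint 2 j = -I * conj (z 3 j) := rfl
  have e4 : z.conjPoint 3 j = -I * conj (z 2 j) := rfl
  constructor
  · simp only [position, e1, e2, e3, e4, posPlus_conj S (h j), posMinus_conj S (h j)]
    exact cartesian_conj _ _ i
  · simp only [momentum, e1, e2, e3, e4, momPlus_conj S (h j), momMinus_conj S (h j)]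
    exact cartesian_conj _ _ i

open scoped ComplexConjugate in
theorem HP_conjPoint
    (hD : ∑ i, (S.position ε z 0 i - S.position ε z 1 i) ^ 2 ∈ slitPlane) :
    S.HP ε z.conjPoint = conj (S.HP ε z) := by
  have e : csqrt (∑ i, (conj (S.position ε z 0 i) - conj (S.position ε z 1 i)) ^ 2)
      = conj (csqrt (∑ i, (S.position ε z 0 i - S.position ε z 1 i) ^ 2)) := by
    rw [← csqrt_conj hD]
    simp only [map_sum, map_pow, map_sub]
  simp only [HP, (position_momentum_conj h _ _).1, (position_momentum_conj h _ _).2, e]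
  simp only [map_mul, map_sub, map_div₀, map_sum, conj_ofReal]

end NearCircular

theorem position_circular (θ : Fin 2 → ℝ) (j : Fin 2) :
    S.position ε (Phase.circular θ) j =
      ![((S.radius ε j * Real.cos (![θ 0 + θ 1, θ 1] j) : ℝ) : ℂ),
        ((S.radius ε j * Real.sin (![θ 0 + θ 1, θ 1] j) : ℝ) : ℂ)] := by
  have e1 : meanLong (Phase.circular θ) j = ((![θ 0 + θ 1, θ 1] j : ℝ) : ℂ) := by
    fin_cases j <;> simp [meanLong, Phase.circular]
  have e2 : S.action ε (Phase.circular θ) j = S.lam0 ε j := by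
    fin_cases j <;> simp [action, Phase.circular]
  have e3 : S.semiMajor ε j (S.lam0 ε j) = S.radius ε j := by
    simp [semiMajor, radius]
  have e4 : Phase.circular θ 2 j = 0 := rfl
  have e5 : Phase.circular θ 3 j = 0 := rfl
  simp only [position, e1, e2, e4, e5, posPlus_circular, posMinus_circular, e3]
  set t : ℝ := ![θ 0 + θ 1, θ 1] j
  have h1 : exp (I * t) = cos t + sin t * I := by rw [mul_comm, exp_mul_I]
  have h2 : exp (-(I * t)) = cos t - sin t * I := by
    rw [show -(I * (t : ℂ)) = (-(t : ℂ)) * I by ring, exp_mul_I, Complex.cos_neg, Complex.sin_neg]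
    ring
  rw [h1, h2]
  push_cast
  congr 1
  · ring
  · congr 1
    field_simp
    ring

/-- On the resonant circular orbits the two planets are at distance at least `2 δ`. -/
theorem four_mul_delta_sq_le (hε : 0 ≤ ε) {θ : Fin 2 → ℝ} (hΔ : 0 < Δ)
    (hθ : θ 0 ∈ Ioo Δ (2 * Real.pi - Δ)) :
    4 * S.delta ε Δ ^ 2 ≤
      (S.radius ε 0 * Real.cos (θ 0 + θ 1) - S.radius ε 1 * Real.cos (θ 1)) ^ 2
      + (S.radius ε 0 * Real.sin (θ 0 + θ 1) - S.radius ε 1 * Real.sin (θ 1)) ^ 2 := by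
  have hs : Real.sin (Δ / 2) ≤ Real.sin (θ 0 / 2) := by
    obtain ⟨h1, h2⟩ := hθ
    rcases le_total (θ 0 / 2) (Real.pi / 2) with h | h
    · exact Real.sin_le_sin_of_le_of_le_pi_div_two (by linarith [Real.pi_pos]) h (by linarith)
    · rw [← Real.sin_pi_sub (θ 0 / 2)]
      exact Real.sin_le_sin_of_le_of_le_pi_div_two (by linarith [Real.pi_pos]) (by linarith)
        (by linarith)
  have hs0 : 0 ≤ Real.sin (Δ / 2) :=
    Real.sin_nonneg_of_nonneg_of_le_pi (by linarith) (by linarith [hθ.1, hθ.2])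
  have hr0 := S.radius_pos hε 0
  have hr1 := S.radius_pos hε 1
  have hm0 : 0 < min (S.radius ε 0) (S.radius ε 1) := lt_min hr0 hr1
  have hmm : min (S.radius ε 0) (S.radius ε 1) ^ 2 ≤ S.radius ε 0 * S.radius ε 1 := by
    rw [pow_two]
    exact mul_le_mul (min_le_left _ _) (min_le_right _ _) hm0.le hr0.le
  have hδ : S.delta ε Δ ^ 2 ≤ Real.sin (θ 0 / 2) ^ 2 * (S.radius ε 0 * S.radius ε 1) := by
    rw [delta, mul_pow]
    exact mul_le_mul (pow_le_pow_left₀ hs0 hs 2) hmm (by positivity) (by positivity)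
  have hcos : Real.cos (θ 0) = 1 - 2 * Real.sin (θ 0 / 2) ^ 2 := by
    rw [← Real.cos_sq_add_sin_sq (θ 0 / 2)]
    have := Real.cos_two_mul (θ 0 / 2)
    rw [show 2 * (θ 0 / 2) = θ 0 by ring] at this
    rw [this]
    nlinarith [Real.cos_sq_add_sin_sq (θ 0 / 2)]
  have hid : (S.radius ε 0 * Real.cos (θ 0 + θ 1) - S.radius ε 1 * Real.cos (θ 1)) ^ 2
      + (S.radius ε 0 * Real.sin (θ 0 + θ 1) - S.radius ε 1 * Real.sin (θ 1)) ^ 2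
      = S.radius ε 0 ^ 2 + S.radius ε 1 ^ 2
        - 2 * (S.radius ε 0 * S.radius ε 1) * Real.cos (θ 0) := by
    have h3 : Real.cos (θ 0) = Real.cos (θ 0 + θ 1) * Real.cos (θ 1)
        + Real.sin (θ 0 + θ 1) * Real.sin (θ 1) := by
      rw [← Real.cos_sub]; ring_nf
    rw [h3]
    linear_combination (S.radius ε 0 ^ 2) * Real.cos_sq_add_sin_sq (θ 0 + θ 1)
      + (S.radius ε 1 ^ 2) * Real.cos_sq_add_sin_sq (θ 1)
  rw [hid, hcos]
  nlinarith [sq_nonneg (S.radius ε 0 - S.radius ε 1)]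

end PlanetarySystem

namespace PlanetarySystem

variable {S : PlanetarySystem} {a B ε Δ : ℝ} {z : Phase}

theorem ball_subset_domain {ρ σ r : ℝ} (hρ : 0 ≤ ρ) (h1 : r ≤ ρ) (h2 : r ≤ σ)
    (hz : z ∈ Phase.domain Δ ρ σ) : Metric.ball z r ⊆ Phase.domain Δ (2 * ρ) (2 * σ) := by
  intro w hw
  rw [mem_ball_iff_norm] at hw
  obtain ⟨θ, hθ, h⟩ := hz
  have hr : 0 ≤ r := (norm_nonneg _).trans hw.le
  have hs : r ≤ Real.sqrt (ρ * σ) := Real.le_sqrt_of_sq_le (by rw [pow_two]; gcongr)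
  have hs2 : Real.sqrt (2 * ρ * (2 * σ)) = 2 * Real.sqrt (ρ * σ) := by
    rw [show 2 * ρ * (2 * σ) = 2 ^ 2 * (ρ * σ) by ring, Real.sqrt_mul (by norm_num),
      Real.sqrt_sq (by norm_num)]
  have hc : ∀ k j, ‖w k j - z k j‖ ≤ r := fun k j =>
    (Phase.norm_apply_le (w - z) k j).trans hw.le
  have hadd : ∀ (k : Fin 4) (j : Fin 2) (b t : ℝ), r ≤ t → ‖z k j‖ ≤ t → ‖w k j‖ ≤ 2 * t := by
    intro k j b t hrt ht
    have := norm_le_norm_sub_add (w k j) (z k j)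
    linarith [hc k j]
  refine ⟨θ, hθ, fun j => ⟨?_, hadd 1 j r ρ h1 (h j).2.1, ?_, ?_⟩⟩
  · have := norm_sub_le_norm_sub_add_norm_sub (w 0 j) (z 0 j) (θ j)
    linarith [hc 0 j, (h j).1]
  · rw [hs2]; exact hadd 2 j r _ hs (h j).2.2.1
  · rw [hs2]; exact hadd 3 j r _ hs (h j).2.2.2

/-- If the differential of `Υ` is bounded by `C` and `2 C σ ≤ δ / 4`, then the holomorphic extension
of `|r₁ - r₂|²` has real part at least `δ²`: compare with the circular configuration. -/
theorem delta_sq_le_re {C ρ σ : ℝ} (hε : 0 ≤ ε) (hΔ : 0 < Δ) (hρ : 0 < ρ) (hρσ : ρ ≤ σ)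
    (hΥ : ∀ z ∈ Phase.domain Δ ρ σ, AnalyticAt ℂ (S.upsilon ε) z ∧ ‖fderiv ℂ (S.upsilon ε) z‖ ≤ C)
    (hσ : 2 * (C * σ) ≤ S.delta ε Δ / 4) (hz : z ∈ Phase.domain Δ ρ σ) :
    S.delta ε Δ ^ 2 ≤ (∑ i, (S.position ε z 0 i - S.position ε z 1 i) ^ 2).re := by
  obtain ⟨θ, hθ, h⟩ := hz
  have hσ0 : 0 ≤ σ := hρ.le.trans hρσ
  have hsq : Real.sqrt (ρ * σ) ≤ σ := by
    rw [Real.sqrt_le_left hσ0, pow_two]; gcongr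
  have hcirc : Phase.circular θ ∈ Phase.domain Δ ρ σ := by
    refine ⟨θ, hθ, fun j => ⟨?_, ?_, ?_, ?_⟩⟩ <;> simp [Phase.circular, hσ0, hρ.le] <;>
      positivity
  -- the distance is estimated on the segment from `z` to the circular configuration
  have hseg : segment ℝ (Phase.circular θ) z ⊆ Phase.domain Δ ρ σ := by
    rintro w ⟨b, c, hb, hc, hbc, rfl⟩
    have hc1 : c ≤ 1 := by linarith
    have hmul : ∀ {u : ℂ} {t : ℝ}, ‖u‖ ≤ t → ‖(c : ℂ) * u‖ ≤ t := by
      intro u t hu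
      rw [norm_mul, norm_real, Real.norm_of_nonneg hc]
      nlinarith [norm_nonneg u]
    refine ⟨θ, hθ, fun j => ⟨?_, ?_, ?_, ?_⟩⟩
    · have e : (b • Phase.circular θ + c • z) 0 j - (θ j : ℂ) = c * (z 0 j - θ j) := by
        have hb' : b = 1 - c := by linarith
        simp only [Phase.circular, Pi.add_apply, Pi.smul_apply, Matrix.cons_val_zero, real_smul, hb']
        push_cast; ring
      rw [e]; exact hmul (h j).1
    · simpa [Phase.circular] using hmul (h j).2.1
    · simpa [Phase.circular] using hmul (h j).2.2.1
    · simpa [Phase.circular] using hmul (h j).2.2.2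
  have hdist : ‖z - Phase.circular θ‖ ≤ σ := by
    rw [Phase.norm_le_iff hσ0]
    intro j
    refine ⟨?_, ?_, ?_, ?_⟩
    · simpa [Phase.circular] using (h j).1
    · simpa [Phase.circular] using (h j).2.1.trans hρσ
    · simpa [Phase.circular] using (h j).2.2.1.trans hsq
    · simpa [Phase.circular] using (h j).2.2.2.trans hsq
  have hmv := (convex_segment (Phase.circular θ) z).norm_image_sub_le_of_norm_fderiv_le (𝕜 := ℂ)
    (f := S.upsilon ε) (C := C) (fun w hw => (hΥ w (hseg hw)).1.differentiableAt)
    (fun w hw => (hΥ w (hseg hw)).2) (left_mem_segment ℝ _ _) (right_mem_segment ℝ _ _)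
  have hC : 0 ≤ C := (norm_nonneg _).trans (hΥ _ hcirc).2
  have hpos : ∀ j i, ‖S.position ε z j i - S.position ε (Phase.circular θ) j i‖ ≤ C * σ := by
    intro j i
    have h1 : ‖(S.upsilon ε z - S.upsilon ε (Phase.circular θ)).2 j i‖
        ≤ ‖S.upsilon ε z - S.upsilon ε (Phase.circular θ)‖ :=
      ((norm_le_pi_norm _ i).trans (norm_le_pi_norm _ j)).trans (norm_snd_le _)
    exact h1.trans (hmv.trans (by gcongr))
  have hreal : ∀ i, ∃ u : ℝ,
      S.position ε (Phase.circular θ) 0 i - S.position ε (Phase.circular θ) 1 i = u ∧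
      u = ![S.radius ε 0 * Real.cos (θ 0 + θ 1) - S.radius ε 1 * Real.cos (θ 1),
        S.radius ε 0 * Real.sin (θ 0 + θ 1) - S.radius ε 1 * Real.sin (θ 1)] i := by
    intro i
    refine ⟨_, ?_, rfl⟩
    rw [position_circular, position_circular]
    fin_cases i <;> simp
  choose u hu hu' using hreal
  have hterm : ∀ i, u i ^ 2 / 2 - 3 * (S.delta ε Δ / 4) ^ 2
      ≤ ((S.position ε z 0 i - S.position ε z 1 i) ^ 2).re := by
    intro i
    obtain ⟨v, hv⟩ : ∃ v, S.position ε z 0 i - S.position ε z 1 i = u i + v :=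
      ⟨_, (add_sub_cancel _ _).symm⟩
    have hvn : ‖v‖ ≤ S.delta ε Δ / 4 := by
      have e : v = (S.position ε z 0 i - S.position ε (Phase.circular θ) 0 i)
          - (S.position ε z 1 i - S.position ε (Phase.circular θ) 1 i) := by
        rw [← sub_eq_iff_eq_add'.2 hv, ← hu i]; ring
      rw [e]
      refine (norm_sub_le _ _).trans ?_
      linarith [hpos 0 i, hpos 1 i]
    have h1 : v.re ^ 2 + v.im ^ 2 ≤ (S.delta ε Δ / 4) ^ 2 := by
      have h2 := pow_le_pow_left₀ (norm_nonneg v) hvn 2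
      rw [← normSq_eq_norm_sq, normSq_apply] at h2
      linarith
    rw [hv, pow_two ((u i : ℂ) + v), mul_re]
    simp only [add_re, ofReal_re, add_im, ofReal_im, zero_add]
    nlinarith [sq_nonneg (u i + 2 * v.re), sq_nonneg v.im, sq_nonneg v.re]
  have h4 := S.four_mul_delta_sq_le hε hΔ hθ
  rw [Fin.sum_univ_two, add_re]
  have t0 := hterm 0
  have t1 := hterm 1
  have hu0 := hu' 0
  have hu1 := hu' 1
  simp only [Matrix.cons_val_zero, Matrix.cons_val_one, Matrix.cons_val_fin_one] at hu0 hu1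
  rw [← hu0, ← hu1] at h4
  nlinarith [sq_nonneg (S.delta ε Δ)]

variable (S)

/-- Uniform estimates for the planetary perturbation: `Υ` is holomorphic with bounded differential
on a fixed neighbourhood, and `H_P` is of size `ε / δ` on neighbourhoods of width at most
proportional to `δ`. -/
theorem exists_perturbation_bounds : ∃ a ρ₀ σ₀ C M₀ : ℝ, 0 < a ∧ 0 < ρ₀ ∧ 0 < σ₀ ∧ 1 < C ∧ 0 < M₀ ∧
    ρ₀ ≤ a / 16 ∧
    (∀ ε : ℝ, 0 < ε → ε ≤ 1 → ∀ j, a ≤ S.lam0 ε j) ∧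
    (∀ ε Δ : ℝ, 0 < ε → ε ≤ 1 → 0 < Δ → ∀ z ∈ Phase.domain Δ ρ₀ σ₀,
        AnalyticAt ℂ (S.upsilon ε) z ∧ ‖fderiv ℂ (S.upsilon ε) z‖ ≤ C) ∧
    ∀ ε Δ ρ σ : ℝ, 0 < ε → ε ≤ 1 → 0 < Δ → 0 < ρ → ρ < ρ₀ / 2 → ρ < σ → σ < σ₀ / 2 →
      σ < S.delta ε Δ / (32 * C) → ∀ z ∈ Phase.domain Δ (4 * ρ) (4 * σ),
        AnalyticAt ℂ (S.HP ε) z ∧ ‖S.HP ε z‖ ≤ M₀ * (ε / S.delta ε Δ) ∧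
        S.HP ε (z + ((2 * Real.pi : ℝ) : ℂ) • Phase.basisVec 0 1) = S.HP ε z ∧
        S.HP ε z.conjPoint = starRingEnd ℂ (S.HP ε z) := by
  obtain ⟨a, B, ha, hB, hpar⟩ := S.exists_parameter_bounds
  have hB0 : 0 ≤ B := hB.le
  -- `Υ` is bounded on the domain of size `(a / 4096, 1 / 4)`, hence has bounded derivative on the
  -- domain of half that size, which contains the domains of width `4`
  let Bd := 72 * B ^ 3 + 24 * B / (a / 2)
  have hBd : 0 ≤ Bd := by positivity
  let r := min (a / 8192) (1 / 8)
  have hr : 0 < r := lt_min (by positivity) (by norm_num)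
  let C := max 2 (2 * Bd / r)
  have hC : 1 < C := lt_of_lt_of_le (by norm_num) (le_max_left _ _)
  have hnc : ∀ ε ∈ Icc (0 : ℝ) 1, ∀ Δ, ∀ z ∈ Phase.domain Δ (a / 4096) (1 / 4), ∀ j,
      IsNearCircular (a / 2) (meanLong z j) (S.action ε z j) (z 2 j) (z 3 j) :=
    fun ε hε Δ z hz j => isNearCircular_of_mem_domain ha (fun j => (hpar ε hε j).1) hz j
  have hL : ∀ ε ∈ Icc (0 : ℝ) 1, ∀ Δ, ∀ z ∈ Phase.domain Δ (a / 4096) (1 / 4), ∀ j,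
      ‖S.action ε z j‖ ≤ 2 * B := by
    rintro ε hε Δ z ⟨θ, -, h⟩ j
    have h1 := norm_action_sub_le (S := S) (ε := ε) (fun j => (h j).2.1) j
    have h2 := norm_le_norm_sub_add (S.action ε z j) (S.lam0 ε j : ℂ)
    rw [norm_real, Real.norm_of_nonneg (S.lam0_pos hε.1 j).le] at h2
    have h3 := hpar ε hε j
    linarith [h3.1, h3.2.1]
  have hΥb : ∀ ε ∈ Icc (0 : ℝ) 1, ∀ Δ, ∀ z ∈ Phase.domain Δ (a / 4096) (1 / 4),
      ‖S.upsilon ε z‖ ≤ Bd := by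
    intro ε hε Δ z hz
    have hp0 : 0 ≤ 72 * B ^ 3 := by positivity
    have hm0 : 0 ≤ 24 * B / (a / 2) := by positivity
    rw [upsilon, norm_prod_le_iff]
    constructor
    · refine (pi_norm_le_iff_of_nonneg hBd).2 fun j => (pi_norm_le_iff_of_nonneg hBd).2 fun i => ?_
      exact (norm_momentum_le (hnc ε hε Δ z hz) hε.1 (fun j => (hpar ε hε j).2.2.1) j i).trans
        (by simp only [Bd]; linarith)
    · refine (pi_norm_le_iff_of_nonneg hBd).2 fun j => (pi_norm_le_iff_of_nonneg hBd).2 fun i => ?_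
      exact (norm_position_le (hnc ε hε Δ z hz) hε.1 (fun j => (hpar ε hε j).2.2.2.1)
        (hL ε hε Δ z hz) j i).trans (by simp only [Bd]; linarith)
  have hΥ : ∀ ε ∈ Icc (0 : ℝ) 1, ∀ Δ, ∀ z ∈ Phase.domain Δ (a / 8192) (1 / 8),
      AnalyticAt ℂ (S.upsilon ε) z ∧ ‖fderiv ℂ (S.upsilon ε) z‖ ≤ C := by
    intro ε hε Δ z hz
    have hsub := ball_subset_domain (by positivity) (min_le_left (a / 8192) (1 / 8))
      (min_le_right (a / 8192) (1 / 8)) hz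
    rw [show 2 * (a / 8192) = a / 4096 by ring, show (2 : ℝ) * (1 / 8) = 1 / 4 by norm_num] at hsub
    refine ⟨analyticAt_upsilon (hnc ε hε Δ z (hsub (Metric.mem_ball_self hr))), ?_⟩
    refine (norm_fderiv_le_of_forall_mem_ball hr
      (fun w hw => (analyticAt_upsilon (hnc ε hε Δ w (hsub hw))).differentiableAt)
      (fun w hw => hΥb ε hε Δ w (hsub hw))).trans (le_max_right _ _)
  let P := 24 * B / (a / 2)
  have hP : 0 ≤ P := by positivity
  have hm₀ := S.m₀_pos
  have hm1 := S.m_pos 0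
  have hm2 := S.m_pos 1
  have hG := S.G_pos
  refine ⟨a, a / 16384, 1 / 16, C, 2 * P ^ 2 * B / S.m₀ + S.G * S.m 0 * S.m 1, ha, by positivity,
    by norm_num, hC, by positivity, by linarith,
    fun ε hε0 hε1 j => (hpar ε ⟨hε0.le, hε1⟩ j).1, ?_, ?_⟩
  · intro ε Δ hε0 hε1 hΔ z hz
    exact hΥ ε ⟨hε0.le, hε1⟩ Δ z
      (Phase.domain_mono (by positivity) (by norm_num) (by linarith) (by norm_num) hz)
  · intro ε Δ ρ σ hε0 hε1 hΔ hρ hρ1 hρσ hσ1 hσδ z hz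
    have hε : ε ∈ Icc (0 : ℝ) 1 := ⟨hε0.le, hε1⟩
    have hσ0 : 0 < σ := hρ.trans hρσ
    have hC0 : 0 < C := by linarith
    have hσδ' : σ * (32 * C) < S.delta ε Δ := (lt_div_iff₀ (by positivity)).1 hσδ
    have hδ0 : 0 < S.delta ε Δ := lt_of_le_of_lt (by positivity) hσδ'
    have hsub8 : Phase.domain Δ (4 * ρ) (4 * σ) ⊆ Phase.domain Δ (a / 8192) (1 / 8) :=
      Phase.domain_mono (by positivity) (by positivity) (by linarith) (by linarith)
    have hsub4 : Phase.domain Δ (4 * ρ) (4 * σ) ⊆ Phase.domain Δ (a / 4096) (1 / 4) :=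
      Phase.domain_mono (by positivity) (by positivity) (by linarith) (by linarith)
    have hn := hnc ε hε Δ z (hsub4 hz)
    have hre := delta_sq_le_re hε.1 hΔ (by positivity) (by linarith : 4 * ρ ≤ 4 * σ)
      (fun w hw => hΥ ε hε Δ w (hsub8 hw)) (by linarith) hz
    set D := ∑ i, (S.position ε z 0 i - S.position ε z 1 i) ^ 2 with hD
    have hre0 : 0 < D.re := lt_of_lt_of_le (by positivity) hre
    have hslit : D ∈ slitPlane := mem_slitPlane_iff.2 (Or.inl hre0)
    have hδs : S.delta ε Δ ≤ ‖csqrt D‖ := by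
      refine le_of_sq_le_sq ?_ (norm_nonneg _)
      rw [norm_csqrt_sq]
      exact hre.trans (re_le_norm D)
    refine ⟨?_, ?_, HP_add_two_pi hn, HP_conjPoint hn hslit⟩
    · have hDa : AnalyticAt ℂ
          (fun z => ∑ i, (S.position ε z 0 i - S.position ε z 1 i) ^ 2) z :=
        Finset.analyticAt_fun_sum _ fun i _ =>
          ((analyticAt_position hn 0 i).sub (analyticAt_position hn 1 i)).pow 2
      have hMa : AnalyticAt ℂ (fun z => ∑ i, S.momentum ε z 0 i * S.momentum ε z 1 i) z :=
        Finset.analyticAt_fun_sum _ fun i _ =>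
          (analyticAt_momentum hn 0 i).mul (analyticAt_momentum hn 1 i)
      exact analyticAt_const.mul (hMa.div_const.sub (analyticAt_const.div (hDa.csqrt hslit)
        (csqrt_ne_zero (slitPlane_ne_zero hslit))))
    · have hδB : S.delta ε Δ ≤ B := by
        have h1 : 0 < min (S.radius ε 0) (S.radius ε 1) :=
          lt_min (S.radius_pos hε.1 0) (S.radius_pos hε.1 1)
        have h2 := Real.sin_le_one (Δ / 2)
        have h3 := (min_le_left (S.radius ε 0) (S.radius ε 1)).trans (hpar ε hε 0).2.2.2.2
        rw [delta]
        nlinarith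
      have hmom : ∀ j i, ‖S.momentum ε z j i‖ ≤ P := fun j i =>
        norm_momentum_le hn hε.1 (fun j => (hpar ε hε j).2.2.1) j i
      have hprod : ∀ i, ‖S.momentum ε z 0 i * S.momentum ε z 1 i‖ ≤ P ^ 2 := by
        intro i
        rw [norm_mul, pow_two]
        exact mul_le_mul (hmom 0 i) (hmom 1 i) (norm_nonneg _) hP
      have h1 : ‖(∑ i, S.momentum ε z 0 i * S.momentum ε z 1 i) / S.m₀‖
          ≤ 2 * P ^ 2 * B / S.m₀ / S.delta ε Δ := by
        rw [norm_div, norm_real, Real.norm_of_nonneg hm₀.le, div_right_comm]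
        gcongr
        rw [Fin.sum_univ_two, le_div_iff₀ hδ0]
        refine mul_le_mul ?_ hδB hδ0.le (by positivity)
        refine (norm_add_le _ _).trans ?_
        linarith [hprod 0, hprod 1]
      have h2 : ‖(S.G * S.m 0 * S.m 1 : ℂ) / csqrt D‖ ≤ S.G * S.m 0 * S.m 1 / S.delta ε Δ := by
        have e : (S.G * S.m 0 * S.m 1 : ℂ) = ((S.G * S.m 0 * S.m 1 : ℝ) : ℂ) := by push_cast; rfl
        rw [e, norm_div, norm_real, Real.norm_of_nonneg (by positivity)]
        gcongr
      rw [HP, norm_mul, norm_real, Real.norm_of_nonneg hε0.le]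
      refine (mul_le_mul_of_nonneg_left ((norm_sub_le _ _).trans (add_le_add h1 h2)) hε0.le).trans_eq
        ?_
      field_simp

end PlanetarySystem

/-! ### Averaging over the fast angle -/

namespace Phase

/-- The direction of the fast angle `ζ₂`. -/
abbrev fast : Phase := basisVec 0 1

/-- The average of `g` over a period of the fast angle; `HPbar` is by definition that of `HP`. -/
def fastAverage (g : Phase → ℂ) (z : Phase) : ℂ :=
  ((1 / (2 * Real.pi) : ℝ) : ℂ) *
    ∫ t in (0 : ℝ)..(2 * Real.pi), g (Function.update z 0 (Function.update (z 0) 1 (t : ℂ)))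

/-- The solution of `ω ∂χ/∂ζ₂ = fastAverage g - g` used as generating function; `chi` is by
definition the one obtained from `HP`. -/
def averagingGenerator (ω : ℝ) (g : Phase → ℂ) (z : Phase) : ℂ :=
  ((ω / (2 * Real.pi) : ℝ) : ℂ) *
    ∫ t in (0 : ℝ)..(2 * Real.pi / ω),
      (t : ℂ) * (fastAverage g z - g (z + ((ω * t : ℝ) : ℂ) • basisVec 0 1))

/-- Open sets stable under real translations of the fast angle and under moving the fast angle
along the segment to `0`. On them averages over real fast angles are defined, and the segment
condition allows moving the path of integration to the real axis. -/
structure IsFastStrip (U : Set Phase) : Prop where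
  isOpen : IsOpen U
  translate : ∀ z ∈ U, ∀ t : ℝ, z + (t : ℂ) • fast ∈ U
  retract : ∀ z ∈ U, ∀ τ ∈ Icc (0 : ℝ) 1, z - ((τ : ℂ) * z 0 1) • fast ∈ U

/-- The projection along the fast angle: it sets `ζ₂` to `0`. -/
def killFast : Phase →L[ℂ] Phase :=
  ContinuousLinearMap.id ℂ Phase - (((ContinuousLinearMap.proj 1 : (Fin 2 → ℂ) →L[ℂ] ℂ).comp
    (ContinuousLinearMap.proj 0 : Phase →L[ℂ] (Fin 2 → ℂ))).smulRight fast)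

theorem killFast_apply (z : Phase) : killFast z = z - (z 0 1) • fast := rfl

theorem killFast_fast : killFast fast = 0 := by
  simp [killFast_apply, basisVec]

theorem update_fast (z : Phase) (t : ℂ) :
    Function.update z 0 (Function.update (z 0) 1 t) = killFast z + t • fast := by
  ext k j
  rw [killFast_apply]
  fin_cases k
  · fin_cases j <;> simp [basisVec]
  · simp [basisVec]
  · simp [basisVec]
  · simp [basisVec]

theorem fastAverage_eq (g : Phase → ℂ) (z : Phase) : fastAverage g z =
    ((1 / (2 * Real.pi) : ℝ) : ℂ) *
      ∫ t in (0 : ℝ)..(2 * Real.pi), g (killFast z + (t : ℂ) • fast) := by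
  simp only [fastAverage, update_fast]

theorem fastAverage_add_smul (g : Phase → ℂ) (z : Phase) (c : ℂ) :
    fastAverage g (z + c • fast) = fastAverage g z := by
  simp only [fastAverage_eq, map_add, map_smul, killFast_fast, smul_zero, add_zero]

section

variable {U : Set Phase} {g : Phase → ℂ}

theorem IsFastStrip.killFast_add_mem (hU : IsFastStrip U) {z : Phase} (hz : z ∈ U) (t : ℝ) :
    killFast z + (t : ℂ) • fast ∈ U := by
  have h := hU.retract z hz 1 (by simp)
  rw [ofReal_one, one_mul] at h
  exact hU.translate _ h t

theorem IsFastStrip.hasFDerivAt_fastAverage (hU : IsFastStrip U) (hg : AnalyticOnNhd ℂ g U)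
    {z : Phase} (hz : z ∈ U) : HasFDerivAt (fastAverage g)
      (((1 / (2 * Real.pi) : ℝ) : ℂ) • ∫ t in (0 : ℝ)..(2 * Real.pi),
        (1 : ℂ) • (fderiv ℂ g (killFast z + (t : ℂ) • fast)).comp killFast) z := by
  have h := (hasFDerivAt_integral_comp_translate hU.isOpen hg killFast fast (c := fun _ => 1)
    continuous_const Real.two_pi_pos.le (z₀ := z)
    fun t _ => hU.killFast_add_mem hz t).const_mul ((1 / (2 * Real.pi) : ℝ) : ℂ)
  simp only [one_mul, ← fastAverage_eq] at h
  exact h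

theorem IsFastStrip.analyticOnNhd_fastAverage (hU : IsFastStrip U) (hg : AnalyticOnNhd ℂ g U) :
    AnalyticOnNhd ℂ (fastAverage g) U :=
  DifferentiableOn.analyticOnNhd_of_finiteDimensional
    (fun _ hz => (hU.hasFDerivAt_fastAverage hg hz).differentiableAt.differentiableWithinAt) hU.isOpen

theorem IsFastStrip.norm_fastAverage_le (hU : IsFastStrip U) {N : ℝ} (hN : ∀ z ∈ U, ‖g z‖ ≤ N)
    {z : Phase} (hz : z ∈ U) : ‖fastAverage g z‖ ≤ N := by
  have h := intervalIntegral.norm_integral_le_of_norm_le_const (a := 0) (b := 2 * Real.pi)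
    (f := fun t : ℝ => g (killFast z + (t : ℂ) • fast)) (C := N)
    fun t _ => hN _ (hU.killFast_add_mem hz t)
  have hp := Real.two_pi_pos
  rw [sub_zero, abs_of_pos hp] at h
  rw [fastAverage_eq, norm_mul, norm_real, Real.norm_of_nonneg (by positivity), one_div,
    inv_mul_le_iff₀ hp]
  exact h.trans_eq (mul_comm _ _)

theorem IsFastStrip.continuous_comp_translate {F : Type*} [TopologicalSpace F] {f : Phase → F}
    (hU : IsFastStrip U) (hf : ContinuousOn f U) {z : Phase} (hz : z ∈ U) :
    Continuous fun t : ℝ => f (z + (t : ℂ) • fast) :=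
  hf.comp_continuous (by fun_prop) fun t => hU.translate z hz t

theorem IsFastStrip.hasDerivAt_comp_translate (hU : IsFastStrip U) (hg : AnalyticOnNhd ℂ g U)
    {z : Phase} (hz : z ∈ U) (t : ℝ) : HasDerivAt (fun t : ℝ => g (z + (t : ℂ) • fast))
      (fderiv ℂ g (z + (t : ℂ) • fast) fast) t := by
  have h1 : HasDerivAt (fun t : ℝ => z + (t : ℂ) • fast) fast t := by
    have := ((ofRealCLM.hasDerivAt (x := t)).smul_const fast).const_add z
    simpa using this
  have h2 := (hg _ (hU.translate z hz t)).differentiableAt.hasFDerivAt.restrictScalars ℝ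
  exact h2.comp_hasDerivAt t h1

theorem IsFastStrip.integral_fderiv (hU : IsFastStrip U) (hg : AnalyticOnNhd ℂ g U)
    (hper : ∀ z ∈ U, g (z + ((2 * Real.pi : ℝ) : ℂ) • fast) = g z) {z : Phase} (hz : z ∈ U) :
    ∫ t in (0 : ℝ)..(2 * Real.pi), fderiv ℂ g (z + (t : ℂ) • fast) fast = 0 := by
  rw [intervalIntegral.integral_eq_sub_of_hasDerivAt
    (fun t _ => hU.hasDerivAt_comp_translate hg hz t)
    ((hU.continuous_comp_translate (f := fun z => fderiv ℂ g z fast)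
      (hg.fderiv.continuousOn.clm_apply continuousOn_const) hz).intervalIntegrable _ _)]
  simp only [ofReal_zero, zero_smul, add_zero]
  rw [hper z hz, sub_self]

/-- The average over a real period starting at a complex fast angle does not depend on that angle:
its derivative vanishes by periodicity. -/
theorem IsFastStrip.integral_translate_eq (hU : IsFastStrip U) (hg : AnalyticOnNhd ℂ g U)
    (hper : ∀ z ∈ U, g (z + ((2 * Real.pi : ℝ) : ℂ) • fast) = g z) {z : Phase} (hz : z ∈ U) :
    ∫ t in (0 : ℝ)..(2 * Real.pi), g (z + (t : ℂ) • fast) = 2 * Real.pi * fastAverage g z := by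
  let J : Phase → ℂ := fun z => ∫ t in (0 : ℝ)..(2 * Real.pi), g (z + (t : ℂ) • fast)
  have hJ : ∀ τ ∈ Icc (0 : ℝ) 1,
      HasDerivWithinAt (fun τ : ℝ => J (z - ((τ : ℂ) * z 0 1) • fast)) 0 (Icc 0 1) τ := by
    intro τ hτ
    set w := z - ((τ : ℂ) * z 0 1) • fast with hw
    have hwU : w ∈ U := hU.retract z hz τ hτ
    have h1 := hasFDerivAt_integral_comp_translate hU.isOpen hg (ContinuousLinearMap.id ℂ Phase)
      fast (c := fun _ => 1) continuous_const Real.two_pi_pos.le (z₀ := w)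
      fun t _ => hU.translate w hwU t
    simp only [one_mul, one_smul, ContinuousLinearMap.id_apply, ContinuousLinearMap.comp_id] at h1
    have h2 : HasDerivAt (fun τ : ℝ => z - ((τ : ℂ) * z 0 1) • fast) (-(z 0 1 • fast)) τ := by
      have := ((((ofRealCLM.hasDerivAt (x := τ)).mul_const (z 0 1)).smul_const fast).const_sub z)
      simpa using this
    have h3 := (h1.restrictScalars ℝ).comp_hasDerivAt τ h2
    refine (h3.congr_deriv ?_).hasDerivWithinAt
    rw [ContinuousLinearMap.coe_restrictScalars', map_neg, map_smul,
      ContinuousLinearMap.intervalIntegral_apply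
        ((hU.continuous_comp_translate hg.fderiv.continuousOn hwU).intervalIntegrable _ _),
      hU.integral_fderiv hg hper hwU, smul_zero, neg_zero]
  have hc := (convex_Icc (0 : ℝ) 1).norm_image_sub_le_of_norm_hasDerivWithin_le (C := 0) hJ
    (fun τ _ => by simp) (left_mem_Icc.2 zero_le_one) (right_mem_Icc.2 zero_le_one)
  rw [zero_mul, norm_le_zero_iff, sub_eq_zero] at hc
  simp only [ofReal_zero, zero_mul, zero_smul, sub_zero, ofReal_one, one_mul] at hc
  have hπ : (Real.pi : ℂ) ≠ 0 := ofReal_ne_zero.2 Real.pi_ne_zero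
  rw [fastAverage_eq]
  change J z = _ * (_ * J (killFast z))
  rw [killFast_apply, hc]
  push_cast
  field_simp

theorem IsFastStrip.averagingGenerator_eq (hU : IsFastStrip U) (hg : ContinuousOn g U) (ω : ℝ)
    {z : Phase} (hz : z ∈ U) : averagingGenerator ω g z =
      ((ω / (2 * Real.pi) : ℝ) : ℂ) *
        ((∫ t in (0 : ℝ)..(2 * Real.pi / ω), (t : ℂ)) * fastAverage g z
          - ∫ t in (0 : ℝ)..(2 * Real.pi / ω), (t : ℂ) * g (z + (t : ℂ) • ((ω : ℂ) • fast))) := by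
  have hc : Continuous fun t : ℝ => g (z + (t : ℂ) • ((ω : ℂ) • fast)) := by
    have := (hU.continuous_comp_translate hg hz).comp (continuous_const_mul ω)
    refine this.congr fun t => ?_
    simp only [Function.comp, smul_smul]
    push_cast
    rw [mul_comm]
  have hi : Continuous fun t : ℝ => (t : ℂ) := continuous_ofReal
  have h1 : IntervalIntegrable (fun t : ℝ => (t : ℂ) * fastAverage g z) MeasureTheory.volume 0
      (2 * Real.pi / ω) := (hi.mul continuous_const).intervalIntegrable _ _
  have h2 : IntervalIntegrable (fun t : ℝ => (t : ℂ) * g (z + (t : ℂ) • ((ω : ℂ) • fast)))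
      MeasureTheory.volume 0 (2 * Real.pi / ω) := (hi.mul hc).intervalIntegrable _ _
  rw [averagingGenerator, ← intervalIntegral.integral_mul_const,
    ← intervalIntegral.integral_sub h1 h2]
  congr 1
  refine intervalIntegral.integral_congr fun t _ => ?_
  simp only [smul_smul, mul_sub]
  push_cast
  rw [mul_comm (ω : ℂ)]

theorem IsFastStrip.translate_mul (hU : IsFastStrip U) {z : Phase} (hz : z ∈ U) (ω t : ℝ) :
    z + (t : ℂ) • ((ω : ℂ) • fast) ∈ U := by
  have := hU.translate z hz (t * ω)
  rwa [ofReal_mul, ← smul_smul] at this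

theorem IsFastStrip.hasFDerivAt_averagingGenerator (hU : IsFastStrip U)
    (hg : AnalyticOnNhd ℂ g U) {ω : ℝ} (hω : 0 < ω) {z : Phase} (hz : z ∈ U) :
    HasFDerivAt (averagingGenerator ω g)
      (((ω / (2 * Real.pi) : ℝ) : ℂ) •
        ((∫ t in (0 : ℝ)..(2 * Real.pi / ω), (t : ℂ)) • fderiv ℂ (fastAverage g) z
          - ∫ t in (0 : ℝ)..(2 * Real.pi / ω), (t : ℂ) •
            (fderiv ℂ g (z + (t : ℂ) • ((ω : ℂ) • fast))).comp
              (ContinuousLinearMap.id ℂ Phase))) z := by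
  have h1 := hasFDerivAt_integral_comp_translate hU.isOpen hg (ContinuousLinearMap.id ℂ Phase)
    ((ω : ℂ) • fast) (c := fun t => (t : ℂ)) continuous_ofReal
    (div_nonneg Real.two_pi_pos.le hω.le) (z₀ := z) fun t _ => hU.translate_mul hz ω t
  have h2 := (hU.analyticOnNhd_fastAverage hg z hz).differentiableAt.hasFDerivAt
  have h3 := ((h2.const_mul (∫ t in (0 : ℝ)..(2 * Real.pi / ω), (t : ℂ))).sub h1).const_mul
    ((ω / (2 * Real.pi) : ℝ) : ℂ)
  refine h3.congr_of_eventuallyEq ?_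
  filter_upwards [hU.isOpen.mem_nhds hz] with w hw
  exact hU.averagingGenerator_eq hg.continuousOn ω hw

theorem IsFastStrip.analyticOnNhd_averagingGenerator (hU : IsFastStrip U)
    (hg : AnalyticOnNhd ℂ g U) {ω : ℝ} (hω : 0 < ω) : AnalyticOnNhd ℂ (averagingGenerator ω g) U :=
  DifferentiableOn.analyticOnNhd_of_finiteDimensional (fun _ hz =>
    (hU.hasFDerivAt_averagingGenerator hg hω hz).differentiableAt.differentiableWithinAt) hU.isOpen

/-- The homological equation, by integration by parts. -/
theorem IsFastStrip.partialDeriv_averagingGenerator (hU : IsFastStrip U)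
    (hg : AnalyticOnNhd ℂ g U)
    (hper : ∀ z ∈ U, g (z + ((2 * Real.pi : ℝ) : ℂ) • fast) = g z) {ω : ℝ} (hω : 0 < ω)
    {z : Phase} (hz : z ∈ U) :
    ω * partialDeriv 0 1 (averagingGenerator ω g) z = fastAverage g z - g z := by
  have hω' : (ω : ℂ) ≠ 0 := ofReal_ne_zero.2 hω.ne'
  have hπ : (Real.pi : ℂ) ≠ 0 := ofReal_ne_zero.2 Real.pi_ne_zero
  have hreparam : ∀ t : ℝ, z + (t : ℂ) • ((ω : ℂ) • fast) = z + ((ω * t : ℝ) : ℂ) • fast := by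
    intro t
    rw [smul_smul, ofReal_mul, mul_comm]
  have hcd : Continuous fun t : ℝ => fderiv ℂ g (z + ((ω * t : ℝ) : ℂ) • fast) :=
    (hU.continuous_comp_translate hg.fderiv.continuousOn hz).comp (continuous_const_mul ω)
  -- the average is constant in the fast direction
  have havg : fderiv ℂ (fastAverage g) z fast = 0 := by
    rw [(hU.hasFDerivAt_fastAverage hg hz).fderiv, smul_apply,
      ContinuousLinearMap.intervalIntegral_apply]
    · simp [killFast_fast]
    · have hk : Continuous fun t : ℝ => fderiv ℂ g (killFast z + (t : ℂ) • fast) :=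
        hg.fderiv.continuousOn.comp_continuous (by fun_prop) fun t => hU.killFast_add_mem hz t
      have hk' : Continuous fun t : ℝ =>
          (1 : ℂ) • (fderiv ℂ g (killFast z + (t : ℂ) • fast)).comp killFast :=
        (hk.clm_comp continuous_const).const_smul (1 : ℂ)
      exact hk'.intervalIntegrable _ _
  have hparts : ∫ t in (0 : ℝ)..(2 * Real.pi / ω),
      (t : ℂ) * ((ω : ℂ) * fderiv ℂ g (z + ((ω * t : ℝ) : ℂ) • fast) fast)
      = 2 * Real.pi / ω * g z - 2 * Real.pi / ω * fastAverage g z := by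
    have hv : ∀ t : ℝ, HasDerivAt (fun t : ℝ => g (z + ((ω * t : ℝ) : ℂ) • fast))
        ((ω : ℂ) * fderiv ℂ g (z + ((ω * t : ℝ) : ℂ) • fast) fast) t := by
      intro t
      have h1 := hU.hasDerivAt_comp_translate hg hz (ω * t)
      have h2 : HasDerivAt (fun t : ℝ => ω * t) ω t := by
        simpa using (hasDerivAt_id t).const_mul ω
      have h3 := h1.scomp t h2
      rw [real_smul] at h3
      exact h3
    have hu : ∀ t : ℝ, HasDerivAt (fun t : ℝ => (t : ℂ)) 1 t := fun t =>
      (hasDerivAt_id t).ofReal_comp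
    rw [intervalIntegral.integral_mul_deriv_eq_deriv_mul (u := fun t : ℝ => (t : ℂ))
      (u' := fun _ => 1) (fun t _ => hu t)
      (fun t _ => hv t) (by simp)
      ((continuous_const.mul (hcd.clm_apply continuous_const)).intervalIntegrable _ _)]
    simp only [one_mul, ofReal_zero, zero_mul, sub_zero]
    rw [intervalIntegral.integral_comp_mul_left (fun s : ℝ => g (z + (s : ℂ) • fast)) hω.ne',
      mul_zero, mul_div_cancel₀ _ hω.ne', hU.integral_translate_eq hg hper hz, hper z hz, real_smul]
    push_cast
    field_simp
  rw [partialDeriv, (hU.hasFDerivAt_averagingGenerator hg hω hz).fderiv]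
  simp only [smul_apply, sub_apply, hreparam,
    ContinuousLinearMap.comp_id]
  have hint : IntervalIntegrable (fun t : ℝ => (t : ℂ) • fderiv ℂ g (z + ((ω * t : ℝ) : ℂ) • fast))
      MeasureTheory.volume 0 (2 * Real.pi / ω) :=
    (continuous_ofReal.smul hcd).intervalIntegrable _ _
  rw [ContinuousLinearMap.intervalIntegral_apply hint, havg]
  have hpull : ∫ t in (0 : ℝ)..(2 * Real.pi / ω),
      (t : ℂ) * ((ω : ℂ) * fderiv ℂ g (z + ((ω * t : ℝ) : ℂ) • fast) fast)
      = ω * ∫ t in (0 : ℝ)..(2 * Real.pi / ω),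
        ((t : ℂ) • fderiv ℂ g (z + ((ω * t : ℝ) : ℂ) • fast)) fast := by
    rw [← intervalIntegral.integral_const_mul]
    refine intervalIntegral.integral_congr fun t _ => ?_
    simp only [smul_apply, smul_eq_mul]
    ring
  rw [hpull] at hparts
  generalize (∫ t in (0 : ℝ)..(2 * Real.pi / ω),
    ((t : ℂ) • fderiv ℂ g (z + ((ω * t : ℝ) : ℂ) • fast)) fast) = J at hparts ⊢
  simp only [smul_eq_mul, mul_zero, zero_sub]
  push_cast
  linear_combination (norm := (field_simp; ring)) (-(ω : ℂ) / (2 * Real.pi)) * hparts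

theorem IsFastStrip.norm_averagingGenerator_le (hU : IsFastStrip U) {N : ℝ}
    (hN : ∀ z ∈ U, ‖g z‖ ≤ N) {ω : ℝ} (hω : 0 < ω) {z : Phase} (hz : z ∈ U) :
    ‖averagingGenerator ω g z‖ ≤ 4 * Real.pi * N / ω := by
  have hp := Real.two_pi_pos
  have hT : 0 < 2 * Real.pi / ω := div_pos hp hω
  have h := intervalIntegral.norm_integral_le_of_norm_le_const (a := 0) (b := 2 * Real.pi / ω)
    (f := fun t : ℝ => (t : ℂ) * (fastAverage g z - g (z + ((ω * t : ℝ) : ℂ) • basisVec 0 1)))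
    (C := 2 * Real.pi / ω * (2 * N)) fun t ht => by
      rw [uIoc_of_le hT.le] at ht
      rw [norm_mul, norm_real, Real.norm_of_nonneg ht.1.le]
      refine mul_le_mul ht.2 ?_ (norm_nonneg _) hT.le
      refine (norm_sub_le _ _).trans ?_
      linarith [hU.norm_fastAverage_le hN hz, hN _ (hU.translate z hz (ω * t))]
  rw [sub_zero, abs_of_pos hT] at h
  rw [averagingGenerator, norm_mul, norm_real, Real.norm_of_nonneg (by positivity)]
  refine (mul_le_mul_of_nonneg_left h (by positivity)).trans_eq ?_
  field_simp
  ring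

theorem IsFastStrip.averagingGenerator_add_two_pi (hU : IsFastStrip U)
    (hper : ∀ z ∈ U, g (z + ((2 * Real.pi : ℝ) : ℂ) • fast) = g z) (ω : ℝ) {z : Phase}
    (hz : z ∈ U) :
    averagingGenerator ω g (z + ((2 * Real.pi : ℝ) : ℂ) • fast) = averagingGenerator ω g z := by
  rw [averagingGenerator, averagingGenerator, fastAverage_add_smul]
  congr 1
  refine intervalIntegral.integral_congr fun t _ => ?_
  rw [add_right_comm, hper _ (hU.translate z hz (ω * t))]

end

/-! ### The real structure -/

/-- The involution `conjPoint` as a real-linear map. -/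
def conjPointL : Phase →L[ℝ] Phase := LinearMap.toContinuousLinearMap
  { toFun := conjPoint
    map_add' := fun z w => by
      ext k j; fin_cases k <;> simp [conjPoint] <;> ring
    map_smul' := fun a z => by
      ext k j; fin_cases k <;> simp [conjPoint] <;> ring }

theorem conjPointL_apply (z : Phase) : conjPointL z = conjPoint z := rfl

theorem conjPoint_add (z w : Phase) : conjPoint (z + w) = conjPoint z + conjPoint w :=
  map_add conjPointL z w

theorem conjPoint_ofReal_smul (t : ℝ) (z : Phase) :
    conjPoint ((t : ℂ) • z) = (t : ℂ) • conjPoint z := by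
  ext k j
  fin_cases k <;> simp [conjPoint] <;> ring

theorem isReal_iff_conjPoint_eq (z : Phase) : z.IsReal ↔ conjPoint z = z := by
  constructor
  · intro h
    ext k j
    obtain ⟨h1, h2, h3⟩ := h j
    fin_cases k
    · exact conj_eq_iff_im.2 h1
    · exact conj_eq_iff_im.2 h2
    · simp [conjPoint, h3, ← mul_assoc]
    · simp [conjPoint, h3]
  · intro h j
    refine ⟨conj_eq_iff_im.1 (congrFun (congrFun h 0) j), conj_eq_iff_im.1 (congrFun (congrFun h 1) j),
      (congrFun (congrFun h 3) j).symm⟩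

theorem conjPoint_fast : conjPoint fast = fast := by
  ext k j
  fin_cases k
  · fin_cases j <;> simp [conjPoint, basisVec]
  · simp [conjPoint, basisVec]
  · simp [conjPoint, basisVec]
  · simp [conjPoint, basisVec]

open scoped ComplexConjugate

theorem fastAverage_conjPoint {U : Set Phase} {g : Phase → ℂ} (hU : IsFastStrip U)
    (hconj : ∀ z ∈ U, g (conjPoint z) = conj (g z)) {z : Phase} (hz : z ∈ U) :
    fastAverage g (conjPoint z) = conj (fastAverage g z) := by
  have h : ∀ t : ℝ, killFast (conjPoint z) + (t : ℂ) • fast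
      = conjPoint (killFast z + (t : ℂ) • fast) := by
    intro t
    rw [conjPoint_add, conjPoint_ofReal_smul, conjPoint_fast]
    congr 1
    ext k j
    rw [killFast_apply, killFast_apply]
    fin_cases k
    · fin_cases j <;> simp [conjPoint, basisVec]
    · simp [conjPoint, basisVec]
    · simp [conjPoint, basisVec]
    · simp [conjPoint, basisVec]
  rw [fastAverage_eq, fastAverage_eq, map_mul, conj_ofReal, ← intervalIntegral.intervalIntegral_conj]
  congr 1
  refine intervalIntegral.integral_congr fun t _ => ?_
  rw [h, hconj _ (hU.killFast_add_mem hz t)]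

theorem averagingGenerator_conjPoint {U : Set Phase} {g : Phase → ℂ} (hU : IsFastStrip U)
    (hconj : ∀ z ∈ U, g (conjPoint z) = conj (g z)) (ω : ℝ) {z : Phase} (hz : z ∈ U) :
    averagingGenerator ω g (conjPoint z) = conj (averagingGenerator ω g z) := by
  rw [averagingGenerator, averagingGenerator, map_mul, conj_ofReal,
    ← intervalIntegral.intervalIntegral_conj]
  congr 1
  refine intervalIntegral.integral_congr fun t _ => ?_
  simp only [map_mul, map_sub, conj_ofReal]
  rw [fastAverage_conjPoint hU hconj hz, ← hconj _ (hU.translate z hz (ω * t)), conjPoint_add,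
    conjPoint_ofReal_smul, conjPoint_fast]

theorem fderiv_conjPoint {U : Set Phase} (hU : IsOpen U) (hUc : ∀ z ∈ U, conjPoint z ∈ U)
    {f : Phase → ℂ} (hf : AnalyticOnNhd ℂ f U) (hconj : ∀ z ∈ U, f (conjPoint z) = conj (f z))
    {z : Phase} (hz : z ∈ U) (v : Phase) :
    fderiv ℂ f (conjPoint z) (conjPoint v) = conj (fderiv ℂ f z v) := by
  have hline : ∀ w u : Phase, HasDerivAt (fun t : ℝ => w + (t : ℂ) • u) u 0 := by
    intro w u
    have := ((ofRealCLM.hasDerivAt (x := (0 : ℝ))).smul_const u).const_add w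
    simpa using this
  have hd : ∀ w ∈ U, ∀ u, HasDerivAt (fun t : ℝ => f (w + (t : ℂ) • u)) (fderiv ℂ f w u) 0 := by
    intro w hw u
    have h1 := (hf w hw).differentiableAt.hasFDerivAt.restrictScalars ℝ
    have h2 : w + ((0 : ℝ) : ℂ) • u = w := by simp
    rw [← h2] at h1
    have h3 := h1.comp_hasDerivAt 0 (hline w u)
    rw [h2] at h3
    exact h3
  have h1 := hd _ (hUc z hz) (conjPoint v)
  have h2 := (conjCLE.toContinuousLinearMap.hasFDerivAt).comp_hasDerivAt (0 : ℝ) (hd z hz v)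
  refine h1.unique (h2.congr_of_eventuallyEq ?_)
  have hmem : ∀ᶠ t : ℝ in nhds 0, z + (t : ℂ) • v ∈ U := by
    refine (hline z v).continuousAt.eventually_mem (hU.mem_nhds ?_)
    simpa using hz
  filter_upwards [hmem] with t ht
  rw [← conjPoint_ofReal_smul, ← conjPoint_add, hconj _ ht]
  rfl

theorem conjPoint_basisVec (j : Fin 2) : conjPoint (basisVec 0 j) = basisVec 0 j ∧
    conjPoint (basisVec 1 j) = basisVec 1 j ∧ conjPoint (basisVec 2 j) = -I • basisVec 3 j ∧
    conjPoint (basisVec 3 j) = -I • basisVec 2 j := by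
  refine ⟨?_, ?_, ?_, ?_⟩ <;>
  · ext k i
    fin_cases k <;> simp [conjPoint, basisVec, Pi.single_apply]

theorem hamField_conjPoint {U : Set Phase} (hU : IsOpen U) (hUc : ∀ z ∈ U, conjPoint z ∈ U)
    {f : Phase → ℂ} (hf : AnalyticOnNhd ℂ f U) (hconj : ∀ z ∈ U, f (conjPoint z) = conj (f z))
    (s : ℝ) {z : Phase} (hz : z ∈ U) :
    hamField s f (conjPoint z) = conjPoint (hamField s f z) := by
  have h := fun v => fderiv_conjPoint hU hUc hf hconj hz v
  have h0 : ∀ j, partialDeriv 0 j f (conjPoint z) = conj (partialDeriv 0 j f z) := fun j => by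
    rw [partialDeriv, partialDeriv, ← h, (conjPoint_basisVec j).1]
  have h1 : ∀ j, partialDeriv 1 j f (conjPoint z) = conj (partialDeriv 1 j f z) := fun j => by
    rw [partialDeriv, partialDeriv, ← h, (conjPoint_basisVec j).2.1]
  have h3 : ∀ j, partialDeriv 3 j f (conjPoint z) = I * conj (partialDeriv 2 j f z) := fun j => by
    rw [partialDeriv, partialDeriv, ← h, (conjPoint_basisVec j).2.2.1, map_smul, smul_eq_mul,
      ← mul_assoc]
    simp
  have h2 : ∀ j, partialDeriv 2 j f (conjPoint z) = I * conj (partialDeriv 3 j f z) := fun j => by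
    rw [partialDeriv, partialDeriv, ← h, (conjPoint_basisVec j).2.2.2, map_smul, smul_eq_mul,
      ← mul_assoc]
    simp
  have e : hamField s f (conjPoint z) = ![fun j => -conj (partialDeriv 1 j f z),
      fun j => conj (partialDeriv 0 j f z), fun j => -(s * (I * conj (partialDeriv 2 j f z))),
      fun j => s * (I * conj (partialDeriv 3 j f z))] := by
    simp only [hamField, h0, h1, h2, h3]
  rw [e]
  ext k j
  fin_cases k
  · simp [hamField, conjPoint]
  · simp [hamField, conjPoint]
  · simp [hamField, conjPoint]; ring
  · simp [hamField, conjPoint]; ring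

end Phase

/-! ### Hamiltonian flows -/

open Metric

section Equivariance

variable {E : Type*} [NormedAddCommGroup E] [NormedSpace ℂ E] {X : E → E}
  {R : Set E} {κ : ℝ}

/-- A real-affine symmetry of a vector field is a symmetry of its flow, by uniqueness of the
integral curves. -/
theorem flow_comp_affine (hX : AnalyticOnNhd ℂ X (thickening 3 R))
    (hκ : ∀ z ∈ thickening 3 R, ‖X z‖ ≤ κ) (hκ1 : κ ≤ 1 / 100) {Φ : ℝ → E → E}
    (hΦ : ∀ z ∈ thickening (7 / 4) R, Φ 0 z = z ∧ ∀ t ∈ Icc (0 : ℝ) 1,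
      ‖Φ t z - z‖ ≤ κ ∧ HasDerivWithinAt (fun t => Φ t z) (X (Φ t z)) (Icc 0 1) t)
    (L : E →L[ℝ] E) (b : E) (hT : ∀ p, ∀ z ∈ thickening p R, L z + b ∈ thickening p R)
    (hXT : ∀ z ∈ thickening 3 R, X (L z + b) = L (X z)) {z : E} (hz : z ∈ thickening (7 / 4) R) :
    Φ 1 (L z + b) = L (Φ 1 z) + b := by
  have hmem : ∀ z ∈ thickening (7 / 4) R, ∀ t ∈ Icc (0 : ℝ) 1, Φ t z ∈ thickening 3 R :=
    fun z hz t ht => ball_subset_thickening_add (q := 1) hz (by norm_num)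
      (mem_ball_iff_norm.2 ((((hΦ z hz).2 t ht).1.trans hκ1).trans_lt (by norm_num)))
  have hTz := hT _ z hz
  refine eqOn_of_hasDerivWithinAt_vectorField hX hκ hκ1 (γ₁ := fun t => Φ t (L z + b))
    (γ₂ := fun t => L (Φ t z) + b) ?_ ?_ (fun t ht => ((hΦ _ hTz).2 t ht).2) (fun t ht => ?_)
    (hmem _ hTz) (fun t ht => hT 3 _ (hmem z hz t ht)) (right_mem_Icc.2 zero_le_one)
  · simp only [(hΦ z hz).1, (hΦ _ hTz).1]
  · simpa only [(hΦ _ hTz).1] using hTz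
  · rw [hXT _ (hmem z hz t ht)]
    exact (L.hasFDerivAt.comp_hasDerivWithinAt t ((hΦ z hz).2 t ht).2).add_const b

end Equivariance

namespace Phase

theorem norm_basisVec (k : Fin 4) (j : Fin 2) : ‖basisVec k j‖ = 1 := by
  rw [basisVec, Pi.norm_single, Pi.norm_single, norm_one]

theorem eq_sum_basisVec (v : Phase) : v = ∑ j, (v 0 j • basisVec 0 j + v 1 j • basisVec 1 j
    + v 2 j • basisVec 2 j + v 3 j • basisVec 3 j) := by
  ext k j
  fin_cases k <;> fin_cases j <;> simp [basisVec, Fin.sum_univ_two]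

/-- The identification of covectors with vectors given by the symplectic form, for which
`hamField s f z` is the image of the differential of `f`. -/
def sharp (s : ℝ) : (Phase →L[ℂ] ℂ) →L[ℂ] Phase := LinearMap.toContinuousLinearMap
  { toFun := fun φ => ![fun j => -φ (basisVec 1 j), fun j => φ (basisVec 0 j),
      fun j => -(s * φ (basisVec 3 j)), fun j => s * φ (basisVec 2 j)]
    map_add' := fun φ ψ => by
      ext k j; fin_cases k <;> simp <;> ring
    map_smul' := fun a φ => by
      ext k j; fin_cases k <;> simp <;> ring }

theorem hamField_eq_sharp (s : ℝ) (f : Phase → ℂ) (z : Phase) :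
    hamField s f z = sharp s (fderiv ℂ f z) := rfl

theorem sympl_sharp {s : ℝ} (hs : s * s = 1) (φ : Phase →L[ℂ] ℂ) (v : Phase) :
    sympl s (sharp s φ) v = -φ v := by
  have hs' : (s : ℂ) * s = 1 := by exact_mod_cast hs
  conv_rhs => rw [eq_sum_basisVec v]
  simp only [sympl, map_sum, map_add, map_smul, smul_eq_mul, ← Finset.sum_neg_distrib]
  refine Finset.sum_congr rfl fun j _ => ?_
  have e : sharp s φ = ![fun j => -φ (basisVec 1 j), fun j => φ (basisVec 0 j),
      fun j => -(s * φ (basisVec 3 j)), fun j => s * φ (basisVec 2 j)] := rfl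
  rw [e]
  simp only [Matrix.cons_val_zero, Matrix.cons_val_one, Matrix.cons_val]
  linear_combination (-φ (basisVec 3 j) * v 3 j - φ (basisVec 2 j) * v 2 j) * hs'

theorem sympl_swap (s : ℝ) (v w : Phase) : sympl s v w = -sympl s w v := by
  rw [sympl, sympl, ← Finset.sum_neg_distrib]
  exact Finset.sum_congr rfl fun j _ => by ring

theorem norm_sharp_le {s : ℝ} (hs : |s| = 1) (φ : Phase →L[ℂ] ℂ) : ‖sharp s φ‖ ≤ ‖φ‖ := by
  have h : ∀ k j, ‖φ (basisVec k j)‖ ≤ ‖φ‖ := fun k j =>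
    (φ.le_opNorm _).trans_eq (by rw [norm_basisVec, mul_one])
  have hs' : ‖(s : ℂ)‖ = 1 := by rw [norm_real, Real.norm_eq_abs, hs]
  refine (norm_le_iff (norm_nonneg _)).2 fun j => ⟨?_, h 0 j, ?_, ?_⟩
  · exact (norm_neg _).trans_le (h 1 j)
  · refine (norm_neg _).trans_le ?_
    rw [norm_mul, hs', one_mul]
    exact h 3 j
  · refine (norm_mul _ _).trans_le ?_
    rw [hs', one_mul]
    exact h 2 j

theorem hasDerivWithinAt_sympl {s : ℝ} {α β : ℝ → Phase} {α' β' : Phase} {t : ℝ} {I : Set ℝ}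
    (hα : HasDerivWithinAt α α' I t) (hβ : HasDerivWithinAt β β' I t) :
    HasDerivWithinAt (fun t => sympl s (α t) (β t)) (sympl s α' (β t) + sympl s (α t) β') I t := by
  have ha : ∀ k j, HasDerivWithinAt (fun t => α t k j) (α' k j) I t := fun k j =>
    hasDerivWithinAt_pi.1 (hasDerivWithinAt_pi.1 hα k) j
  have hb : ∀ k j, HasDerivWithinAt (fun t => β t k j) (β' k j) I t := fun k j =>
    hasDerivWithinAt_pi.1 (hasDerivWithinAt_pi.1 hβ k) j
  have h := HasDerivWithinAt.fun_sum (u := Finset.univ) fun (j : Fin 2) _ =>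
    (((ha 0 j).mul (hb 1 j)).sub ((ha 1 j).mul (hb 0 j))).add
      ((((ha 2 j).mul (hb 3 j)).sub ((ha 3 j).mul (hb 2 j))).const_mul (s : ℂ))
  refine h.congr_deriv ?_
  rw [sympl, sympl, ← Finset.sum_add_distrib]
  exact Finset.sum_congr rfl fun j _ => by ring

section

variable {R : Set Phase} {f : Phase → ℂ} {s κ : ℝ}

theorem analyticOnNhd_hamField {U : Set Phase} (hf : AnalyticOnNhd ℂ f U) (s : ℝ) :
    AnalyticOnNhd ℂ (hamField s f) U :=
  (sharp s).comp_analyticOnNhd hf.fderiv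

/-- The linearisation of a Hamiltonian vector field is infinitesimally symplectic, by symmetry of
the second derivative of the Hamiltonian. -/
theorem sympl_fderiv_hamField (hs : s * s = 1) {z : Phase} (hf : AnalyticAt ℂ f z) (v w : Phase) :
    sympl s (fderiv ℂ (hamField s f) z v) w + sympl s v (fderiv ℂ (hamField s f) z w) = 0 := by
  have h1 : HasFDerivAt (hamField s f) ((sharp s).comp (fderiv ℂ (fderiv ℂ f) z)) z :=
    (sharp s).hasFDerivAt.comp z hf.fderiv.differentiableAt.hasFDerivAt
  have h2 : IsSymmSndFDerivAt ℂ f z :=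
    (hf.contDiffAt (n := ⊤)).isSymmSndFDerivAt (by simp)
  rw [h1.fderiv, sympl_swap s v]
  simp only [ContinuousLinearMap.comp_apply, sympl_sharp hs]
  rw [h2 v w]
  ring

/-- The time-one map of a small Hamiltonian is holomorphic and canonical. -/
theorem exists_hamiltonian_flow (hs : |s| = 1) (hf : AnalyticOnNhd ℂ f (thickening 4 R))
    (hB : ∀ z ∈ thickening 4 R, ‖f z‖ ≤ κ / 2) (hκ1 : κ ≤ 1 / 100) :
    AnalyticOnNhd ℂ (hamField s f) (thickening 3 R) ∧
    (∀ z ∈ thickening 3 R, ‖hamField s f z‖ ≤ κ) ∧ ∃ Φ : ℝ → Phase → Phase,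
      (∀ z ∈ thickening (7 / 4) R, Φ 0 z = z ∧ ∀ t ∈ Icc (0 : ℝ) 1, ‖Φ t z - z‖ ≤ κ ∧
        HasDerivWithinAt (fun t => Φ t z) (hamField s f (Φ t z)) (Icc 0 1) t) ∧
      AnalyticOnNhd ℂ (Φ 1) (thickening (7 / 4) R) ∧
      ∀ z ∈ thickening (7 / 4) R, ∀ v w,
        sympl s (fderiv ℂ (Φ 1) z v) (fderiv ℂ (Φ 1) z w) = sympl s v w := by
  have hs2 : s * s = 1 := by rw [← abs_mul_abs_self, hs, one_mul]
  have hX : AnalyticOnNhd ℂ (hamField s f) (thickening 3 R) :=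
    (analyticOnNhd_hamField hf s).mono (thickening_mono (by norm_num) R)
  have hκ : ∀ z ∈ thickening 3 R, ‖hamField s f z‖ ≤ κ := fun z hz =>
    (norm_sharp_le hs _).trans
      ((norm_fderiv_le_of_mem_thickening hf hB (by norm_num) hz).trans_eq (by ring))
  obtain ⟨Φ, A, h⟩ := exists_flow hX hκ hκ1
  have h1 : (1 : ℝ) ∈ Icc (0 : ℝ) 1 := right_mem_Icc.2 zero_le_one
  have h0 : (0 : ℝ) ∈ Icc (0 : ℝ) 1 := left_mem_Icc.2 zero_le_one
  refine ⟨hX, hκ, Φ, fun z hz => ⟨(h z hz).1, fun t ht => ⟨((h z hz).2.2 t ht).1,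
    ((h z hz).2.2 t ht).2.1⟩⟩, ?_, fun z hz v w => ?_⟩
  · exact DifferentiableOn.analyticOnNhd_of_finiteDimensional (fun z hz =>
      ((h z hz).2.2 1 h1).2.2.2.differentiableAt.differentiableWithinAt) isOpen_thickening
  · obtain ⟨-, hA0, hz'⟩ := h z hz
    have hd : ∀ t ∈ Icc (0 : ℝ) 1,
        HasDerivWithinAt (fun t => sympl s (A t z v) (A t z w)) 0 (Icc 0 1) t := by
      intro t ht
      obtain ⟨hb, -, hA, -⟩ := hz' t ht
      have hmem : Φ t z ∈ thickening 4 R := ball_subset_thickening_add (q := 1) hz (by norm_num)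
        (mem_ball_iff_norm.2 ((hb.trans hκ1).trans_lt (by norm_num)))
      have hAu : ∀ u, HasDerivWithinAt (fun t => A t z u)
          (fderiv ℂ (hamField s f) (Φ t z) (A t z u)) (Icc 0 1) t := fun u =>
        (((ContinuousLinearMap.apply ℂ Phase u).restrictScalars ℝ).hasFDerivAt
          |>.comp_hasDerivWithinAt t hA)
      refine (hasDerivWithinAt_sympl (hAu v) (hAu w)).congr_deriv ?_
      exact sympl_fderiv_hamField hs2 (hf _ hmem) _ _
    have hc := norm_sub_le_of_hasDerivWithinAt_unitInterval (κ := 0) hd (fun t _ => by simp) h0 h1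
    rw [norm_le_zero_iff, sub_eq_zero] at hc
    rw [((hz' 1 h1).2.2.2).fderiv, hc, hA0]
    rfl

end

end Phase

/-! ### Anisotropic rescaling -/

open Metric

namespace Phase

/-- The factors `σ` for the angles, `ρ` for the actions and `√(ρσ)` for the remaining variables.
The rescaling by these factors maps isotropic neighbourhoods in the sup
norm to the sets `domain`, and multiplies the symplectic form by `ρσ`. -/
def scaleFactor (ρ σ : ℝ) : Fin 4 → ℝ := ![σ, ρ, Real.sqrt (ρ * σ), Real.sqrt (ρ * σ)]

theorem scaleFactor_pos {ρ σ : ℝ} (hρ : 0 < ρ) (hσ : 0 < σ) (k : Fin 4) :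
    0 < scaleFactor ρ σ k := by
  have := Real.sqrt_pos.2 (mul_pos hρ hσ)
  fin_cases k <;> simpa [scaleFactor]

/-- Multiplication by a nonzero real factor in each of the four blocks of variables. -/
def scale (c : Fin 4 → ℝ) (hc : ∀ k, 0 < c k) : Phase ≃L[ℂ] Phase :=
  (LinearEquiv.piCongrRight fun k =>
    LinearEquiv.smulOfNeZero ℂ (Fin 2 → ℂ) (c k : ℂ)
      (ofReal_ne_zero.2 (hc k).ne')).toContinuousLinearEquiv

theorem scale_apply (c : Fin 4 → ℝ) (hc : ∀ k, 0 < c k) (w : Phase) (k : Fin 4) (j : Fin 2) :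
    scale c hc w k j = c k * w k j := rfl

theorem scale_basisVec (c : Fin 4 → ℝ) (hc : ∀ k, 0 < c k) (k : Fin 4) (j : Fin 2) :
    scale c hc (basisVec k j) = (c k : ℂ) • basisVec k j := by
  ext l i
  rw [scale_apply]
  by_cases h : l = k
  · subst h; simp
  · simp [basisVec, h]

theorem partialDeriv_comp_scale (c : Fin 4 → ℝ) (hc : ∀ k, 0 < c k) {f : Phase → ℂ} {w : Phase}
    (hf : DifferentiableAt ℂ f (scale c hc w)) (a : ℂ) (k : Fin 4) (j : Fin 2) :
    partialDeriv k j (fun w => a * f (scale c hc w)) w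
      = a * (c k * partialDeriv k j f (scale c hc w)) := by
  have h : HasFDerivAt (fun w => a * f (scale c hc w))
      (a • (fderiv ℂ f (scale c hc w)).comp (scale c hc : Phase →L[ℂ] Phase)) w :=
    (hf.hasFDerivAt.comp w (scale c hc).hasFDerivAt).const_mul a
  rw [partialDeriv, h.fderiv, partialDeriv]
  change a • fderiv ℂ f (scale c hc w) (scale c hc (basisVec k j)) = _
  rw [scale_basisVec, map_smul, smul_eq_mul, smul_eq_mul]

section

variable {ρ σ : ℝ} (hc : ∀ k, 0 < scaleFactor ρ σ k)

theorem scaleFactor_two_mul_self (hρ : 0 < ρ) (hσ : 0 < σ) :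
    (scaleFactor ρ σ 2 : ℂ) * scaleFactor ρ σ 2 = ρ * σ := by
  have : scaleFactor ρ σ 2 * scaleFactor ρ σ 2 = ρ * σ :=
    Real.mul_self_sqrt (mul_pos hρ hσ).le
  exact_mod_cast this

theorem sympl_scale (hρ : 0 < ρ) (hσ : 0 < σ) (s : ℝ) (v w : Phase) :
    sympl s (scale _ hc v) (scale _ hc w) = ρ * σ * sympl s v w := by
  have h := scaleFactor_two_mul_self hρ hσ
  have h3 : scaleFactor ρ σ 3 = scaleFactor ρ σ 2 := rfl
  have h0 : scaleFactor ρ σ 0 = σ := rfl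
  have h1 : scaleFactor ρ σ 1 = ρ := rfl
  simp only [sympl, scale_apply, Finset.mul_sum, h3, h0, h1]
  refine Finset.sum_congr rfl fun j _ => ?_
  linear_combination s * (v 2 j * w 3 j - v 3 j * w 2 j) * h

theorem hamField_scale (hρ : 0 < ρ) (hσ : 0 < σ) (s : ℝ) {f : Phase → ℂ} {w : Phase}
    (hf : DifferentiableAt ℂ f (scale _ hc w)) :
    scale _ hc (hamField s (fun w => ((ρ * σ : ℝ) : ℂ)⁻¹ * f (scale _ hc w)) w)
      = hamField s f (scale _ hc w) := by
  have h := scaleFactor_two_mul_self hρ hσ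
  have h3 : scaleFactor ρ σ 3 = scaleFactor ρ σ 2 := rfl
  have h0 : scaleFactor ρ σ 0 = σ := rfl
  have h1 : scaleFactor ρ σ 1 = ρ := rfl
  have hρ' : (ρ : ℂ) ≠ 0 := ofReal_ne_zero.2 hρ.ne'
  have hσ' : (σ : ℂ) ≠ 0 := ofReal_ne_zero.2 hσ.ne'
  have hd := partialDeriv_comp_scale _ hc hf ((ρ * σ : ℝ) : ℂ)⁻¹
  ext k j
  rw [scale_apply]
  fin_cases k
  · change (scaleFactor ρ σ 0 : ℂ) * -partialDeriv 1 j _ w = -partialDeriv 1 j f _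
    rw [hd, h0, h1]; push_cast; field_simp
  · change (scaleFactor ρ σ 1 : ℂ) * partialDeriv 0 j _ w = partialDeriv 0 j f _
    rw [hd, h0, h1]; push_cast; field_simp
  · change (scaleFactor ρ σ 2 : ℂ) * -(s * partialDeriv 3 j _ w) = -(s * partialDeriv 3 j f _)
    rw [hd, h3]; push_cast; field_simp
    linear_combination -s * partialDeriv 3 j f (scale _ hc w) * h
  · change (scaleFactor ρ σ 3 : ℂ) * (s * partialDeriv 2 j _ w) = s * partialDeriv 2 j f _
    rw [hd, h3]; push_cast; field_simp
    linear_combination s * partialDeriv 2 j f (scale _ hc w) * h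

theorem conjPoint_scale (w : Phase) : conjPoint (scale _ hc w) = scale _ hc (conjPoint w) := by
  have h3 : scaleFactor ρ σ 3 = scaleFactor ρ σ 2 := rfl
  ext k j
  rw [scale_apply]
  fin_cases k <;> simp [conjPoint, scale_apply, h3] <;> ring

/-- The resonant cylinder in rescaled coordinates. -/
def cylinder (Δ σ : ℝ) : Set Phase :=
  {w | ∃ θ : Fin 2 → ℝ, θ 0 ∈ Ioo Δ (2 * Real.pi - Δ) ∧ w = circular fun j => θ j / σ}

theorem scale_mem_domain_iff (hρ : 0 < ρ) (hσ : 0 < σ) {Δ p : ℝ} (hp : 0 ≤ p) {w : Phase} :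
    scale _ hc w ∈ domain Δ (p * ρ) (p * σ) ↔ ∃ r ∈ cylinder Δ σ, ‖w - r‖ ≤ p := by
  have h2 : Real.sqrt (p * ρ * (p * σ)) = p * Real.sqrt (ρ * σ) := by
    rw [show p * ρ * (p * σ) = p ^ 2 * (ρ * σ) by ring, Real.sqrt_mul (sq_nonneg p),
      Real.sqrt_sq hp]
  have hs := Real.sqrt_pos.2 (mul_pos hρ hσ)
  have hmul : ∀ (c : ℝ) (x : ℂ), 0 < c → (‖(c : ℂ) * x‖ ≤ p * c ↔ ‖x‖ ≤ p) := fun c x hc => by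
    rw [norm_mul, norm_real, Real.norm_of_nonneg hc.le, mul_comm, mul_le_mul_iff_left₀ hc]
  have key : ∀ θ : Fin 2 → ℝ, (∀ j, ‖scale _ hc w 0 j - (θ j : ℂ)‖ ≤ p * σ ∧
      ‖scale _ hc w 1 j‖ ≤ p * ρ ∧ ‖scale _ hc w 2 j‖ ≤ Real.sqrt (p * ρ * (p * σ)) ∧
      ‖scale _ hc w 3 j‖ ≤ Real.sqrt (p * ρ * (p * σ))) ↔
      ‖w - circular fun j => θ j / σ‖ ≤ p := fun θ => by
    rw [norm_le_iff hp, h2]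
    refine forall_congr' fun j => ?_
    have e0 : scale _ hc w 0 j - (θ j : ℂ) = (σ : ℂ) * (w 0 j - ((θ j / σ : ℝ) : ℂ)) := by
      have hσ' : (σ : ℂ) ≠ 0 := ofReal_ne_zero.2 hσ.ne'
      change (σ : ℂ) * w 0 j - _ = _
      push_cast
      field_simp
    have e1 : scale _ hc w 1 j = (ρ : ℂ) * w 1 j := rfl
    have e2 : scale _ hc w 2 j = ((Real.sqrt (ρ * σ) : ℝ) : ℂ) * w 2 j := rfl
    have e3 : scale _ hc w 3 j = ((Real.sqrt (ρ * σ) : ℝ) : ℂ) * w 3 j := rfl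
    rw [e0, e1, e2, e3, hmul _ _ hσ, hmul _ _ hρ, hmul _ _ hs, hmul _ _ hs]
    simp [circular]
  constructor
  · rintro ⟨θ, hθ, h⟩
    exact ⟨_, ⟨θ, hθ, rfl⟩, (key θ).1 h⟩
  · rintro ⟨_, ⟨θ, hθ, rfl⟩, h⟩
    exact ⟨θ, hθ, (key θ).2 h⟩

theorem mem_thickening_cylinder_of_mem_domain (hρ : 0 < ρ) (hσ : 0 < σ) {Δ p q : ℝ} (hp : 0 ≤ p)
    (hpq : p < q) {w : Phase} (hw : scale _ hc w ∈ domain Δ (p * ρ) (p * σ)) :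
    w ∈ thickening q (cylinder Δ σ) := by
  obtain ⟨r, hr, h⟩ := (scale_mem_domain_iff hc hρ hσ hp).1 hw
  exact mem_thickening_iff.2 ⟨r, hr, by rw [dist_eq_norm]; linarith⟩

theorem scale_mem_domain_of_mem_thickening (hρ : 0 < ρ) (hσ : 0 < σ) {Δ p : ℝ} (hp : 0 ≤ p)
    {w : Phase} (hw : w ∈ thickening p (cylinder Δ σ)) :
    scale _ hc w ∈ domain Δ (p * ρ) (p * σ) := by
  obtain ⟨r, hr, h⟩ := mem_thickening_iff.1 hw
  exact (scale_mem_domain_iff hc hρ hσ hp).2 ⟨r, hr, by rw [← dist_eq_norm]; exact h.le⟩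

theorem scale_mem_domain_add (hρ : 0 < ρ) (hσ : 0 < σ) {Δ p q κ : ℝ} (hp : 0 ≤ p)
    (hpq : p + κ ≤ q) {w w' : Phase} (hw : scale _ hc w ∈ domain Δ (p * ρ) (p * σ))
    (hκ : ‖w' - w‖ ≤ κ) : scale _ hc w' ∈ domain Δ (q * ρ) (q * σ) := by
  have hκ0 := (norm_nonneg _).trans hκ
  obtain ⟨r, hr, h⟩ := (scale_mem_domain_iff hc hρ hσ hp).1 hw
  refine (scale_mem_domain_iff hc hρ hσ (by linarith)).2 ⟨r, hr, ?_⟩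
  linarith [norm_sub_le_norm_sub_add_norm_sub w' w r]

end

theorem add_smul_fast_mem_cylinder {Δ σ : ℝ} (hσ : 0 < σ) {r : Phase} (hr : r ∈ cylinder Δ σ)
    (t : ℝ) : r + (t : ℂ) • fast ∈ cylinder Δ σ := by
  obtain ⟨θ, hθ, rfl⟩ := hr
  refine ⟨![θ 0, θ 1 + σ * t], hθ, ?_⟩
  ext k j
  fin_cases k
  · fin_cases j
    · simp [circular, basisVec]
    · have hσ' : (σ : ℂ) ≠ 0 := ofReal_ne_zero.2 hσ.ne'
      simp [circular, basisVec]
      field_simp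
  · simp [circular, basisVec]
  · simp [circular, basisVec]
  · simp [circular, basisVec]

theorem add_smul_fast_mem_thickening {Δ σ : ℝ} (hσ : 0 < σ) {p : ℝ} {w : Phase}
    (hw : w ∈ thickening p (cylinder Δ σ)) (t : ℝ) :
    w + (t : ℂ) • fast ∈ thickening p (cylinder Δ σ) := by
  obtain ⟨r, hr, h⟩ := mem_thickening_iff.1 hw
  exact mem_thickening_iff.2 ⟨_, add_smul_fast_mem_cylinder hσ hr t, by rwa [dist_add_right]⟩

theorem sub_smul_fast_mem_thickening {Δ σ : ℝ} (hσ : 0 < σ) {p τ : ℝ} {w : Phase}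
    (hw : w ∈ thickening p (cylinder Δ σ)) (hτ : τ ∈ Icc (0 : ℝ) 1) :
    w - ((τ : ℂ) * w 0 1) • fast ∈ thickening p (cylinder Δ σ) := by
  obtain ⟨r, hr, h⟩ := mem_thickening_iff.1 hw
  obtain ⟨θ, hθ, rfl⟩ := hr
  refine mem_thickening_iff.2 ⟨_, add_smul_fast_mem_cylinder hσ ⟨θ, hθ, rfl⟩ (-(τ * (θ 1 / σ))),
    lt_of_le_of_lt ?_ h⟩
  rw [dist_eq_norm, dist_eq_norm]
  set r := circular fun j => θ j / σ with hr
  have hr1 : r 0 1 = ((θ 1 / σ : ℝ) : ℂ) := rfl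
  have e2 : w - ((τ : ℂ) * w 0 1) • fast - (r + ((-(τ * (θ 1 / σ)) : ℝ) : ℂ) • fast)
      = (w - r) - ((τ : ℂ) * (w - r) 0 1) • fast := by
    rw [Pi.sub_apply, Pi.sub_apply, hr1]
    push_cast
    module
  rw [e2]
  generalize w - r = v
  have hn := fun k j => norm_apply_le v k j
  refine (norm_le_iff (norm_nonneg v)).2 fun j => ⟨?_, ?_, ?_, ?_⟩
  · fin_cases j
    · simpa [basisVec] using hn 0 0
    · have e3 : (v - ((τ : ℂ) * v 0 1) • fast) 0 1 = ((1 - τ : ℝ) : ℂ) * v 0 1 := by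
        simp [basisVec]; ring
      simp only [Fin.mk_one, e3]
      rw [norm_mul, norm_real, Real.norm_of_nonneg (by linarith [hτ.2])]
      nlinarith [hn 0 1, norm_nonneg (v 0 1), hτ.1]
  · simpa [basisVec] using hn 1 j
  · simpa [basisVec] using hn 2 j
  · simpa [basisVec] using hn 3 j

theorem conjPoint_of_mem_cylinder {Δ σ : ℝ} {r : Phase} (hr : r ∈ cylinder Δ σ) :
    conjPoint r = r := by
  obtain ⟨θ, -, rfl⟩ := hr
  ext k j
  fin_cases k <;> simp [conjPoint, circular]

theorem norm_conjPoint_le (z : Phase) : ‖conjPoint z‖ ≤ ‖z‖ := by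
  refine (norm_le_iff (norm_nonneg z)).2 fun j => ⟨?_, ?_, ?_, ?_⟩
  · exact (norm_conj (z 0 j)).trans_le (norm_apply_le z 0 j)
  · exact (norm_conj (z 1 j)).trans_le (norm_apply_le z 1 j)
  · simpa [conjPoint] using norm_apply_le z 3 j
  · simpa [conjPoint] using norm_apply_le z 2 j

theorem conjPoint_mem_thickening {Δ σ p : ℝ} {w : Phase}
    (hw : w ∈ thickening p (cylinder Δ σ)) : conjPoint w ∈ thickening p (cylinder Δ σ) := by
  obtain ⟨r, hr, h⟩ := mem_thickening_iff.1 hw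
  refine mem_thickening_iff.2 ⟨r, hr, ?_⟩
  rw [dist_eq_norm] at h ⊢
  have e : conjPoint w - r = conjPoint (w - r) := by
    conv_lhs => rw [← conjPoint_of_mem_cylinder hr]
    exact (map_sub conjPointL w r).symm
  rw [e]
  exact (norm_conjPoint_le _).trans_lt h

/-- An open variant of `domain Δ (p * ρ) (p * σ)`: the points whose rescaled coordinates are at
distance less than `p` from the resonant cylinder. -/
def openDomain {ρ σ : ℝ} (hc : ∀ k, 0 < scaleFactor ρ σ k) (Δ p : ℝ) : Set Phase :=
  (scale _ hc).symm ⁻¹' thickening p (cylinder Δ σ)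

theorem scale_mem_openDomain {ρ σ : ℝ} (hc : ∀ k, 0 < scaleFactor ρ σ k) {Δ p : ℝ} {w : Phase}
    (hw : w ∈ thickening p (cylinder Δ σ)) : scale _ hc w ∈ openDomain hc Δ p := by
  rwa [openDomain, mem_preimage, ContinuousLinearEquiv.symm_apply_apply]

theorem domain_subset_openDomain {ρ σ : ℝ} (hc : ∀ k, 0 < scaleFactor ρ σ k) (hρ : 0 < ρ)
    (hσ : 0 < σ) {Δ p q : ℝ} (hp : 0 ≤ p) (hpq : p < q) :
    domain Δ (p * ρ) (p * σ) ⊆ openDomain hc Δ q := fun z hz =>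
  mem_thickening_cylinder_of_mem_domain hc hρ hσ hp hpq
    (by rwa [ContinuousLinearEquiv.apply_symm_apply])

theorem openDomain_subset_domain {ρ σ : ℝ} (hc : ∀ k, 0 < scaleFactor ρ σ k) (hρ : 0 < ρ)
    (hσ : 0 < σ) {Δ p : ℝ} (hp : 0 ≤ p) : openDomain hc Δ p ⊆ domain Δ (p * ρ) (p * σ) :=
  fun z hz => by
    have := scale_mem_domain_of_mem_thickening hc hρ hσ hp hz
    rwa [ContinuousLinearEquiv.apply_symm_apply] at this

theorem isFastStrip_openDomain {Δ ρ σ : ℝ} (hc : ∀ k, 0 < scaleFactor ρ σ k) (hσ : 0 < σ) (p : ℝ) :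
    IsFastStrip (openDomain hc Δ p) where
  isOpen := isOpen_thickening.preimage (scale _ hc).symm.continuous
  translate z hz t := by
    have e : (scale _ hc).symm (z + (t : ℂ) • fast)
        = (scale _ hc).symm z + ((t / σ : ℝ) : ℂ) • fast := by
      have hσ' : (σ : ℂ) ≠ 0 := ofReal_ne_zero.2 hσ.ne'
      rw [ContinuousLinearEquiv.symm_apply_eq, map_add, ContinuousLinearEquiv.apply_symm_apply,
        map_smul, scale_basisVec, smul_smul]
      have h0 : scaleFactor ρ σ 0 = σ := rfl
      rw [h0]
      push_cast
      rw [div_mul_cancel₀ _ hσ']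
    rw [openDomain, mem_preimage, e]
    exact add_smul_fast_mem_thickening hσ hz _
  retract z hz τ hτ := by
    set w := (scale _ hc).symm z with hw
    have hwz : scale _ hc w = z := (scale _ hc).apply_symm_apply z
    have hzw : z 0 1 = scaleFactor ρ σ 0 * w 0 1 := (congrFun (congrFun hwz 0) 1).symm
    have e : (scale _ hc).symm (z - ((τ : ℂ) * z 0 1) • fast) = w - ((τ : ℂ) * w 0 1) • fast := by
      rw [ContinuousLinearEquiv.symm_apply_eq, map_sub, hw, ContinuousLinearEquiv.apply_symm_apply,
        map_smul, scale_basisVec, smul_smul, hzw]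
      congr 2
      ring
    rw [openDomain, mem_preimage, e]
    exact sub_smul_fast_mem_thickening hσ (w := w) hz hτ

theorem hamField_add_const {U : Set Phase} (hU : IsOpen U) {f : Phase → ℂ} {b : Phase}
    (hf : ∀ z ∈ U, f (z + b) = f z) (s : ℝ) {z : Phase} (hz : z ∈ U) :
    hamField s f (z + b) = hamField s f z := by
  rw [hamField_eq_sharp, hamField_eq_sharp, ← fderiv_comp_add_right]
  congr 1
  refine Filter.EventuallyEq.fderiv_eq ?_
  filter_upwards [hU.mem_nhds hz] with w hw using hf w hw

end Phase

/-! ### The averaged normal form -/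

open Metric

/-- Near the resonant action `l` the Keplerian frequency `ω (l / L) ^ 3` is close to `ω`. -/
theorem norm_keplerFrequency_sub_le {ω l : ℝ} {L : ℂ} (hω : 0 < ω) (hl : 0 < l)
    (hL : ‖L - l‖ ≤ l / 2) : L ≠ 0 ∧ ‖((ω * l ^ 3 : ℝ) : ℂ) / L ^ 3 - ω‖ ≤ 38 * ω * ‖L - l‖ / l := by
  have hnl : ‖(l : ℂ)‖ = l := by rw [norm_real, Real.norm_of_nonneg hl.le]
  have h1 : l / 2 ≤ ‖L‖ := by
    have := norm_sub_norm_le (l : ℂ) (l - L)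
    rw [sub_sub_cancel, norm_sub_rev (l : ℂ) L, hnl] at this
    linarith
  have h2 : ‖L‖ ≤ 3 / 2 * l := by
    have := norm_add_le (L - l) (l : ℂ)
    rw [sub_add_cancel, hnl] at this
    linarith
  have hL0 : L ≠ 0 := norm_pos_iff.1 (by linarith)
  refine ⟨hL0, ?_⟩
  have e : ((ω * l ^ 3 : ℝ) : ℂ) / L ^ 3 - ω
      = -((ω : ℂ) * (L - l) * (L ^ 2 + L * l + l ^ 2) / L ^ 3) := by
    push_cast
    field_simp
    ring
  have h3 : ‖L ^ 2 + L * l + l ^ 2‖ ≤ 19 / 4 * l ^ 2 := by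
    refine (norm_add₃_le).trans ?_
    rw [norm_pow, norm_mul, norm_pow, hnl]
    nlinarith [norm_nonneg L]
  have h4 : (l / 2) ^ 3 ≤ ‖L‖ ^ 3 := pow_le_pow_left₀ (by positivity) h1 3
  rw [e, norm_neg, norm_div, norm_mul, norm_mul, norm_pow, norm_real, Real.norm_of_nonneg hω.le]
  calc ω * ‖L - l‖ * ‖L ^ 2 + L * l + l ^ 2‖ / ‖L‖ ^ 3
      ≤ ω * ‖L - l‖ * (19 / 4 * l ^ 2) / (l / 2) ^ 3 := by gcongr
    _ = 38 * ω * ‖L - l‖ / l := by field_simp; ring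

namespace PlanetarySystem

variable {S : PlanetarySystem} {ε : ℝ}

theorem hasDerivWithinAt_HK {γ : ℝ → Phase} {v : Phase} {I : Set ℝ} {t : ℝ}
    (hγ : HasDerivWithinAt γ v I t) (h0 : ∀ j, S.action ε (γ t) j ≠ 0) :
    HasDerivWithinAt (fun t => S.HK ε (γ t))
      (((S.mu ε 0 ^ 2 * S.beta ε 0 ^ 3 : ℝ) : ℂ) / S.action ε (γ t) 0 ^ 3 * v 1 0
        + ((S.mu ε 1 ^ 2 * S.beta ε 1 ^ 3 : ℝ) : ℂ) / S.action ε (γ t) 1 ^ 3 * (v 1 1 - v 1 0))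
      I t := by
  have hc : ∀ j, HasDerivWithinAt (fun t => γ t 1 j) (v 1 j) I t := fun j =>
    hasDerivWithinAt_pi.1 (hasDerivWithinAt_pi.1 hγ 1) j
  have ha0 : HasDerivWithinAt (fun t => S.action ε (γ t) 0) (v 1 0) I t := (hc 0).const_add _
  have ha1 : HasDerivWithinAt (fun t => S.action ε (γ t) 1) (v 1 1 - v 1 0) I t :=
    (((hc 0).const_sub _).add (hc 1)).congr_deriv (by ring)
  have hk : ∀ (c : ℂ) (j : Fin 2) (a' : ℂ), HasDerivWithinAt (fun t => S.action ε (γ t) j) a' I t →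
      HasDerivWithinAt (fun t => -c / (2 * S.action ε (γ t) j ^ 2))
        (c / S.action ε (γ t) j ^ 3 * a') I t := by
    intro c j a' ha
    have h := (hasDerivWithinAt_const t I (-c)).div ((ha.pow 2).const_mul 2)
      (mul_ne_zero two_ne_zero (pow_ne_zero 2 (h0 j)))
    refine h.congr_deriv ?_
    have := h0 j
    simp only [Pi.pow_apply]
    field_simp
    ring
  have h := (hk ((S.mu ε 0 ^ 2 * S.beta ε 0 ^ 3 : ℝ) : ℂ) 0 _ ha0).add
    (hk ((S.mu ε 1 ^ 2 * S.beta ε 1 ^ 3 : ℝ) : ℂ) 1 _ ha1)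
  refine h.congr_of_eventuallyEq (Filter.Eventually.of_forall fun t => ?_) ?_ <;>
    exact Fin.sum_univ_two _

theorem analyticAt_HK {z : Phase} (h0 : ∀ j, S.action ε z j ≠ 0) : AnalyticAt ℂ (S.HK ε) z := by
  refine Finset.analyticAt_fun_sum _ fun j _ => ?_
  exact analyticAt_const.div (analyticAt_const.mul ((analyticAt_action j).pow 2))
    (mul_ne_zero two_ne_zero (pow_ne_zero 2 (h0 j)))

/-- Energy balance along a trajectory of the generating Hamiltonian `χ`: the Keplerian part changes
by `ω ∂χ/∂ζ₂ = P̄ - P` up to the detuning of the frequencies, which turns the perturbation `P` at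
the end point into the average `P̄` at the starting point. -/
theorem norm_energy_sub_le {γ : ℝ → Phase} {χ P Pbar : Phase → ℂ} {s b d e : ℝ}
    (hγ : ∀ t ∈ Icc (0 : ℝ) 1,
      HasDerivWithinAt γ (Phase.hamField s χ (γ t)) (Icc (0 : ℝ) 1) t)
    (h0 : ∀ t ∈ Icc (0 : ℝ) 1, ∀ j, S.action ε (γ t) j ≠ 0)
    (hhom : ∀ t ∈ Icc (0 : ℝ) 1,
      S.ω * Phase.partialDeriv 0 1 χ (γ t) = Pbar (γ t) - P (γ t))
    (hb : ∀ t ∈ Icc (0 : ℝ) 1, ∀ j,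
      ‖((S.mu ε j ^ 2 * S.beta ε j ^ 3 : ℝ) : ℂ) / S.action ε (γ t) j ^ 3 - S.ω‖ ≤ b)
    (hd : ∀ t ∈ Icc (0 : ℝ) 1, ∀ j, ‖Phase.partialDeriv 0 j χ (γ t)‖ ≤ d)
    (hP : ∀ t ∈ Icc (0 : ℝ) 1, ‖P (γ 1) - P (γ t)‖ ≤ e)
    (hPbar : ∀ t ∈ Icc (0 : ℝ) 1, ‖Pbar (γ t) - Pbar (γ 0)‖ ≤ e) :
    ‖S.HK ε (γ 1) + P (γ 1) - S.HK ε (γ 0) - Pbar (γ 0)‖ ≤ 2 * e + 3 * (b * d) := by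
  have hz0 : (0 : ℝ) ∈ Icc (0 : ℝ) 1 := by simp
  have hz1 : (1 : ℝ) ∈ Icc (0 : ℝ) 1 := by simp
  have hb0 : 0 ≤ b := (norm_nonneg _).trans (hb 0 hz0 0)
  have hg : ∀ t ∈ Icc (0 : ℝ) 1, HasDerivWithinAt
      (fun t : ℝ => S.HK ε (γ t) + (t : ℂ) * (P (γ 1) - Pbar (γ 0))) _ (Icc 0 1) t := fun t ht =>
    (hasDerivWithinAt_HK (hγ t ht) (h0 t ht)).add
      (((hasDerivAt_id t).ofReal_comp.hasDerivWithinAt).mul_const (P (γ 1) - Pbar (γ 0)))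
  have h := norm_sub_le_of_hasDerivWithinAt_unitInterval (κ := 2 * e + 3 * (b * d)) hg
    (fun t ht => ?_) hz0 hz1
  · refine (congrArg norm ?_).trans_le h
    push_cast
    ring
  · change ‖_ * Phase.partialDeriv 0 0 χ (γ t) + _ * (Phase.partialDeriv 0 1 χ (γ t) -
      Phase.partialDeriv 0 0 χ (γ t)) + _‖ ≤ _
    have h2 := hhom t ht
    have hb0' := hb t ht 0
    have hb1' := hb t ht 1
    have hd0 := hd t ht 0
    have hd1 := hd t ht 1
    set A0 := ((S.mu ε 0 ^ 2 * S.beta ε 0 ^ 3 : ℝ) : ℂ) / S.action ε (γ t) 0 ^ 3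
    set A1 := ((S.mu ε 1 ^ 2 * S.beta ε 1 ^ 3 : ℝ) : ℂ) / S.action ε (γ t) 1 ^ 3
    set D0 := Phase.partialDeriv 0 0 χ (γ t)
    set D1 := Phase.partialDeriv 0 1 χ (γ t)
    have hm : ∀ A D : ℂ, ‖A‖ ≤ b → ‖D‖ ≤ d → ‖A * D‖ ≤ b * d := fun A D hA hD =>
      (norm_mul _ _).trans_le (mul_le_mul hA hD (norm_nonneg _) hb0)
    have e1 : A0 * D0 + A1 * (D1 - D0) + ((1 : ℝ) : ℂ) * (P (γ 1) - Pbar (γ 0))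
        = (P (γ 1) - P (γ t)) + (Pbar (γ t) - Pbar (γ 0))
          + ((A0 - S.ω) * D0 + (A1 - S.ω) * D1 - (A1 - S.ω) * D0) := by
      push_cast
      linear_combination h2
    refine (congrArg norm e1).trans_le ?_
    have t1 := norm_add_le ((P (γ 1) - P (γ t)) + (Pbar (γ t) - Pbar (γ 0)))
      ((A0 - S.ω) * D0 + (A1 - S.ω) * D1 - (A1 - S.ω) * D0)
    have t2 := norm_add_le (P (γ 1) - P (γ t)) (Pbar (γ t) - Pbar (γ 0))
    have t3 := norm_sub_le ((A0 - S.ω) * D0 + (A1 - S.ω) * D1) ((A1 - S.ω) * D0)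
    have t4 := norm_add_le ((A0 - S.ω) * D0) ((A1 - S.ω) * D1)
    linarith [hm _ _ hb0' hd0, hm _ _ hb1' hd1, hm _ _ hb1' hd0, hP t ht, hPbar t ht]

end PlanetarySystem

open Metric

namespace Phase

/-- A Hamiltonian bounded by `ρσκ / 2` on the domain of width `4` has a flow of speed at most `κ`
in the rescaled coordinates, hence a time-one map which is defined on the domain of width `3 / 2`
and has the stated geometric properties. Functions bounded by `N` vary by at most `2 N κ` along
the trajectories. -/
theorem exists_timeOne_map {s ρ σ κ : ℝ} (hs : |s| = 1) (hρ : 0 < ρ) (hσ : 0 < σ)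
    (hc : ∀ k, 0 < scaleFactor ρ σ k) (Δ : ℝ) {χ : Phase → ℂ}
    (hχ : AnalyticOnNhd ℂ χ (openDomain hc Δ 4))
    (hχB : ∀ z ∈ openDomain hc Δ 4, ‖χ z‖ ≤ ρ * σ * (κ / 2)) (hκ1 : κ ≤ 1 / 100)
    (hχper : ∀ z ∈ openDomain hc Δ 4, χ (z + ((2 * Real.pi : ℝ) : ℂ) • fast) = χ z)
    (hχconj : ∀ z ∈ openDomain hc Δ 4, χ z.conjPoint = starRingEnd ℂ (χ z)) :
    ∃ γ : ℝ → Phase → Phase,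
      AnalyticOnNhd ℂ (γ 1) (domain Δ (3 / 2 * ρ) (3 / 2 * σ)) ∧
      (∀ z ∈ domain Δ (3 / 2 * ρ) (3 / 2 * σ), γ 0 z = z ∧ ∀ t ∈ Icc (0 : ℝ) 1,
        γ t z ∈ domain Δ (7 / 4 * ρ) (7 / 4 * σ) ∧
        HasDerivWithinAt (fun t => γ t z) (hamField s χ (γ t z)) (Icc (0 : ℝ) 1) t ∧
        ∀ j, ‖partialDeriv 0 j χ (γ t z)‖ ≤ ρ * κ) ∧
      (∀ z ∈ domain Δ (3 / 2 * ρ) (3 / 2 * σ), ∀ v w : Phase,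
        sympl s (fderiv ℂ (γ 1) z v) (fderiv ℂ (γ 1) z w) = sympl s v w) ∧
      (∀ z ∈ domain Δ (3 / 2 * ρ) (3 / 2 * σ),
        γ 1 (z + ((2 * Real.pi : ℝ) : ℂ) • fast) = γ 1 z + ((2 * Real.pi : ℝ) : ℂ) • fast) ∧
      (∀ z ∈ domain Δ (3 / 2 * ρ) (3 / 2 * σ), z.IsReal → (γ 1 z).IsReal) ∧
      InjOn (γ 1) (domain Δ (3 / 2 * ρ) (3 / 2 * σ)) ∧
      domain Δ (5 / 4 * ρ) (5 / 4 * σ) ⊆ γ 1 '' domain Δ (3 / 2 * ρ) (3 / 2 * σ) ∧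
      ∀ (g : Phase → ℂ) (N : ℝ), AnalyticOnNhd ℂ g (openDomain hc Δ 4) →
        (∀ z ∈ openDomain hc Δ 4, ‖g z‖ ≤ N) → ∀ z ∈ domain Δ (3 / 2 * ρ) (3 / 2 * σ),
        ∀ t ∈ Icc (0 : ℝ) 1, ∀ t' ∈ Icc (0 : ℝ) 1, ‖g (γ t z) - g (γ t' z)‖ ≤ 2 * N * κ := by
  have hρσ0 : 0 < ρ * σ := mul_pos hρ hσ
  set Sc := scale _ hc with hSc
  have hScS : ∀ z, Sc (Sc.symm z) = z := Sc.apply_symm_apply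
  have hSSc : ∀ w, Sc.symm (Sc w) = w := Sc.symm_apply_apply
  let R := cylinder Δ σ
  have hmemU : ∀ w ∈ thickening 4 R, Sc w ∈ openDomain hc Δ 4 := fun w hw =>
    scale_mem_openDomain hc hw
  have hdom : ∀ p q : ℝ, 0 ≤ p → p < q → ∀ z ∈ domain Δ (p * ρ) (p * σ),
      Sc.symm z ∈ thickening q R := fun p q hp hpq z hz =>
    domain_subset_openDomain hc hρ hσ hp hpq hz
  have hadd : ∀ p q : ℝ, 0 ≤ p → p + κ ≤ q → ∀ z ∈ domain Δ (p * ρ) (p * σ), ∀ w,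
      ‖w - Sc.symm z‖ ≤ κ → Sc w ∈ domain Δ (q * ρ) (q * σ) := fun p q hp hpq z hz w hw =>
    scale_mem_domain_add hc hρ hσ hp hpq (by rwa [← hSc, hScS]) hw
  -- the flow in rescaled coordinates
  let f : Phase → ℂ := fun w => ((ρ * σ : ℝ) : ℂ)⁻¹ * χ (Sc w)
  have hfan : AnalyticOnNhd ℂ f (thickening 4 R) := fun w hw =>
    analyticAt_const.mul ((hχ _ (hmemU w hw)).comp ((Sc : Phase →L[ℂ] Phase).analyticAt w))
  have hfB : ∀ w ∈ thickening 4 R, ‖f w‖ ≤ κ / 2 := fun w hw => by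
    rw [norm_mul, norm_inv, norm_real, Real.norm_of_nonneg hρσ0.le, inv_mul_le_iff₀ hρσ0]
    exact hχB _ (hmemU w hw)
  obtain ⟨hX, hXκ, Φ, hΦ, hΦan, hΦsym⟩ := exists_hamiltonian_flow hs hfan hfB hκ1
  have hXχ : ∀ w ∈ thickening 4 R, Sc (hamField s f w) = hamField s χ (Sc w) := fun w hw =>
    hamField_scale hc hρ hσ s (hχ _ (hmemU w hw)).differentiableAt
  obtain ⟨hinj, hsurj⟩ := injOn_and_exists_preimage_of_flow hX hXκ hκ1 hΦ
  have hw7 : ∀ z ∈ domain Δ (3 / 2 * ρ) (3 / 2 * σ), Sc.symm z ∈ thickening (7 / 4) R :=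
    hdom _ _ (by norm_num) (by norm_num)
  have hΦ3 : ∀ w ∈ thickening (7 / 4) R, ∀ t ∈ Icc (0 : ℝ) 1, Φ t w ∈ thickening 3 R :=
    fun w hw t ht => ball_subset_thickening_add (q := 1) hw (by norm_num)
      (mem_ball_iff_norm.2 ((((hΦ w hw).2 t ht).1.trans hκ1).trans_lt (by norm_num)))
  have h34 : ∀ w ∈ thickening 3 R, w ∈ thickening 4 R := fun w hw =>
    thickening_mono (by norm_num) R hw
  refine ⟨fun t z => Sc (Φ t (Sc.symm z)), ?_, fun z hz => ⟨?_, fun t ht => ?_⟩, ?_, ?_, ?_, ?_, ?_,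
    ?_⟩
  · exact fun z hz => ((Sc : Phase →L[ℂ] Phase).analyticAt _).comp
      ((hΦan _ (hw7 z hz)).comp ((Sc.symm : Phase →L[ℂ] Phase).analyticAt z))
  · simp only
    rw [(hΦ _ (hw7 z hz)).1, hScS]
  · obtain ⟨h1, h2⟩ := (hΦ _ (hw7 z hz)).2 t ht
    have h3 := hΦ3 _ (hw7 z hz) t ht
    refine ⟨hadd _ _ (by norm_num) (by linarith) z hz _ h1, ?_, fun j => ?_⟩
    · rw [← hXχ _ (h34 _ h3)]
      exact ((Sc : Phase →L[ℂ] Phase).restrictScalars ℝ).hasFDerivAt.comp_hasDerivWithinAt t h2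
    · -- the `ζ`-derivatives of `χ` are components of the vector field
      have h5 : partialDeriv 0 j χ (Sc (Φ t (Sc.symm z)))
          = ρ * hamField s f (Φ t (Sc.symm z)) 1 j :=
        (congrFun (congrFun (hXχ _ (h34 _ h3)) 1) j).symm
      rw [h5, norm_mul, norm_real, Real.norm_of_nonneg hρ.le]
      exact mul_le_mul_of_nonneg_left ((norm_apply_le _ _ _).trans (hXκ _ h3)) hρ.le
  · intro z hz v w
    have h1 : HasFDerivAt (fun z => Sc (Φ 1 (Sc.symm z))) ((Sc : Phase →L[ℂ] Phase).comp
        ((fderiv ℂ (Φ 1) (Sc.symm z)).comp (Sc.symm : Phase →L[ℂ] Phase))) z :=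
      (Sc : Phase →L[ℂ] Phase).hasFDerivAt.comp z
        ((hΦan _ (hw7 z hz)).differentiableAt.hasFDerivAt.comp z
          (Sc.symm : Phase →L[ℂ] Phase).hasFDerivAt)
    rw [h1.fderiv]
    change sympl s (Sc (fderiv ℂ (Φ 1) (Sc.symm z) (Sc.symm v)))
      (Sc (fderiv ℂ (Φ 1) (Sc.symm z) (Sc.symm w))) = _
    rw [hSc, sympl_scale hc hρ hσ, ← hSc, hΦsym _ (hw7 z hz),
      ← sympl_scale hc hρ hσ, ← hSc, hScS, hScS]
  · intro z hz
    let b : Phase := ((2 * Real.pi / σ : ℝ) : ℂ) • fast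
    have hb : Sc b = ((2 * Real.pi : ℝ) : ℂ) • fast := by
      have hσ' : (σ : ℂ) ≠ 0 := ofReal_ne_zero.2 hσ.ne'
      have h0 : scaleFactor ρ σ 0 = σ := rfl
      rw [map_smul, hSc, scale_basisVec, smul_smul, h0]
      push_cast
      rw [div_mul_cancel₀ _ hσ']
    have hfb : ∀ w ∈ thickening 3 R, f (w + b) = f w := fun w hw => by
      simp only [f]
      rw [map_add, hb, hχper _ (hmemU w (h34 w hw))]
    have hT := flow_comp_affine hX hXκ hκ1 hΦ (ContinuousLinearMap.id ℝ Phase) b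
      (fun p w hw => add_smul_fast_mem_thickening hσ hw _)
      (fun w hw => hamField_add_const isOpen_thickening hfb s hw) (hw7 z hz)
    simp only [ContinuousLinearMap.id_apply] at hT
    simp only
    rw [← hb, map_add, hSSc, hT, map_add]
  · intro z hz hreal
    have hfconj : ∀ w ∈ thickening 4 R, f w.conjPoint = starRingEnd ℂ (f w) := fun w hw => by
      simp only [f]
      rw [hSc, ← conjPoint_scale, ← hSc, hχconj _ (hmemU w hw), map_mul, map_inv₀, conj_ofReal]
    have hT := flow_comp_affine hX hXκ hκ1 hΦ conjPointL 0
      (fun p w hw => by rw [add_zero]; exact conjPoint_mem_thickening hw)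
      (fun w hw => by
        rw [add_zero]
        exact hamField_conjPoint isOpen_thickening
          (fun w hw => conjPoint_mem_thickening hw) hfan hfconj s (h34 w hw)) (hw7 z hz)
    rw [add_zero, add_zero, conjPointL_apply, conjPointL_apply] at hT
    have hw : (Sc.symm z).conjPoint = Sc.symm z := by
      rw [ContinuousLinearEquiv.eq_symm_apply, hSc, ← conjPoint_scale, ← hSc, hScS]
      exact (isReal_iff_conjPoint_eq z).1 hreal
    rw [hw] at hT
    refine (isReal_iff_conjPoint_eq _).2 ?_
    rw [hSc, conjPoint_scale, ← hSc, ← hT]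
  · intro z hz z' hz' h
    exact Sc.symm.injective (hinj (hdom _ _ (by norm_num) (by norm_num) z hz)
      (hdom _ _ (by norm_num) (by norm_num) z' hz') (Sc.injective h))
  · intro y hy
    obtain ⟨w, hw, hwy⟩ := hsurj _ (hdom _ (3 / 2) (by norm_num) (by norm_num) y hy)
    refine ⟨Sc w, hadd _ _ (by norm_num) (by linarith) y hy w hw, ?_⟩
    simp only
    rw [hSSc, hwy, hScS]
  · intro g N hg hgN z hz t ht t' ht'
    have hgan : AnalyticOnNhd ℂ (fun w => g (Sc w)) (thickening 4 R) := fun w hw =>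
      (hg _ (hmemU w hw)).comp ((Sc : Phase →L[ℂ] Phase).analyticAt w)
    have hd : ∀ w ∈ thickening 3 R, ‖fderiv ℂ (fun w => g (Sc w)) w‖ ≤ 2 * N := fun w hw =>
      (norm_fderiv_le_of_mem_thickening hgan (fun w hw => hgN _ (hmemU w hw)) (by norm_num)
        hw).trans_eq (by ring)
    have hm := hΦ3 _ (hw7 z hz)
    have hderiv : ∀ t ∈ Icc (0 : ℝ) 1, HasDerivWithinAt (fun t => g (Sc (Φ t (Sc.symm z))))
        (fderiv ℂ (fun w => g (Sc w)) (Φ t (Sc.symm z)) (hamField s f (Φ t (Sc.symm z))))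
        (Icc 0 1) t := fun t ht => by
      have h1 := (hgan _ (h34 _ (hm t ht))).differentiableAt.hasFDerivAt.restrictScalars ℝ
      exact h1.comp_hasDerivWithinAt t ((hΦ _ (hw7 z hz)).2 t ht).2
    refine norm_sub_le_of_hasDerivWithinAt_unitInterval hderiv (fun t ht => ?_) ht' ht
    exact (ContinuousLinearMap.le_opNorm _ _).trans (mul_le_mul (hd _ (hm t ht)) (hXκ _ (hm t ht))
      (norm_nonneg _) ((norm_nonneg _).trans (hd _ (hm t ht))))

end Phase

end

theorem theorem2 (S : PlanetarySystem) :
    ∃ ρ₀ σ₀ C M : ℝ, 0 < ρ₀ ∧ 0 < σ₀ ∧ 1 < C ∧ 0 < M ∧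
      (∀ ε Δ : ℝ, 0 < ε → ε ≤ 1 → 0 < Δ → ∀ z ∈ Phase.domain Δ ρ₀ σ₀,
        AnalyticAt ℂ (S.upsilon ε) z ∧ ‖fderiv ℂ (S.upsilon ε) z‖ ≤ C) ∧
      ∀ s ε Δ ρ σ : ℝ, (s = 1 ∨ s = -1) → 0 < ε → ε ≤ 1 → 0 < Δ → 0 < ρ → 0 < σ →
        ρ < ρ₀ / 2 → ρ < σ → σ < min (σ₀ / 2) (S.delta ε Δ / (32 * C)) →
        ε / (S.delta ε Δ * ρ * σ) < S.ω / (32 * Real.pi * M) →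
        AnalyticOnNhd ℂ (S.HP ε) (Phase.domain Δ (2 * ρ) (2 * σ)) ∧
        AnalyticOnNhd ℂ (S.chi ε) (Phase.domain Δ (2 * ρ) (2 * σ)) ∧
        (∀ z ∈ Phase.domain Δ (2 * ρ) (2 * σ),
          S.ω * Phase.partialDeriv 0 1 (S.chi ε) z = S.HPbar ε z - S.HP ε z) ∧
        (∀ z ∈ Phase.domain Δ (2 * ρ) (2 * σ),
          ‖S.HPbar ε z‖ ≤ 2 * M * (ε / S.delta ε Δ)) ∧
        ∃ 𝒞 : Phase → Phase,
          AnalyticOnNhd ℂ 𝒞 (Phase.domain Δ (3 / 2 * ρ) (3 / 2 * σ)) ∧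
          -- time-one map of the Hamiltonian flow generated by `χ`
          (∀ z ∈ Phase.domain Δ (3 / 2 * ρ) (3 / 2 * σ), ∃ γ : ℝ → Phase,
            γ 0 = z ∧ γ 1 = 𝒞 z ∧ ∀ t ∈ Set.Icc (0 : ℝ) 1,
              γ t ∈ Phase.domain Δ (7 / 4 * ρ) (7 / 4 * σ) ∧
              HasDerivWithinAt γ (Phase.hamField s (S.chi ε) (γ t)) (Set.Icc (0 : ℝ) 1) t) ∧
          -- canonical
          (∀ z ∈ Phase.domain Δ (3 / 2 * ρ) (3 / 2 * σ), ∀ v w : Phase,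
            Phase.sympl s (fderiv ℂ 𝒞 z v) (fderiv ℂ 𝒞 z w) = Phase.sympl s v w) ∧
          -- compatible with the periodicity of the fast angle and with the real structure
          (∀ z ∈ Phase.domain Δ (3 / 2 * ρ) (3 / 2 * σ),
            𝒞 (z + ((2 * Real.pi : ℝ) : ℂ) • Phase.basisVec 0 1)
              = 𝒞 z + ((2 * Real.pi : ℝ) : ℂ) • Phase.basisVec 0 1) ∧
          (∀ z ∈ Phase.domain Δ (3 / 2 * ρ) (3 / 2 * σ), z.IsReal → (𝒞 z).IsReal) ∧
          -- size of the transformation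
          Set.MapsTo 𝒞 (Phase.domain Δ (3 / 2 * ρ) (3 / 2 * σ))
            (Phase.domain Δ (2 * ρ) (2 * σ)) ∧
          Set.InjOn 𝒞 (Phase.domain Δ (3 / 2 * ρ) (3 / 2 * σ)) ∧
          Phase.domain Δ (5 / 4 * ρ) (5 / 4 * σ)
            ⊆ 𝒞 '' Phase.domain Δ (3 / 2 * ρ) (3 / 2 * σ) ∧
          𝒞 '' Phase.domain Δ (3 / 2 * ρ) (3 / 2 * σ)
            ⊆ Phase.domain Δ (7 / 4 * ρ) (7 / 4 * σ) ∧
          -- transformed Hamiltonian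
          ∃ Hstar : Phase → ℂ,
            AnalyticOnNhd ℂ Hstar (Phase.domain Δ (3 / 2 * ρ) (3 / 2 * σ)) ∧
            ∀ z ∈ Phase.domain Δ (3 / 2 * ρ) (3 / 2 * σ),
              S.H ε (𝒞 z) = S.HK ε z + S.HPbar ε z + Hstar z ∧
              ‖Hstar z‖ ≤ 40 * (M * Real.pi / S.ω) *
                (ρ / σ + ε / (ρ * σ * S.delta ε Δ)) * M * (ε / S.delta ε Δ) := by
  obtain ⟨a, ρ₀, σ₀, C, M₀, ha, hρ₀, hσ₀, hC, hM₀, hρa, hlam, hups, hHP⟩ :=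
    S.exists_perturbation_bounds
  have hω := S.ω_pos
  have hπ := Real.pi_pos
  -- `M ≥ 100 M₀` makes the flow slow, and `M ^ 2 ≥ 10 ^ 4 M₀ ω / a` absorbs the detuning
  obtain ⟨M, hMM₀, hMa⟩ : ∃ M, 100 * M₀ ≤ M ∧ 100 * (S.ω / a) ≤ M :=
    ⟨max (100 * M₀) (100 * (S.ω / a)), le_max_left _ _, le_max_right _ _⟩
  have hωa : 0 < S.ω / a := div_pos hω ha
  have hM : 0 < M := by linarith
  refine ⟨ρ₀, σ₀, C, M, hρ₀, hσ₀, hC, hM, hups, ?_⟩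
  intro s ε Δ ρ σ hs hε hε1 hΔ hρ hσ hρρ₀ hρσ hσmin hsmall
  have hs1 : |s| = 1 := by rcases hs with rfl | rfl <;> simp
  obtain ⟨hσσ₀, hσδ⟩ := lt_min_iff.1 hσmin
  have hδ : 0 < S.delta ε Δ := by
    by_contra hneg
    have := div_nonpos_of_nonpos_of_nonneg (not_lt.1 hneg) (by linarith : 0 ≤ 32 * C)
    linarith
  have hP := hHP ε Δ ρ σ hε hε1 hΔ hρ hρρ₀ hρσ hσσ₀ hσδ
  set D := S.delta ε Δ with hD
  set N := M₀ * (ε / D) with hN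
  have hεD : 0 < ε / D := div_pos hε hδ
  have hN0 : 0 < N := mul_pos hM₀ hεD
  have hc := Phase.scaleFactor_pos hρ hσ
  have hU : Phase.IsFastStrip (Phase.openDomain hc Δ 4) := Phase.isFastStrip_openDomain hc hσ 4
  have hUdom : ∀ z ∈ Phase.openDomain hc Δ 4, z ∈ Phase.domain Δ (4 * ρ) (4 * σ) := fun z hz =>
    Phase.openDomain_subset_domain hc hρ hσ (by norm_num) hz
  have hdomU : ∀ z ∈ Phase.domain Δ (2 * ρ) (2 * σ), z ∈ Phase.openDomain hc Δ 4 := fun z hz =>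
    Phase.domain_subset_openDomain hc hρ hσ (by norm_num) (by norm_num) hz
  have hmono : ∀ {p q : ℝ}, 0 ≤ p → p ≤ q →
      Phase.domain Δ (p * ρ) (p * σ) ⊆ Phase.domain Δ (q * ρ) (q * σ) := fun hp hpq =>
    Phase.domain_mono (mul_nonneg hp hρ.le) (mul_nonneg hp hσ.le)
      (mul_le_mul_of_nonneg_right hpq hρ.le) (mul_le_mul_of_nonneg_right hpq hσ.le)
  have h74 : ∀ z ∈ Phase.domain Δ (7 / 4 * ρ) (7 / 4 * σ), z ∈ Phase.openDomain hc Δ 4 :=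
    fun z hz => hdomU z (hmono (by norm_num) (by norm_num) hz)
  have h32 : ∀ z ∈ Phase.domain Δ (3 / 2 * ρ) (3 / 2 * σ),
      z ∈ Phase.domain Δ (7 / 4 * ρ) (7 / 4 * σ) := fun z hz =>
    hmono (by norm_num) (by norm_num) hz
  -- the perturbation, its average and the generating function on the domain of width `4`
  have hPan : AnalyticOnNhd ℂ (S.HP ε) (Phase.openDomain hc Δ 4) :=
    fun z hz => (hP z (hUdom z hz)).1
  have hPN : ∀ z ∈ Phase.openDomain hc Δ 4, ‖S.HP ε z‖ ≤ N := fun z hz => (hP z (hUdom z hz)).2.1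
  have hPper : ∀ z ∈ Phase.openDomain hc Δ 4,
      S.HP ε (z + ((2 * Real.pi : ℝ) : ℂ) • Phase.fast) = S.HP ε z :=
    fun z hz => (hP z (hUdom z hz)).2.2.1
  have hPconj : ∀ z ∈ Phase.openDomain hc Δ 4, S.HP ε z.conjPoint = starRingEnd ℂ (S.HP ε z) :=
    fun z hz => (hP z (hUdom z hz)).2.2.2
  have hban : AnalyticOnNhd ℂ (S.HPbar ε) (Phase.openDomain hc Δ 4) :=
    hU.analyticOnNhd_fastAverage hPan
  have hbN : ∀ z ∈ Phase.openDomain hc Δ 4, ‖S.HPbar ε z‖ ≤ N := fun z hz =>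
    hU.norm_fastAverage_le hPN hz
  have hχan : AnalyticOnNhd ℂ (S.chi ε) (Phase.openDomain hc Δ 4) :=
    hU.analyticOnNhd_averagingGenerator hPan hω
  have hhom : ∀ z ∈ Phase.openDomain hc Δ 4,
      S.ω * Phase.partialDeriv 0 1 (S.chi ε) z = S.HPbar ε z - S.HP ε z :=
    fun z hz => hU.partialDeriv_averagingGenerator hPan hPper hω hz
  refine ⟨hPan.mono hdomU, hχan.mono hdomU, fun z hz => hhom z (hdomU z hz), fun z hz => ?_, ?_⟩
  · refine (hbN z (hdomU z hz)).trans ?_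
    rw [hN]
    gcongr
    linarith
  -- the flow has speed at most `κ` in rescaled coordinates
  set κ := 8 * Real.pi * N / (S.ω * (ρ * σ)) with hκ
  have hκ0 : 0 ≤ κ := by positivity
  have hκ1 : κ ≤ 1 / 100 := by
    have h1 : κ = 8 * Real.pi * M₀ / S.ω * (ε / (D * ρ * σ)) := by
      rw [hκ, hN]; field_simp
    have h2 : 8 * Real.pi * M₀ / S.ω * (S.ω / (32 * Real.pi * M)) = M₀ / (4 * M) := by
      field_simp; norm_num
    have h3 : κ ≤ M₀ / (4 * M) := by
      rw [h1, ← h2]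
      exact mul_le_mul_of_nonneg_left hsmall.le (by positivity)
    refine h3.trans ?_
    rw [div_le_div_iff₀ (by positivity) (by norm_num)]
    linarith
  have hχN : ∀ z ∈ Phase.openDomain hc Δ 4, ‖S.chi ε z‖ ≤ ρ * σ * (κ / 2) := fun z hz => by
    refine (hU.norm_averagingGenerator_le hPN hω hz).trans_eq ?_
    rw [hκ]
    field_simp
    norm_num
  obtain ⟨γ, hγan, hγ, hsym, hper, hreal, hinj, hsurj, hosc⟩ :=
    Phase.exists_timeOne_map hs1 hρ hσ hc Δ hχan hχN hκ1
      (fun z hz => hU.averagingGenerator_add_two_pi hPper S.ω hz)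
      (fun z hz => Phase.averagingGenerator_conjPoint hU hPconj S.ω hz)
  have h01 : (1 : ℝ) ∈ Icc (0 : ℝ) 1 := by simp
  have hmaps : ∀ z ∈ Phase.domain Δ (3 / 2 * ρ) (3 / 2 * σ),
      γ 1 z ∈ Phase.domain Δ (7 / 4 * ρ) (7 / 4 * σ) := fun z hz => ((hγ z hz).2 1 h01).1
  refine ⟨γ 1, hγan, fun z hz => ⟨fun t => γ t z, (hγ z hz).1, rfl, fun t ht =>
    ⟨((hγ z hz).2 t ht).1, ((hγ z hz).2 t ht).2.1⟩⟩, hsym, hper, hreal,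
    fun z hz => hmono (by norm_num) (by norm_num) (hmaps z hz), hinj, hsurj, ?_, ?_⟩
  · rintro _ ⟨z, hz, rfl⟩
    exact hmaps z hz
  -- the transformed Hamiltonian
  have haction : ∀ z ∈ Phase.domain Δ (7 / 4 * ρ) (7 / 4 * σ), ∀ j, S.action ε z j ≠ 0 ∧
      ‖((S.mu ε j ^ 2 * S.beta ε j ^ 3 : ℝ) : ℂ) / S.action ε z j ^ 3 - S.ω‖
        ≤ 152 * S.ω * ρ / a := by
    rintro z ⟨θ, -, h⟩ j
    have hl := S.lam0_pos hε.le j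
    have hal := hlam ε hε hε1 j
    have h1 := PlanetarySystem.norm_action_sub_le (S := S) (ε := ε) (fun j => (h j).2.1) j
    obtain ⟨h2, h3⟩ := norm_keplerFrequency_sub_le hω hl (L := S.action ε z j) (by linarith)
    rw [S.lam0_pow_three hε.le j]
    refine ⟨h2, h3.trans ?_⟩
    calc 38 * S.ω * ‖S.action ε z j - S.lam0 ε j‖ / S.lam0 ε j
        ≤ 38 * S.ω * (4 * ρ) / a := by gcongr; linarith
      _ = 152 * S.ω * ρ / a := by ring
  refine ⟨fun z => S.H ε (γ 1 z) - S.HK ε z - S.HPbar ε z, fun z hz => ?_,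
    fun z hz => ⟨by ring, ?_⟩⟩
  · have h2 : AnalyticAt ℂ (S.H ε) (γ 1 z) :=
      (PlanetarySystem.analyticAt_HK fun j => (haction _ (hmaps z hz) j).1).add
        (hPan _ (h74 _ (hmaps z hz)))
    exact ((h2.comp (hγan z hz)).sub
      (PlanetarySystem.analyticAt_HK fun j => (haction _ (h32 z hz) j).1)).sub
      (hban _ (h74 _ (h32 z hz)))
  · have hγ' := (hγ z hz).2
    have hE := PlanetarySystem.norm_energy_sub_le (S := S) (ε := ε) (s := s)
      (γ := fun t => γ t z) (χ := S.chi ε) (P := S.HP ε) (Pbar := S.HPbar ε)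
      (b := 152 * S.ω * ρ / a) (d := ρ * κ) (e := 2 * N * κ) (fun t ht => (hγ' t ht).2.1)
      (fun t ht j => (haction _ (hγ' t ht).1 j).1)
      (fun t ht => hhom _ (h74 _ (hγ' t ht).1))
      (fun t ht j => (haction _ (hγ' t ht).1 j).2) (fun t ht j => (hγ' t ht).2.2 j)
      (fun t ht => hosc _ N hPan hPN z hz 1 h01 t ht)
      (fun t ht => hosc _ N hban hbN z hz t ht 0 (by simp))
    have e1 : S.H ε (γ 1 z) - S.HK ε z - S.HPbar ε z = S.HK ε (γ 1 z) + S.HP ε (γ 1 z)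
        - S.HK ε (γ 0 z) - S.HPbar ε (γ 0 z) := by
      rw [(hγ z hz).1]
      rfl
    refine (congrArg norm e1).trans_le (hE.trans ?_)
    have hsq : M₀ ^ 2 ≤ M ^ 2 := pow_le_pow_left₀ hM₀.le (by linarith) 2
    have hsq' : 10000 * (M₀ * (S.ω / a)) ≤ M ^ 2 := by
      have := mul_le_mul hMM₀ hMa (by positivity) hM.le
      nlinarith
    calc 2 * (2 * N * κ) + 3 * (152 * S.ω * ρ / a * (ρ * κ))
        = 32 * (Real.pi / S.ω * (ε / D) * (ε / (ρ * σ * D))) * M₀ ^ 2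
          + 3648 * (Real.pi / S.ω * (ε / D) * (ρ / σ)) * (M₀ * (S.ω / a)) := by
          rw [hκ, hN]; field_simp; ring
      _ ≤ 40 * (Real.pi / S.ω * (ε / D) * (ε / (ρ * σ * D))) * M ^ 2
          + 40 * (Real.pi / S.ω * (ε / D) * (ρ / σ)) * M ^ 2 := by
          have p1 : 0 ≤ Real.pi / S.ω * (ε / D) * (ε / (ρ * σ * D)) := by positivity
          have p2 : 0 ≤ Real.pi / S.ω * (ε / D) * (ρ / σ) := by positivity
          have q1 := mul_le_mul_of_nonneg_left hsq p1
          have q2 := mul_le_mul_of_nonneg_left hsq' p2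
          have q3 := mul_nonneg p1 (sq_nonneg M₀)
          have q4 := mul_nonneg p2 (mul_pos hM₀ hωa).le
          linarith
      _ = 40 * (M * Real.pi / S.ω) * (ρ / σ + ε / (ρ * σ * D)) * M * (ε / D) := by ring
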